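/- Let $d\ge 1$, $T>0$ and $1/3<\gamma\le 1/2$. Let $b\in L^\infty([0,T];L^\infty(\mathbb R^d;\mathbb R^d)\cap C^1(\mathbb R^d;\mathbb R^d))$, i.e. $b$ is measurable on $[0,T]\times\mathbb R^d$, $b_t$ is continuously differentiable for almost every $t$, $\operatorname{ess\,sup}_{t}\sup_{x}|b_t(x)|<\infty$ and $\operatorname{ess\,sup}_{t}\sup_{|x|\le R}|Db_t(x)|<\infty$ for every $R>0$. Assume that $\operatorname{div} b\in L^\infty([0,T]\times\mathbb R^d)$. Let $\mathbf X=(X,\mathbb X)$ be a geometric $\gamma$-rough path on $[0,T]$ with values in $\mathbb R^d$. That is, $X$ is $\gamma$-Hölder on $[0,T]$; $\mathbb X:[0,T]^2\to\mathbb R^{d\times d}$ is continuous with $|\mathbb X_{s,t}|\le C|t-s|^{2\gamma}$; Chen's relation $\mathbb X_{s,t}-\mathbb X_{s,r}-\mathbb X_{r,t}=(X_r-X_s)\otimes(X_t-X_r)$ holds for $0\le s\le r\le t\le T$; and there are $X^n\in C^1([0,T];\mathbb R^d)$ whose natural lifts $(X^n,\mathbb X^n)$, $\mathbb X^n_{s,t}=\int_s^t(X^n_r-X^n_s)\otimes\dot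 X^n_r\,dr$, satisfy $$|X_0-X^n_0|+\sup_{s\ne t}\frac{|(X-X^n)_t-(X-X^n)_s|}{|t-s|^\gamma}+\sup_{s\neq t}\frac{|\mathbb X_{s,t}-\mathbb X^n_{s,t}|}{|t-s|^{2\gamma}}\to0 .$$ Then for every $u_0\in L^\infty(\mathbb R^d)$ there is exactly one weak controlled solution $u\in L^\infty([0,T]\times\mathbb R^d)$ (as an equivalence class for almost everywhere equality) of the rough transport equation $$\partial_t u_t(x)+b_t(x)\cdot\nabla u_t(x)+\nabla u_t(x)\cdot d\mathbf X_t=0$$ with initial condition $u_0$. Here $u\in L^\infty([0,T]\times\mathbb R^d)$ is called a weak controlled solution with initial condition $u_0$ if for every $\varphi\in C_c^\infty(\mathbb R^d)$ the map $t\mapsto u_t(\varphi)=\int_{\mathbb R^d}u_t(x)\varphi(x)\,dx$, defined for almost every $t\in[0,T]$, has a continuous version on $[0,T]$, still denoted by $u(\varphi)$, such that for every $\varphi\in C_c^\infty(\mathbb R^d)$: 1. $u(\varphi)$ is controlled by $X$ with derivative $u(\nabla\varphi)=(u(\partial_k\varphi))_{1\le k\le d}$: the paths $u(\varphi)$ and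 $u(\nabla\varphi)$ are $\gamma$-Hölder on $[0,T]$, and the remainder $u_t(\varphi)-u_s(\varphi)-u_s(\nabla\varphi)\cdot(X_t-X_s)$ is continuous on $[0,T]^2$ and bounded by $C_\varphi|t-s|^{2\gamma}$; 2. for every $t\in[0,T]$, $$u_t(\varphi)=\int_{\mathbb R^d}u_0\varphi\,dx+\int_0^t u_s\big(b_s\cdot\nabla\varphi+\operatorname{div}(b_s)\,\varphi\big)\,ds+\int_0^t u_s(\nabla\varphi)\,d\mathbf X_s ,$$ where the last term is the controlled rough integral, i.e. the limit, which is part of the requirement, of the sums $$\sum_i\Big(\sum_k u_{t_i}(\partial_k\varphi)\,(X^k_{t_{i+1}}-X^k_{t_i})+\sum_{j,k}u_{t_i}(\partial_j\partial_k\varphi)\,\mathbb X^{jk}_{t_i,t_{i+1}}\Big)$$ over partitions $(t_i)$ of $[0,t]$ as their mesh tends to $0$. -/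

import Mathlib

open MeasureTheory Set Filter Topology
open scoped ContDiff ENNReal RealInnerProductSpace

noncomputable section

namespace RoughTransport

/-- The Euclidean space `ℝ^d`. -/
abbrev E (d : ℕ) : Type := EuclideanSpace ℝ (Fin d)

/-! ### Hölder spaces on the time interval `[0,T]` -/

/-- `f ∈ 𝒞^ν([0,T]; F)`, i.e. `f` is `ν`-Hölder on `[0,T]`. -/
def IsHolder {F : Type*} [NormedAddCommGroup F] (T ν : ℝ) (f : ℝ → F) : Prop :=
  ∃ C : ℝ, ∀ s ∈ Icc 0 T, ∀ t ∈ Icc 0 T, ‖f t - f s‖ ≤ C * |t - s| ^ ν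

/-- `A ∈ 𝒞_2^ν([0,T]²; F)`: `A` is continuous on `[0,T]²`, vanishes on the diagonal and
`‖A s t‖ ≤ C |t - s|^ν`. -/
def IsHolderTwo {F : Type*} [NormedAddCommGroup F] (T ν : ℝ) (A : ℝ → ℝ → F) : Prop :=
  ContinuousOn (fun p : ℝ × ℝ => A p.1 p.2) (Icc 0 T ×ˢ Icc 0 T) ∧
  (∀ s ∈ Icc 0 T, A s s = 0) ∧
  ∃ C : ℝ, ∀ s ∈ Icc 0 T, ∀ t ∈ Icc 0 T, ‖A s t‖ ≤ C * |t - s| ^ ν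

/-! ### Rough paths -/

/-- `(X, XX)` is a `γ`-rough path on `[0,T]`; the last clause is Chen's relation. -/
structure IsRoughPath {d : ℕ} (T γ : ℝ) (X : ℝ → E d)
    (XX : ℝ → ℝ → Matrix (Fin d) (Fin d) ℝ) : Prop where
  path_holder : IsHolder T γ X
  area_holder : ∀ i j, IsHolderTwo T (2 * γ) (fun s t => XX s t i j)
  chen : ∀ s u t, 0 ≤ s → s ≤ u → u ≤ t → t ≤ T → ∀ i j,
    XX s t i j - XX s u i j - XX u t i j = (X u i - X s i) * (X t j - X u j)

/-- The natural lift of a `C¹` path `Y` on `[0,T]`: `∫_s^t (Y_r - Y_s) ⊗ Y'_r dr`. -/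
def naturalLift {d : ℕ} (T : ℝ) (Y : ℝ → E d) (s t : ℝ) : Matrix (Fin d) (Fin d) ℝ :=
  Matrix.of fun i j => ∫ r in s..t, (Y r i - Y s i) * (derivWithin Y (Icc 0 T) r) j

/-- `(X, XX)` and `(Y, YY)` are at distance at most `ε` in the rough path distance
`‖X - Y‖_γ + ‖XX - YY‖_{2γ}` (each of the summands being at most `ε`). -/
def RoughClose {d : ℕ} (T γ ε : ℝ) (X : ℝ → E d) (XX : ℝ → ℝ → Matrix (Fin d) (Fin d) ℝ)
    (Y : ℝ → E d) (YY : ℝ → ℝ → Matrix (Fin d) (Fin d) ℝ) : Prop :=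
  ‖X 0 - Y 0‖ ≤ ε ∧
  (∀ s ∈ Icc 0 T, ∀ t ∈ Icc 0 T, ‖(X t - Y t) - (X s - Y s)‖ ≤ ε * |t - s| ^ γ) ∧
  ∀ s ∈ Icc 0 T, ∀ t ∈ Icc 0 T, ∀ i j,
    |XX s t i j - YY s t i j| ≤ ε * |t - s| ^ (2 * γ)

/-- `(X, XX)` is a geometric `γ`-rough path on `[0,T]`: a rough path which is the limit, for the
rough path distance, of the natural lifts of a sequence of `C¹` paths. -/
def IsGeometricRoughPath {d : ℕ} (T γ : ℝ) (X : ℝ → E d)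
    (XX : ℝ → ℝ → Matrix (Fin d) (Fin d) ℝ) : Prop :=
  IsRoughPath T γ X XX ∧
  ∃ Y : ℕ → ℝ → E d,
    (∀ n, ContDiffOn ℝ 1 (Y n) (Icc 0 T)) ∧
    ∀ ε > 0, ∀ᶠ n in atTop, RoughClose T γ ε X XX (Y n) (naturalLift T (Y n))

/-- The real path `y` is `γ`-controlled by `X` on `[0,T]` with (Gubinelli) derivative `y'`:
`y_t - y_s = y'_s · (X_t - X_s) + y^#_{s,t}` with `y, y' ∈ 𝒞^γ` and `y^# ∈ 𝒞_2^{2γ}`. -/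
def IsControlled {d : ℕ} (T γ : ℝ) (X : ℝ → E d) (y : ℝ → ℝ) (y' : ℝ → E d) : Prop :=
  IsHolder T γ y ∧ IsHolder T γ y' ∧
  IsHolderTwo T (2 * γ) (fun s t => y t - y s - ⟪y' s, X t - X s⟫)

/-- The compensated Riemann sum along `p 0 ≤ p 1 ≤ ⋯ ≤ p n` of an `ℝ^d`-valued controlled path
with components `a k`, whose derivatives are `a' k`. -/
def roughRiemannSum {d : ℕ} (X : ℝ → E d) (XX : ℝ → ℝ → Matrix (Fin d) (Fin d) ℝ)
    (a : Fin d → ℝ → ℝ) (a' : Fin d → ℝ → E d) (n : ℕ) (p : ℕ → ℝ) : ℝ :=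
  ∑ i ∈ Finset.range n,
    (∑ k, a k (p i) * (X (p (i + 1)) k - X (p i) k)
      + ∑ k, ∑ j, a' k (p i) j * XX (p i) (p (i + 1)) j k)

/-- `∫_s^t a dX = I` as a controlled rough integral: the compensated Riemann sums converge to `I`
as the mesh of the partition of `[s,t]` tends to `0`. -/
def HasRoughIntegral {d : ℕ} (X : ℝ → E d) (XX : ℝ → ℝ → Matrix (Fin d) (Fin d) ℝ)
    (a : Fin d → ℝ → ℝ) (a' : Fin d → ℝ → E d) (s t I : ℝ) : Prop :=
  ∀ ε > 0, ∃ δ > 0, ∀ (n : ℕ) (p : ℕ → ℝ), Monotone p → p 0 = s → p n = t →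
    (∀ i < n, p (i + 1) - p i < δ) → |roughRiemannSum X XX a a' n p - I| < ε

/-! ### Function spaces on `ℝ^d` and `[0,T] × ℝ^d` -/

/-- Lebesgue measure on `[0,T] × ℝ^d`. -/
def spaceTime (d : ℕ) (T : ℝ) : Measure (ℝ × E d) :=
  ((volume : Measure ℝ).restrict (Icc 0 T)).prod (volume : Measure (E d))

/-- `φ ∈ C_c^∞(ℝ^d)`. -/
def IsTest {d : ℕ} (φ : E d → ℝ) : Prop := ContDiff ℝ ∞ φ ∧ HasCompactSupport φ

/-- The partial derivative `∂_k φ`. -/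
def partialDeriv {d : ℕ} (k : Fin d) (φ : E d → ℝ) (x : E d) : ℝ :=
  fderiv ℝ φ x (EuclideanSpace.single k 1)

/-- The divergence of a vector field. -/
def divergence {d : ℕ} (v : E d → E d) (x : E d) : ℝ :=
  ∑ k, (fderiv ℝ v x (EuclideanSpace.single k 1)) k

/-- `b ∈ L^∞([0,T]; L^∞(ℝ^d) ∩ C^1(ℝ^d))`, where `C^1(ℝ^d)` carries its usual topology of locally
uniform convergence of the function and of its first derivatives. -/
structure IsLinftyC1 {d : ℕ} (T : ℝ) (b : ℝ → E d → E d) : Prop where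
  aestronglyMeasurable :
    AEStronglyMeasurable (fun z : ℝ × E d => b z.1 z.2) (spaceTime d T)
  contDiff : ∀ᵐ t ∂(volume.restrict (Icc 0 T)), ContDiff ℝ 1 (b t)
  bounded : ∃ C : ℝ, ∀ᵐ t ∂(volume.restrict (Icc 0 T)), ∀ x, ‖b t x‖ ≤ C
  deriv_bounded : ∀ R : ℝ, ∃ C : ℝ, ∀ᵐ t ∂(volume.restrict (Icc 0 T)),
    ∀ x, ‖x‖ ≤ R → ‖fderiv ℝ (b t) x‖ ≤ C

/-! ### Weak controlled solutions -/

/-- `u ∈ L^∞([0,T] × ℝ^d)` is a weak controlled solution of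
`∂_t u + b · ∇u + ∇u · dX = 0` with initial condition `u₀`.

An element of `L^∞([0,T] × ℝ^d)` determines `u_t(φ) = ∫ u(t,x) φ(x) dx` for almost every `t` only;
`U φ` is the (necessarily unique) version of `t ↦ u_t(φ)` which is continuous on `[0,T]`.
The path `u(φ)` is controlled by `X` with derivative `u(∇φ)`, hence the components
`u(∂_k φ)` of the integrand `u(∇φ)` have the derivatives `u(∇ ∂_k φ)`. -/
def IsWeakControlledSolution {d : ℕ} (T γ : ℝ) (b : ℝ → E d → E d)
    (X : ℝ → E d) (XX : ℝ → ℝ → Matrix (Fin d) (Fin d) ℝ)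
    (u₀ : Lp ℝ ∞ (volume : Measure (E d))) (u : Lp ℝ ∞ (spaceTime d T)) : Prop :=
  ∃ U : (E d → ℝ) → ℝ → ℝ, ∀ φ : E d → ℝ, IsTest φ →
    (∀ᵐ t ∂(volume.restrict (Icc 0 T)), U φ t = ∫ x, u (t, x) * φ x) ∧
    IsControlled T γ X (U φ) (fun t => WithLp.toLp 2 fun k => U (partialDeriv k φ) t) ∧
    ∀ t ∈ Icc 0 T, ∃ I : ℝ,
      HasRoughIntegral X XX (fun k => U (partialDeriv k φ))
        (fun k s => WithLp.toLp 2 fun j => U (partialDeriv j (partialDeriv k φ)) s) 0 t I ∧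
      U φ t = (∫ x, u₀ x * φ x)
        + (∫ s in (0 : ℝ)..t,
            ∫ x, u (s, x) * (fderiv ℝ φ x (b s x) + divergence (b s) x * φ x))
        + I

end RoughTransport

end

/-! The noise is removed by moving along with it. If u solves the rough equation, then v_t(x) =
u_t(x + X_t) formally solves ∂_t v + c·∇v = 0 with c_t(x) = b_t(x + X_t), and c satisfies the same
global bounds as b, with local bounds on Dc. Passing from u to v transfers uniqueness, passing from
v to u transfers existence, and what remains is a transport equation without noise whose field is
locally Lipschitz in space with bounded divergence.

From u to v (`IsSolutionVersion.local_bound`): for a test function φ, the path t ↦ u_t(φ(· - X_t))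
minus the time integral of the shifted drift has increments of order |t - s|^{3γ}, hence is constant
because 3γ > 1. Three expansions enter: Taylor's formula for φ(· - X_t), the sewing estimate that
replaces the rough integral by its germ (`IsRoughPath.exists_integral_bound`), and the controlled
expansion of u(∇φ). Since the rough path is geometric, the symmetric part of 𝕏 is half the square of
the increment, and the Hessian of φ sees nothing else (`germ_eq`); the terms of first and second
order then cancel. The condition γ ≤ 1/2 makes the drift errors, of order 1 + γ, negligible against
3γ. From v to u (`isSolutionVersion_shiftVersion`) the same expansions apply to paths v(φ) that are
Lipschitz in time.

Existence for the transport equation is by duality. For Φ vanishing at time T, renormalization with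
a smooth absolute value gives ∫|Φ_0| ≤ ∫∫|∂_tΦ + div(cΦ)| (`integral_abs_le_dualOp`). Hence the
functional -∫v₀Φ_0 of ∂_tΦ + div(cΦ) is dominated by an L¹ norm and is represented by a bounded
function (`exists_bounded_representation`).

Uniqueness follows DiPerna and Lions. The mollification of v solves the equation up to a commutator,
which tends to zero at Lebesgue points because c is locally Lipschitz. The limit is a localized
energy inequality for v² (`IsWeakTransport.energy_le`); an integrable weight with bounded
logarithmic gradient, together with an exponential factor in time, forces v = 0
(`IsWeakTransport.ae_eq_zero`). -/

noncomputable section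
namespace RoughTransport

/-! ### Test functions, translations and Taylor expansions -/

variable {d : ℕ}

/-- The translate `x ↦ φ (x + a)`. -/
def tau (a : E d) (φ : E d → ℝ) : E d → ℝ := fun x => φ (x + a)

/-- The formal adjoint `c · ∇φ + (div c) φ` of `-c · ∇`. -/
def adv (c : E d → E d) (φ : E d → ℝ) (x : E d) : ℝ :=
  fderiv ℝ φ x (c x) + divergence c x * φ x

theorem IsTest.add {φ ψ : E d → ℝ} (hφ : IsTest φ) (hψ : IsTest ψ) : IsTest (φ + ψ) :=
  ⟨hφ.1.add hψ.1, hφ.2.add hψ.2⟩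

theorem IsTest.smul {φ : E d → ℝ} (a : ℝ) (hφ : IsTest φ) : IsTest (a • φ) :=
  ⟨contDiff_const.smul hφ.1, hφ.2.smul_left (f := fun _ => a)⟩

theorem isTest_zero : IsTest (0 : E d → ℝ) := ⟨contDiff_const, HasCompactSupport.zero⟩

theorem IsTest.sub {φ ψ : E d → ℝ} (hφ : IsTest φ) (hψ : IsTest ψ) : IsTest (φ - ψ) := by
  have := hφ.add (hψ.smul (-1))
  rwa [neg_one_smul, ← sub_eq_add_neg] at this

theorem IsTest.sum {ι : Type*} (s : Finset ι) {φ : ι → E d → ℝ} (hφ : ∀ i, IsTest (φ i)) :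
    IsTest (∑ i ∈ s, φ i) := by
  classical
  induction s using Finset.induction_on with
  | empty => simpa using isTest_zero
  | insert i s hi ih => rw [Finset.sum_insert hi]; exact (hφ i).add ih

theorem IsTest.tau {φ : E d → ℝ} (a : E d) (hφ : IsTest φ) : IsTest (tau a φ) :=
  ⟨hφ.1.comp (contDiff_id.add contDiff_const), hφ.2.comp_homeomorph (Homeomorph.addRight a)⟩

theorem IsTest.partialDeriv {φ : E d → ℝ} (k : Fin d) (hφ : IsTest φ) :
    IsTest (partialDeriv k φ) :=
  ⟨(hφ.1.fderiv_right (m := ∞) (by simp)).clm_apply contDiff_const,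
    (hφ.2.fderiv_apply (𝕜 := ℝ) _)⟩

theorem IsTest.differentiable {φ : E d → ℝ} (hφ : IsTest φ) : Differentiable ℝ φ :=
  hφ.1.differentiable (by simp)

theorem IsTest.continuous {φ : E d → ℝ} (hφ : IsTest φ) : Continuous φ := hφ.1.continuous

theorem fderiv_tau (a : E d) (φ : E d → ℝ) (x : E d) :
    fderiv ℝ (tau a φ) x = fderiv ℝ φ (x + a) := fderiv_comp_add_right a

theorem partialDeriv_tau (a : E d) (k : Fin d) (φ : E d → ℝ) :
    partialDeriv k (tau a φ) = tau a (partialDeriv k φ) := by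
  funext x; simp only [partialDeriv, fderiv_tau]; rfl

theorem tau_zero (φ : E d → ℝ) : tau 0 φ = φ := by funext x; simp [tau]

theorem clm_apply_eq_sum {F : Type*} [NormedAddCommGroup F] [NormedSpace ℝ F]
    (L : E d →L[ℝ] F) (h : E d) :
    L h = ∑ k, h k • L (EuclideanSpace.single k 1) := by
  conv_lhs => rw [← (EuclideanSpace.basisFun (Fin d) ℝ).sum_repr h]
  simp

theorem fderiv_apply_eq_sum (φ : E d → ℝ) (x h : E d) :
    fderiv ℝ φ x h = ∑ k, h k * partialDeriv k φ x := by
  rw [clm_apply_eq_sum]; rfl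

theorem abs_coord_le (h : E d) (k : Fin d) : |h k| ≤ ‖h‖ := by
  simpa using PiLp.norm_apply_le h k

theorem IsTest.exists_bound {φ : E d → ℝ} (hφ : IsTest φ) : ∃ A, 0 ≤ A ∧ ∀ x, |φ x| ≤ A := by
  obtain ⟨A, hA⟩ := hφ.2.exists_bound_of_continuous hφ.continuous
  exact ⟨A, (norm_nonneg _).trans (hA 0), hA⟩

theorem exists_radius {F : Type*} [Zero F] {f : E d → F} (hf : HasCompactSupport f) :
    ∃ R, 0 ≤ R ∧ ∀ x, R < ‖x‖ → f x = 0 := by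
  obtain ⟨R, hR⟩ := (Metric.isBounded_iff_subset_closedBall 0).1 hf.isCompact.isBounded
  refine ⟨max R 0, le_max_right _ _, fun x hx => ?_⟩
  by_contra h
  have := hR (subset_tsupport f h)
  rw [mem_closedBall_zero_iff] at this
  exact absurd (lt_of_le_of_lt (le_max_left R 0) hx) (not_lt.2 this)

theorem IsTest.exists_radius {φ : E d → ℝ} (hφ : IsTest φ) :
    ∃ R, 0 ≤ R ∧ ∀ x, R < ‖x‖ → φ x = 0 := RoughTransport.exists_radius hφ.2

theorem IsTest.hasDerivAt_line {φ : E d → ℝ} (hφ : IsTest φ) (x h : E d) (r : ℝ) :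
    HasDerivAt (fun r : ℝ => φ (x + r • h)) (∑ k, h k * RoughTransport.partialDeriv k φ (x + r • h))
      r := by
  have h1 : HasDerivAt (fun r : ℝ => x + r • h) h r := by
    simpa using ((hasDerivAt_id r).smul_const h).const_add x
  have := (hφ.differentiable (x + r • h)).hasFDerivAt.comp_hasDerivAt r h1
  rwa [fderiv_apply_eq_sum] at this

theorem IsTest.taylor_one {φ : E d → ℝ} (hφ : IsTest φ) :
    ∃ C, 0 ≤ C ∧ ∀ x h, |φ (x + h) - φ x| ≤ C * ‖h‖ := by
  choose A hA0 hA using fun k => (hφ.partialDeriv k).exists_bound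
  refine ⟨∑ k, A k, Finset.sum_nonneg fun k _ => hA0 k, fun x h => ?_⟩
  have := norm_image_sub_le_of_norm_deriv_le_segment_01' (f := fun r : ℝ => φ (x + r • h))
    (C := (∑ k, A k) * ‖h‖) (fun r _ => (hφ.hasDerivAt_line x h r).hasDerivWithinAt) (fun r _ => by
      rw [Finset.sum_mul]
      refine norm_sum_le_of_le _ fun k _ => ?_
      rw [norm_mul, mul_comm]
      exact mul_le_mul (hA k _) (abs_coord_le h k) (norm_nonneg _) (hA0 k))
  simpa using this

/-- Each order follows from the previous one applied to the partial derivatives: along r ↦ φ(x + r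
h) minus its Taylor polynomial, the derivative is h paired with the lower-order remainders of the
∂_kφ. The constants are not sharp. -/
theorem IsTest.taylor_two {φ : E d → ℝ} (hφ : IsTest φ) :
    ∃ C, 0 ≤ C ∧ ∀ x h, |φ (x + h) - φ x - ∑ k, h k * RoughTransport.partialDeriv k φ x|
      ≤ C * ‖h‖ ^ 2 := by
  choose A hA0 hA using fun k => (hφ.partialDeriv k).taylor_one
  refine ⟨∑ k, A k, Finset.sum_nonneg fun k _ => hA0 k, fun x h => ?_⟩
  have := norm_image_sub_le_of_norm_deriv_le_segment_01'
    (f := fun r : ℝ => φ (x + r • h) - r * ∑ k, h k * RoughTransport.partialDeriv k φ x)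
    (C := (∑ k, A k) * ‖h‖ ^ 2)
    (fun r _ => ((hφ.hasDerivAt_line x h r).sub
      ((hasDerivAt_id r).mul_const _)).hasDerivWithinAt) (fun r hr => by
      rw [one_mul, ← Finset.sum_sub_distrib, Finset.sum_mul]
      refine norm_sum_le_of_le _ fun k _ => ?_
      rw [← mul_sub, norm_mul]
      have h1 := hA k x (r • h)
      have h2 : ‖r • h‖ ≤ ‖h‖ := by
        rw [norm_smul, Real.norm_of_nonneg hr.1]
        exact mul_le_of_le_one_left (norm_nonneg _) hr.2.le
      calc _ ≤ ‖h‖ * (A k * ‖h‖) := mul_le_mul (abs_coord_le h k)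
            (h1.trans (mul_le_mul_of_nonneg_left h2 (hA0 k))) (abs_nonneg _) (norm_nonneg _)
        _ = A k * ‖h‖ ^ 2 := by ring)
  simpa [sub_right_comm] using this

theorem IsTest.taylor_three {φ : E d → ℝ} (hφ : IsTest φ) :
    ∃ C, 0 ≤ C ∧ ∀ x h, |φ (x + h) - φ x - ∑ k, h k * RoughTransport.partialDeriv k φ x
      - 1 / 2 * ∑ k, ∑ j, h k * h j *
        RoughTransport.partialDeriv j (RoughTransport.partialDeriv k φ) x| ≤ C * ‖h‖ ^ 3 := by
  choose A hA0 hA using fun k => (hφ.partialDeriv k).taylor_two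
  refine ⟨∑ k, A k, Finset.sum_nonneg fun k _ => hA0 k, fun x h => ?_⟩
  have := norm_image_sub_le_of_norm_deriv_le_segment_01'
    (f := fun r : ℝ => φ (x + r • h) - r * ∑ k, h k * RoughTransport.partialDeriv k φ x
      - r ^ 2 * (1 / 2 * ∑ k, ∑ j, h k * h j *
        RoughTransport.partialDeriv j (RoughTransport.partialDeriv k φ) x))
    (C := (∑ k, A k) * ‖h‖ ^ 3)
    (fun r _ => (((hφ.hasDerivAt_line x h r).sub
      ((hasDerivAt_id r).mul_const _)).sub ((hasDerivAt_pow 2 r).mul_const _)).hasDerivWithinAt)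
    (fun r hr => by
      have e : ∑ k, h k * RoughTransport.partialDeriv k φ (x + r • h)
          - 1 * ∑ k, h k * RoughTransport.partialDeriv k φ x
          - (((2 : ℕ) : ℝ) * r ^ (2 - 1)) * (1 / 2 * ∑ k, ∑ j, h k * h j *
            RoughTransport.partialDeriv j (RoughTransport.partialDeriv k φ) x)
          = ∑ k, h k * (RoughTransport.partialDeriv k φ (x + r • h)
            - RoughTransport.partialDeriv k φ x - ∑ j, (r • h) j *
            RoughTransport.partialDeriv j (RoughTransport.partialDeriv k φ) x) := by
        rw [one_mul, ← Finset.sum_sub_distrib, ← mul_assoc, Finset.mul_sum,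
          ← Finset.sum_sub_distrib]
        refine Finset.sum_congr rfl fun k _ => ?_
        rw [Finset.mul_sum, mul_sub, mul_sub, Finset.mul_sum]
        congr 1
        refine Finset.sum_congr rfl fun j _ => ?_
        simp only [PiLp.smul_apply, smul_eq_mul]; norm_num; ring
      rw [e, Finset.sum_mul]
      refine norm_sum_le_of_le _ fun k _ => ?_
      rw [norm_mul]
      have h1 := hA k x (r • h)
      have h2 : ‖r • h‖ ≤ ‖h‖ := by
        rw [norm_smul, Real.norm_of_nonneg hr.1]
        exact mul_le_of_le_one_left (norm_nonneg _) hr.2.le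
      calc _ ≤ ‖h‖ * (A k * ‖h‖ ^ 2) := mul_le_mul (abs_coord_le h k)
            (h1.trans (mul_le_mul_of_nonneg_left (by gcongr) (hA0 k)))
            (abs_nonneg _) (norm_nonneg _)
        _ = A k * ‖h‖ ^ 3 := by ring)
  -- The auxiliary function is compared at its endpoints r = 1 and r = 0; this normalizes the two
  -- values.
  have e2 : ∀ a b c p : ℝ, a - 1 * b - 1 ^ 2 * c - (p - 0 * b - 0 ^ 2 * c) = a - p - b - c := by
    intros; ring
  rw [e2] at this
  simpa using this

/-! ### Integration by parts against a `C¹` vector field -/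

/-- For a C¹ field, `adv c f` is div(f c), the divergence of a compactly supported field; each
coordinate is integrated by parts separately. -/
theorem integral_adv_eq_zero {c : E d → E d} (hc : ContDiff ℝ 1 c) {f : E d → ℝ}
    (hf : ContDiff ℝ 1 f) (hf' : HasCompactSupport f) : ∫ x, adv c f x = 0 := by
  have hck : ∀ k, ContDiff ℝ 1 fun x => c x k := fun k =>
    (EuclideanSpace.proj (𝕜 := ℝ) k).contDiff.comp hc
  have hfd : Continuous (fderiv ℝ f) := hf.continuous_fderiv one_ne_zero
  have hcd : ∀ k, Continuous (fderiv ℝ fun x => c x k) :=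
    fun k => (hck k).continuous_fderiv one_ne_zero
  have e : ∀ x, adv c f x = ∑ k, (fderiv ℝ f x (EuclideanSpace.single k 1) * c x k
      + f x * fderiv ℝ (fun y => c y k) x (EuclideanSpace.single k 1)) := by
    intro x
    rw [Finset.sum_add_distrib, adv, clm_apply_eq_sum, divergence, Finset.sum_mul]
    congr 1
    · exact Finset.sum_congr rfl fun k _ => by simp [mul_comm]
    · refine Finset.sum_congr rfl fun k _ => ?_
      have : HasFDerivAt (fun y => c y k)
          ((EuclideanSpace.proj (𝕜 := ℝ) k : E d →L[ℝ] ℝ).comp (fderiv ℝ c x)) x :=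
        (EuclideanSpace.proj (𝕜 := ℝ) k : E d →L[ℝ] ℝ).hasFDerivAt.comp x
          (hc.differentiable one_ne_zero x).hasFDerivAt
      rw [this.fderiv, mul_comm]; simp
  have i1 : ∀ k, Integrable fun x => fderiv ℝ f x (EuclideanSpace.single k 1) * c x k := fun k =>
    ((hfd.clm_apply continuous_const).mul (hck k).continuous).integrable_of_hasCompactSupport
      ((hf'.fderiv_apply (𝕜 := ℝ) _).mul_right)
  have i2 : ∀ k, Integrable fun x =>
      f x * fderiv ℝ (fun y => c y k) x (EuclideanSpace.single k 1) := fun k =>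
    (hf.continuous.mul ((hcd k).clm_apply continuous_const)).integrable_of_hasCompactSupport
      hf'.mul_right
  have i3 : ∀ k, Integrable fun x => fderiv ℝ f x (EuclideanSpace.single k 1) * c x k
      + f x * fderiv ℝ (fun y => c y k) x (EuclideanSpace.single k 1) :=
    fun k => (i1 k).add (i2 k)
  simp_rw [e]
  rw [integral_finsetSum _ fun k _ => i3 k]
  refine Finset.sum_eq_zero fun k _ => ?_
  rw [integral_add (i1 k) (i2 k), integral_mul_fderiv_eq_neg_fderiv_mul_of_integrable (i1 k) (i2 k)
    ((hf.continuous.mul (hck k).continuous).integrable_of_hasCompactSupport hf'.mul_right)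
    (fun x _ => hf.differentiable one_ne_zero x)
    (fun x _ => (hck k).differentiable one_ne_zero x), add_neg_cancel]

end RoughTransport
end

noncomputable section
namespace RoughTransport

/-! ### Bounded functions, regular vector fields and the drift -/

variable {d : ℕ} {T K M D : ℝ}

/-- `u` is measurable on `[0,T] × ℝ^d` and bounded by `K`. -/
structure IsBdd (T K : ℝ) (u : ℝ × E d → ℝ) : Prop where
  nonneg : 0 ≤ K
  meas : AEStronglyMeasurable u (spaceTime d T)
  bound : ∀ᵐ z ∂(spaceTime d T), |u z| ≤ K

/-- `b` is a vector field of class `C¹` in space, with global bounds for the field and its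
divergence and local bounds for its derivative. -/
structure IsRegular (T M D : ℝ) (b : ℝ → E d → E d) : Prop where
  M_nonneg : 0 ≤ M
  D_nonneg : 0 ≤ D
  meas : AEStronglyMeasurable (fun z : ℝ × E d => b z.1 z.2) (spaceTime d T)
  div_meas : AEStronglyMeasurable (fun z : ℝ × E d => divergence (b z.1) z.2) (spaceTime d T)
  contDiff : ∀ᵐ t ∂(volume.restrict (Icc 0 T)), ContDiff ℝ 1 (b t)
  bound : ∀ᵐ t ∂(volume.restrict (Icc 0 T)), ∀ x, ‖b t x‖ ≤ M
  div_bound : ∀ᵐ t ∂(volume.restrict (Icc 0 T)), ∀ x, |divergence (b t) x| ≤ D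
  deriv_bound : ∀ R : ℝ, ∃ C : ℝ, ∀ᵐ t ∂(volume.restrict (Icc 0 T)),
    ∀ x, ‖x‖ ≤ R → ‖fderiv ℝ (b t) x‖ ≤ C

/-- The volume of the ball of radius `R`. -/
def vol (d : ℕ) (R : ℝ) : ℝ := (volume (Metric.closedBall (0 : E d) R)).toReal

theorem vol_nonneg (R : ℝ) : 0 ≤ vol d R := ENNReal.toReal_nonneg

theorem integrable_indicator_ball (B R : ℝ) :
    Integrable ((Metric.closedBall (0 : E d) R).indicator fun _ => B) :=
  (integrable_indicator_iff Metric.isClosed_closedBall.measurableSet).2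
    (integrableOn_const measure_closedBall_lt_top.ne)

theorem abs_le_indicator_ball {f : E d → ℝ} {B R : ℝ} (h : ∀ᵐ x, |f x| ≤ B)
    (h0 : ∀ x, R < ‖x‖ → f x = 0) :
    ∀ᵐ x, ‖f x‖ ≤ (Metric.closedBall (0 : E d) R).indicator (fun _ => B) x := by
  filter_upwards [h] with x hx
  by_cases hxR : x ∈ Metric.closedBall (0 : E d) R
  · rwa [indicator_of_mem hxR]
  · rw [indicator_of_notMem hxR, h0 x (by simpa using hxR), norm_zero]

theorem integrable_of_ball {f : E d → ℝ} {B R : ℝ} (hf : AEStronglyMeasurable f)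
    (h : ∀ᵐ x, |f x| ≤ B) (h0 : ∀ x, R < ‖x‖ → f x = 0) : Integrable f :=
  (integrable_indicator_ball B R).mono' hf (abs_le_indicator_ball h h0)

theorem abs_integral_le_of_ball {f : E d → ℝ} {B R : ℝ}
    (h : ∀ᵐ x, |f x| ≤ B) (h0 : ∀ x, R < ‖x‖ → f x = 0) : |∫ x, f x| ≤ B * vol d R := by
  have := norm_integral_le_of_norm_le (integrable_indicator_ball B R) (abs_le_indicator_ball h h0)
  rw [integral_indicator Metric.isClosed_closedBall.measurableSet, setIntegral_const,
    smul_eq_mul, mul_comm] at this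
  exact this

/-- The drift term `∫ u_r (b_r · ∇φ + div b_r φ)`. -/
def drift (u : ℝ × E d → ℝ) (b : ℝ → E d → E d) (r : ℝ) (φ : E d → ℝ) : ℝ :=
  ∫ x, u (r, x) * adv (b r) φ x

/-- The slices at time `r` of `u` and `b` have the regularity that holds at almost every time. -/
structure GoodTime (K M D : ℝ) (u : ℝ × E d → ℝ) (b : ℝ → E d → E d) (r : ℝ) : Prop where
  meas : AEStronglyMeasurable fun x => u (r, x)
  bound : ∀ᵐ x, |u (r, x)| ≤ K
  contDiff : ContDiff ℝ 1 (b r)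
  field_bound : ∀ x, ‖b r x‖ ≤ M
  div_bound : ∀ x, |divergence (b r) x| ≤ D

theorem IsBdd.ae_slice {u : ℝ × E d → ℝ} (hu : IsBdd T K u) :
    ∀ᵐ t ∂(volume.restrict (Icc 0 T)),
      AEStronglyMeasurable (fun x => u (t, x)) ∧ ∀ᵐ x, |u (t, x)| ≤ K := by
  filter_upwards [hu.meas.prodMk_left, Measure.ae_ae_of_ae_prod hu.bound] with t h1 h2
  exact ⟨h1, h2⟩

theorem ae_goodTime {u : ℝ × E d → ℝ} {b : ℝ → E d → E d} (hu : IsBdd T K u)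
    (hb : IsRegular T M D b) :
    ∀ᵐ t ∂(volume.restrict (Icc 0 T)), GoodTime K M D u b t := by
  filter_upwards [hu.ae_slice, hb.contDiff, hb.bound, hb.div_bound] with t h1 h2 h3 h4
  exact ⟨h1.1, h1.2, h2, h3, h4⟩

theorem continuous_divergence {c : E d → E d} (hc : ContDiff ℝ 1 c) :
    Continuous (divergence c) := by
  have h := hc.continuous_fderiv one_ne_zero
  unfold divergence
  refine continuous_finsetSum _ fun k _ => ?_
  exact (EuclideanSpace.proj (𝕜 := ℝ) k).continuous.comp (h.clm_apply continuous_const)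

theorem continuous_adv {c : E d → E d} (hc : ContDiff ℝ 1 c) {φ : E d → ℝ}
    (hφ : ContDiff ℝ 1 φ) : Continuous (adv c φ) :=
  ((hφ.continuous_fderiv one_ne_zero).clm_apply hc.continuous).add
    ((continuous_divergence hc).mul hφ.continuous)

theorem fderiv_eq_zero_of_radius {φ : E d → ℝ} {R : ℝ} (h0 : ∀ x, R < ‖x‖ → φ x = 0) {x : E d}
    (hx : R < ‖x‖) : fderiv ℝ φ x = 0 := by
  have : φ =ᶠ[𝓝 x] fun _ => 0 :=
    (continuous_norm.isOpen_preimage _ isOpen_Ioi).eventually_mem hx |>.mono fun y hy => h0 y hy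
  rw [this.fderiv_eq]; simp

theorem adv_eq_zero_of_radius {c : E d → E d} {φ : E d → ℝ} {R : ℝ}
    (h0 : ∀ x, R < ‖x‖ → φ x = 0) {x : E d} (hx : R < ‖x‖) : adv c φ x = 0 := by
  rw [adv, fderiv_eq_zero_of_radius h0 hx, h0 x hx]; simp

theorem abs_adv_le {c : E d → E d} {φ : E d → ℝ} {A₀ A₁ : ℝ} {x : E d}
    (hM : ‖c x‖ ≤ M) (hD : |divergence c x| ≤ D)
    (h₀ : |φ x| ≤ A₀) (h₁ : ∀ k, |partialDeriv k φ x| ≤ A₁) :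
    |adv c φ x| ≤ M * (d * A₁) + D * A₀ := by
  refine (abs_add_le _ _).trans (add_le_add ?_ ?_)
  · rw [fderiv_apply_eq_sum]
    have : M * (d * A₁) = ∑ _k : Fin d, M * A₁ := by simp; ring
    rw [this]
    refine (Finset.abs_sum_le_sum_abs _ _).trans (Finset.sum_le_sum fun k _ => ?_)
    rw [abs_mul]
    exact mul_le_mul ((abs_coord_le _ k).trans hM) (h₁ k) (abs_nonneg _)
      ((norm_nonneg _).trans hM)
  · rw [abs_mul]
    exact mul_le_mul hD h₀ (abs_nonneg _) ((abs_nonneg _).trans hD)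

namespace GoodTime

variable {u : ℝ × E d → ℝ} {b : ℝ → E d → E d} {r : ℝ}

theorem K_nonneg (h : GoodTime K M D u b r) : 0 ≤ K := by
  obtain ⟨x, hx⟩ := h.bound.exists
  exact (abs_nonneg _).trans hx

theorem integrable_mul (h : GoodTime K M D u b r) {φ : E d → ℝ} (hφ : Continuous φ)
    (hφ' : HasCompactSupport φ) : Integrable fun x => u (r, x) * φ x := by
  obtain ⟨A, hA⟩ := hφ'.exists_bound_of_continuous hφ
  obtain ⟨R, -, hR⟩ := exists_radius hφ'
  refine integrable_of_ball (B := K * A) (R := R) (h.meas.mul hφ.aestronglyMeasurable) ?_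
    fun x hx => by rw [hR x hx, mul_zero]
  filter_upwards [h.bound] with x hx
  rw [abs_mul]
  exact mul_le_mul hx (hA x) (abs_nonneg _) h.K_nonneg

theorem integrable_drift (h : GoodTime K M D u b r) {φ : E d → ℝ} (hφ : IsTest φ) :
    Integrable fun x => u (r, x) * adv (b r) φ x := by
  obtain ⟨R, -, hR⟩ := hφ.exists_radius
  refine h.integrable_mul (continuous_adv h.contDiff (hφ.1.of_le (by simp))) ?_
  refine HasCompactSupport.intro (isCompact_closedBall (0 : E d) R) fun x hx => ?_
  exact adv_eq_zero_of_radius hR (by simpa using hx)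

theorem drift_sub (h : GoodTime K M D u b r) {φ ψ : E d → ℝ} (hφ : IsTest φ) (hψ : IsTest ψ) :
    drift u b r (φ - ψ) = drift u b r φ - drift u b r ψ := by
  rw [drift, drift, drift, ← integral_sub (h.integrable_drift hφ) (h.integrable_drift hψ)]
  congr 1; funext x
  rw [adv, fderiv_sub (hφ.differentiable x) (hψ.differentiable x), adv, adv]
  simp; ring

theorem abs_drift_le (h : GoodTime K M D u b r) {φ : E d → ℝ} {A₀ A₁ R : ℝ}
    (h₀ : ∀ x, |φ x| ≤ A₀) (h₁ : ∀ k x, |partialDeriv k φ x| ≤ A₁)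
    (hR : ∀ x, R < ‖x‖ → φ x = 0) :
    |drift u b r φ| ≤ K * (M * (d * A₁) + D * A₀) * vol d R := by
  refine abs_integral_le_of_ball ?_ fun x hx => by rw [adv_eq_zero_of_radius hR hx, mul_zero]
  filter_upwards [h.bound] with x hx
  rw [abs_mul]
  exact mul_le_mul hx (abs_adv_le (h.field_bound x) (h.div_bound x) (h₀ x) fun k => h₁ k x)
    (abs_nonneg _) h.K_nonneg

end GoodTime

theorem tau_radius {φ : E d → ℝ} {R H : ℝ} (hR : ∀ x, R < ‖x‖ → φ x = 0) {a : E d}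
    (ha : ‖a‖ ≤ H) : ∀ x, R + H < ‖x‖ → tau a φ x = 0 := by
  intro x hx
  refine hR _ ?_
  have : ‖x‖ ≤ ‖x + a‖ + ‖a‖ := by simpa using norm_sub_le (x + a) a
  linarith

/-- The drift is bounded, uniformly for bounded translations of the test function. -/
theorem IsTest.exists_drift_bound {φ : E d → ℝ} (hφ : IsTest φ) (K M D H : ℝ)
    (hK : 0 ≤ K) (hM : 0 ≤ M) (hD : 0 ≤ D) : ∃ C, 0 ≤ C ∧
      ∀ (u : ℝ × E d → ℝ) (b : ℝ → E d → E d) (r : ℝ), GoodTime K M D u b r →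
      ∀ a, ‖a‖ ≤ H → |drift u b r (RoughTransport.tau a φ)| ≤ C := by
  obtain ⟨A₀, h₀, hA₀⟩ := hφ.exists_bound
  choose B hB0 hB using fun k => (hφ.partialDeriv k).exists_bound
  obtain ⟨R, hR0, hR⟩ := hφ.exists_radius
  have hBs : 0 ≤ ∑ k, B k := Finset.sum_nonneg fun k _ => hB0 k
  refine ⟨K * (M * (d * ∑ k, B k) + D * A₀) * vol d (R + H), ?_, fun u b r h a ha => ?_⟩
  · have := vol_nonneg (d := d) (R + H); positivity
  · refine h.abs_drift_le (fun x => hA₀ _) (fun k x => ?_) (tau_radius hR ha)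
    rw [partialDeriv_tau]
    exact (hB k _).trans (Finset.single_le_sum (fun k _ => hB0 k) (Finset.mem_univ k))

/-- The drift is Lipschitz with respect to translations of the test function. -/
theorem IsTest.exists_drift_lipschitz {φ : E d → ℝ} (hφ : IsTest φ) (K M D H : ℝ)
    (hK : 0 ≤ K) (hM : 0 ≤ M) (hD : 0 ≤ D) : ∃ C, 0 ≤ C ∧
      ∀ (u : ℝ × E d → ℝ) (b : ℝ → E d → E d) (r : ℝ), GoodTime K M D u b r →
      ∀ a a', ‖a‖ ≤ H → ‖a'‖ ≤ H →
        |drift u b r (RoughTransport.tau a φ) - drift u b r (RoughTransport.tau a' φ)|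
          ≤ C * ‖a - a'‖ := by
  obtain ⟨A₀, h₀, hA₀⟩ := hφ.taylor_one
  choose B hB0 hB using fun k => (hφ.partialDeriv k).taylor_one
  obtain ⟨R, hR0, hR⟩ := hφ.exists_radius
  have hBs : 0 ≤ ∑ k, B k := Finset.sum_nonneg fun k _ => hB0 k
  refine ⟨K * (M * (d * ∑ k, B k) + D * A₀) * vol d (R + H), ?_, fun u b r h a a' ha ha' => ?_⟩
  · have := vol_nonneg (d := d) (R + H); positivity
  · rw [← h.drift_sub (hφ.tau a) (hφ.tau a')]
    have e : ∀ x : E d, x + a = x + a' + (a - a') := fun x => by abel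
    have := h.abs_drift_le (φ := RoughTransport.tau a φ - RoughTransport.tau a' φ)
      (A₀ := A₀ * ‖a - a'‖) (A₁ := (∑ k, B k) * ‖a - a'‖) (R := R + H)
      (fun x => by
        simp only [RoughTransport.tau, Pi.sub_apply]; rw [e x]; exact hA₀ _ _)
      (fun k x => by
        have : RoughTransport.partialDeriv k (RoughTransport.tau a φ - RoughTransport.tau a' φ) x
            = RoughTransport.partialDeriv k φ (x + a)
              - RoughTransport.partialDeriv k φ (x + a') := by
          rw [RoughTransport.partialDeriv, fderiv_sub ((hφ.tau a).differentiable x)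
            ((hφ.tau a').differentiable x), fderiv_tau, fderiv_tau]; rfl
        rw [this, e x]
        exact (hB k _ _).trans (mul_le_mul_of_nonneg_right
          (Finset.single_le_sum (fun k _ => hB0 k) (Finset.mem_univ k)) (norm_nonneg _)))
      (fun x hx => by
        rw [Pi.sub_apply, tau_radius hR ha x hx, tau_radius hR ha' x hx, sub_zero])
    refine this.trans (le_of_eq ?_)
    ring

theorem aestronglyMeasurable_drift {u : ℝ × E d → ℝ} {b : ℝ → E d → E d} (hu : IsBdd T K u)
    (hb : IsRegular T M D b) {φ : E d → ℝ} (hφ : IsTest φ) {a : ℝ → E d} (ha : Continuous a) :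
    AEStronglyMeasurable (fun r => drift u b r (tau (a r) φ)) (volume.restrict (Icc 0 T)) := by
  have h1 : AEStronglyMeasurable (fun z : ℝ × E d => u z * adv (b z.1) (tau (a z.1) φ) z.2)
      (spaceTime d T) := by
    refine hu.meas.mul (AEStronglyMeasurable.add ?_ (hb.div_meas.mul ?_))
    · simp_rw [fderiv_apply_eq_sum, partialDeriv_tau]
      refine Finset.aestronglyMeasurable_fun_sum _ fun k _ => AEStronglyMeasurable.mul ?_ ?_
      · exact (EuclideanSpace.proj (𝕜 := ℝ) k).continuous.comp_aestronglyMeasurable hb.meas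
      · exact Continuous.aestronglyMeasurable
          ((hφ.partialDeriv k).continuous.comp (continuous_snd.add (ha.comp continuous_fst)))
    · exact Continuous.aestronglyMeasurable
        (hφ.continuous.comp (continuous_snd.add (ha.comp continuous_fst)))
  exact h1.integral_prod_right'

theorem integrableOn_drift {u : ℝ × E d → ℝ} {b : ℝ → E d → E d} (hu : IsBdd T K u)
    (hb : IsRegular T M D b) {φ : E d → ℝ} (hφ : IsTest φ) {a : ℝ → E d} (ha : Continuous a)
    {H : ℝ} (hH : ∀ t, ‖a t‖ ≤ H) :
    IntegrableOn (fun r => drift u b r (tau (a r) φ)) (Icc 0 T) := by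
  obtain ⟨C, -, hC⟩ := hφ.exists_drift_bound K M D H hu.nonneg hb.M_nonneg hb.D_nonneg
  refine Integrable.of_bound (aestronglyMeasurable_drift hu hb hφ ha) C ?_
  filter_upwards [ae_goodTime hu hb] with t ht
  exact hC u b t ht _ (hH t)

theorem intervalIntegrable_of_Icc {f : ℝ → ℝ} (hf : IntegrableOn f (Icc 0 T)) {s t : ℝ}
    (hs : s ∈ Icc 0 T) (ht : t ∈ Icc 0 T) : IntervalIntegrable f volume s t :=
  (intervalIntegrable_iff.2 (hf.mono_set (uIoc_subset_uIcc.trans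
    ((ordConnected_Icc (a := (0 : ℝ)) (b := T)).uIcc_subset hs ht))))

theorem intervalIntegrable_drift {u : ℝ × E d → ℝ} {b : ℝ → E d → E d} (hu : IsBdd T K u)
    (hb : IsRegular T M D b) {φ : E d → ℝ} (hφ : IsTest φ) {s t : ℝ}
    (hs : s ∈ Icc 0 T) (ht : t ∈ Icc 0 T) :
    IntervalIntegrable (fun r => drift u b r φ) volume s t := by
  have := integrableOn_drift hu hb hφ (a := fun _ => 0) continuous_const (H := 0) (by simp)
  simp only [tau_zero] at this
  exact intervalIntegrable_of_Icc this hs ht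

/-- A bound for an interval integral whose integrand is controlled almost everywhere. -/
theorem abs_intervalIntegral_le {f : ℝ → ℝ} {C s t : ℝ} (hs : s ∈ Icc 0 T) (ht : t ∈ Icc 0 T)
    (h : ∀ᵐ r ∂(volume.restrict (Icc 0 T)), r ∈ uIoc s t → |f r| ≤ C) :
    |∫ r in s..t, f r| ≤ C * |t - s| := by
  refine intervalIntegral.norm_integral_le_of_norm_le_const_ae (f := f) ?_
  filter_upwards [(ae_restrict_iff' measurableSet_Icc).1 h] with r hr hr'
  exact hr ((uIoc_subset_uIcc.trans
    ((ordConnected_Icc (a := (0 : ℝ)) (b := T)).uIcc_subset hs ht)) hr') hr'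

/-! ### Continuous versions of `t ↦ ∫ u_t φ` -/

/-- `U φ` is a version of `t ↦ ∫ u_t φ` that is continuous on `[0,T]`. -/
structure IsVersion (T : ℝ) (u : ℝ × E d → ℝ) (U : (E d → ℝ) → ℝ → ℝ) : Prop where
  ae_eq : ∀ φ, IsTest φ → ∀ᵐ t ∂(volume.restrict (Icc 0 T)), U φ t = ∫ x, u (t, x) * φ x
  cont : ∀ φ, IsTest φ → ContinuousOn (U φ) (Icc 0 T)

theorem eqOn_of_ae {f g : ℝ → ℝ} (hT : 0 < T) (hf : ContinuousOn f (Icc 0 T))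
    (hg : ContinuousOn g (Icc 0 T)) (h : ∀ᵐ t ∂(volume.restrict (Icc 0 T)), f t = g t) :
    ∀ t ∈ Icc 0 T, f t = g t :=
  Measure.eqOn_Icc_of_ae_eq volume hT.ne h hf hg

theorem le_of_ae {f : ℝ → ℝ} {C : ℝ} (hT : 0 < T) (hf : ContinuousOn f (Icc 0 T))
    (h : ∀ᵐ t ∂(volume.restrict (Icc 0 T)), |f t| ≤ C) : ∀ t ∈ Icc 0 T, |f t| ≤ C := by
  intro t ht
  -- The bound is rewritten as the equality min(|f|, C) = |f| between continuous functions, which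
  -- extends from almost every time to every time.
  have := eqOn_of_ae hT (hf.abs.inf continuousOn_const) hf.abs (by
    filter_upwards [h] with t ht using inf_eq_left.2 ht) t ht
  exact inf_eq_left.1 this

theorem integrable_slice_mul {u : ℝ × E d → ℝ} (hu : IsBdd T K u) :
    ∀ᵐ t ∂(volume.restrict (Icc 0 T)), ∀ φ, IsTest φ → Integrable fun x => u (t, x) * φ x := by
  filter_upwards [hu.ae_slice] with t ht φ hφ
  exact (GoodTime.mk (b := fun _ _ => 0) (M := 0) (D := 0) ht.1 ht.2 contDiff_const (by simp)
    (by simp [divergence])).integrable_mul hφ.continuous hφ.2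

theorem abs_integral_slice_le {u : ℝ × E d → ℝ} {t A R : ℝ} (hK : 0 ≤ K)
    (h : ∀ᵐ x, |u (t, x)| ≤ K) {φ : E d → ℝ} (hA : ∀ x, |φ x| ≤ A)
    (hR : ∀ x, R < ‖x‖ → φ x = 0) : |∫ x, u (t, x) * φ x| ≤ K * A * vol d R := by
  refine abs_integral_le_of_ball ?_ fun x hx => by rw [hR x hx, mul_zero]
  filter_upwards [h] with x hx
  rw [abs_mul]
  exact mul_le_mul hx (hA x) (abs_nonneg _) hK

namespace IsVersion

variable {u : ℝ × E d → ℝ} {U : (E d → ℝ) → ℝ → ℝ}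

/-- A version is not assumed to depend linearly on the test function. Linearity is inherited from
the integral at almost every time, then holds at every time by continuity. -/
theorem add (hT : 0 < T) (hu : IsBdd T K u) (hU : IsVersion T u U) {φ ψ : E d → ℝ}
    (hφ : IsTest φ) (hψ : IsTest ψ) {t : ℝ} (ht : t ∈ Icc 0 T) :
    U (φ + ψ) t = U φ t + U ψ t := by
  refine eqOn_of_ae hT (hU.cont _ (hφ.add hψ)) ((hU.cont _ hφ).add (hU.cont _ hψ)) ?_ t ht
  filter_upwards [hU.ae_eq _ hφ, hU.ae_eq _ hψ, hU.ae_eq _ (hφ.add hψ), integrable_slice_mul hu]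
    with s h1 h2 h3 h4
  rw [Pi.add_apply, h1, h2, h3, ← integral_add (h4 φ hφ) (h4 ψ hψ)]
  simp [mul_add]

theorem smul (hT : 0 < T) (hU : IsVersion T u U) {φ : E d → ℝ}
    (hφ : IsTest φ) (a : ℝ) {t : ℝ} (ht : t ∈ Icc 0 T) : U (a • φ) t = a * U φ t := by
  refine eqOn_of_ae hT (hU.cont _ (hφ.smul a)) ((hU.cont _ hφ).const_smul a) ?_ t ht
  filter_upwards [hU.ae_eq _ hφ, hU.ae_eq _ (hφ.smul a)] with s h1 h2
  rw [Pi.smul_apply, h1, h2, smul_eq_mul, ← integral_const_mul]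
  congr 1; funext x; simp; ring

theorem sub (hT : 0 < T) (hu : IsBdd T K u) (hU : IsVersion T u U) {φ ψ : E d → ℝ}
    (hφ : IsTest φ) (hψ : IsTest ψ) {t : ℝ} (ht : t ∈ Icc 0 T) :
    U (φ - ψ) t = U φ t - U ψ t := by
  have := hU.add hT hu (hφ.sub hψ) hψ ht
  rw [sub_add_cancel] at this
  linarith

theorem sum (hT : 0 < T) (hu : IsBdd T K u) (hU : IsVersion T u U) {ι : Type*} (s : Finset ι)
    {φ : ι → E d → ℝ} (hφ : ∀ i, IsTest (φ i)) {t : ℝ} (ht : t ∈ Icc 0 T) :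
    U (∑ i ∈ s, φ i) t = ∑ i ∈ s, U (φ i) t := by
  classical
  induction s using Finset.induction_on with
  | empty => simpa using hU.smul hT isTest_zero 0 ht
  | insert i s hi ih =>
    rw [Finset.sum_insert hi, Finset.sum_insert hi, hU.add hT hu (hφ i) (IsTest.sum s hφ) ht, ih]

theorem abs_le (hT : 0 < T) (hu : IsBdd T K u) (hU : IsVersion T u U) {φ : E d → ℝ}
    (hφ : IsTest φ) {A R : ℝ} (hA : ∀ x, |φ x| ≤ A) (hR : ∀ x, R < ‖x‖ → φ x = 0)
    {t : ℝ} (ht : t ∈ Icc 0 T) : |U φ t| ≤ K * A * vol d R := by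
  refine le_of_ae hT (hU.cont _ hφ) ?_ t ht
  filter_upwards [hU.ae_eq _ hφ, hu.ae_slice] with s h1 h2
  rw [h1]
  exact abs_integral_slice_le hu.nonneg h2.2 hA hR

theorem taylor_one (hT : 0 < T) (hu : IsBdd T K u) (hU : IsVersion T u U) {φ : E d → ℝ}
    (hφ : IsTest φ) (H : ℝ) : ∃ C, 0 ≤ C ∧ ∀ a h, ‖a‖ ≤ H → ‖h‖ ≤ H → ∀ t ∈ Icc 0 T,
      |U (tau (a + h) φ) t - U (tau a φ) t| ≤ C * ‖h‖ := by
  obtain ⟨A, hA0, hA⟩ := hφ.taylor_one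
  obtain ⟨R, -, hR⟩ := hφ.exists_radius
  -- The ball of radius R + 2H contains the supports of all the translates by a and by a + h that
  -- occur.
  refine ⟨K * A * vol d (R + (H + H)), mul_nonneg (mul_nonneg hu.nonneg hA0) (vol_nonneg _),
    fun a h ha hh t ht => ?_⟩
  rw [← hU.sub hT hu (hφ.tau _) (hφ.tau _) ht]
  refine (hU.abs_le hT hu (A := A * ‖h‖) (R := R + (H + H)) ((hφ.tau _).sub (hφ.tau _))
    (fun x => ?_) (fun x hx => ?_) ht).trans (le_of_eq (by ring))
  · simp only [tau, Pi.sub_apply, ← add_assoc]; exact hA _ _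
  · rw [Pi.sub_apply, tau_radius hR ((norm_add_le _ _).trans (add_le_add ha hh)) x hx,
      tau_radius hR (H := H + H) (by linarith [norm_nonneg h]) x hx, sub_zero]

theorem taylor_two (hT : 0 < T) (hu : IsBdd T K u) (hU : IsVersion T u U) {φ : E d → ℝ}
    (hφ : IsTest φ) (H : ℝ) : ∃ C, 0 ≤ C ∧ ∀ a h, ‖a‖ ≤ H → ‖h‖ ≤ H → ∀ t ∈ Icc 0 T,
      |U (tau (a + h) φ) t - U (tau a φ) t - ∑ k, h k * U (tau a (partialDeriv k φ)) t|
        ≤ C * ‖h‖ ^ 2 := by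
  obtain ⟨A, hA0, hA⟩ := hφ.taylor_two
  obtain ⟨R, -, hR⟩ := hφ.exists_radius
  have z1 : ∀ k, ∀ y, R < ‖y‖ → partialDeriv k φ y = 0 := fun k y hy => by
    rw [partialDeriv, fderiv_eq_zero_of_radius hR hy]; rfl
  refine ⟨K * A * vol d (R + (H + H)), mul_nonneg (mul_nonneg hu.nonneg hA0) (vol_nonneg _),
    fun a h ha hh t ht => ?_⟩
  have t1 : ∀ k, IsTest (h k • tau a (partialDeriv k φ)) := fun k =>
    ((hφ.partialDeriv k).tau a).smul _
  have e : U (tau (a + h) φ) t - U (tau a φ) t - ∑ k, h k * U (tau a (partialDeriv k φ)) t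
      = U (tau (a + h) φ - tau a φ - ∑ k, h k • tau a (partialDeriv k φ)) t := by
    rw [hU.sub hT hu ((hφ.tau _).sub (hφ.tau _)) (IsTest.sum _ t1) ht,
      hU.sub hT hu (hφ.tau _) (hφ.tau _) ht, hU.sum hT hu _ t1 ht]
    simp_rw [hU.smul hT ((hφ.partialDeriv _).tau a) _ ht]
  rw [e]
  have ha2 : ‖a‖ ≤ H + H := by linarith [norm_nonneg h]
  refine (hU.abs_le hT hu (A := A * ‖h‖ ^ 2) (R := R + (H + H))
    (((hφ.tau _).sub (hφ.tau _)).sub (IsTest.sum _ t1))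
    (fun x => ?_) (fun x hx => ?_) ht).trans (le_of_eq (by ring))
  · simp only [tau, Pi.sub_apply, ← add_assoc, Finset.sum_apply, Pi.smul_apply, smul_eq_mul]
    exact hA _ _
  · simp only [Pi.sub_apply, Finset.sum_apply, Pi.smul_apply]
    rw [tau_radius hR ((norm_add_le _ _).trans (add_le_add ha hh)) x hx,
      tau_radius hR ha2 x hx]
    simp_rw [tau_radius (z1 _) ha2 x hx]
    simp

theorem taylor_three (hT : 0 < T) (hu : IsBdd T K u) (hU : IsVersion T u U) {φ : E d → ℝ}
    (hφ : IsTest φ) (H : ℝ) : ∃ C, 0 ≤ C ∧ ∀ a h, ‖a‖ ≤ H → ‖h‖ ≤ H → ∀ t ∈ Icc 0 T,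
      |U (tau (a + h) φ) t - U (tau a φ) t - ∑ k, h k * U (tau a (partialDeriv k φ)) t
        - 1 / 2 * ∑ k, ∑ j, h k * h j * U (tau a (partialDeriv j (partialDeriv k φ))) t|
        ≤ C * ‖h‖ ^ 3 := by
  obtain ⟨A, hA0, hA⟩ := hφ.taylor_three
  obtain ⟨R, -, hR⟩ := hφ.exists_radius
  refine ⟨K * A * vol d (R + (H + H)), mul_nonneg (mul_nonneg hu.nonneg hA0) (vol_nonneg _),
    fun a h ha hh t ht => ?_⟩
  have t1 : ∀ k, IsTest (h k • tau a (partialDeriv k φ)) := fun k =>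
    ((hφ.partialDeriv k).tau a).smul _
  have t2 : ∀ k j, IsTest ((h k * h j) • tau a (partialDeriv j (partialDeriv k φ))) := fun k j =>
    (((hφ.partialDeriv k).partialDeriv j).tau a).smul _
  have t3 : ∀ k, IsTest (∑ j, (h k * h j) • tau a (partialDeriv j (partialDeriv k φ))) :=
    fun k => IsTest.sum _ (t2 k)
  have e : U (tau (a + h) φ) t - U (tau a φ) t - ∑ k, h k * U (tau a (partialDeriv k φ)) t
        - 1 / 2 * ∑ k, ∑ j, h k * h j * U (tau a (partialDeriv j (partialDeriv k φ))) t
      = U (tau (a + h) φ - tau a φ - ∑ k, h k • tau a (partialDeriv k φ)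
        - (1 / 2 : ℝ) • ∑ k, ∑ j, (h k * h j) • tau a (partialDeriv j (partialDeriv k φ))) t := by
    rw [hU.sub hT hu (((hφ.tau _).sub (hφ.tau _)).sub (IsTest.sum _ t1))
      ((IsTest.sum _ t3).smul _) ht,
      hU.sub hT hu ((hφ.tau _).sub (hφ.tau _)) (IsTest.sum _ t1) ht,
      hU.sub hT hu (hφ.tau _) (hφ.tau _) ht, hU.sum hT hu _ t1 ht,
      hU.smul hT (IsTest.sum _ t3) _ ht, hU.sum hT hu _ t3 ht]
    simp_rw [hU.sum hT hu _ (t2 _) ht, hU.smul hT ((hφ.partialDeriv _).tau a) _ ht,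
      hU.smul hT (((hφ.partialDeriv _).partialDeriv _).tau a) _ ht]
  rw [e]
  have ha2 : ‖a‖ ≤ H + H := by linarith [norm_nonneg h]
  have z1 : ∀ k, ∀ y, R < ‖y‖ → partialDeriv k φ y = 0 := fun k y hy => by
    rw [partialDeriv, fderiv_eq_zero_of_radius hR hy]; rfl
  have z2 : ∀ k j, ∀ y, R < ‖y‖ → partialDeriv j (partialDeriv k φ) y = 0 := fun k j y hy => by
    rw [partialDeriv, fderiv_eq_zero_of_radius (z1 k) hy]; rfl
  refine (hU.abs_le hT hu (A := A * ‖h‖ ^ 3) (R := R + (H + H))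
    ((((hφ.tau _).sub (hφ.tau _)).sub (IsTest.sum _ t1)).sub ((IsTest.sum _ t3).smul _))
    (fun x => ?_) (fun x hx => ?_) ht).trans (le_of_eq (by ring))
  · simp only [tau, Pi.sub_apply, ← add_assoc, Finset.sum_apply, Pi.smul_apply, smul_eq_mul]
    exact hA _ _
  · simp only [Pi.sub_apply, Finset.sum_apply, Pi.smul_apply]
    rw [tau_radius hR ((norm_add_le _ _).trans (add_le_add ha hh)) x hx,
      tau_radius hR ha2 x hx]
    simp_rw [tau_radius (z1 _) ha2 x hx, tau_radius (z2 _ _) ha2 x hx]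
    simp

/-- At almost every time, the version is the integral for all translates of a test function. -/
theorem ae_eq_tau (hT : 0 < T) (hu : IsBdd T K u) (hU : IsVersion T u U) {φ : E d → ℝ}
    (hφ : IsTest φ) : ∀ᵐ t ∂(volume.restrict (Icc 0 T)),
      ∀ a, U (tau a φ) t = ∫ x, u (t, x) * tau a φ x := by
  -- The exceptional null set of times depends on the translation. A countable dense set of
  -- translations has a common null set, and both sides are continuous in the translation.
  have h1 : ∀ᵐ t ∂(volume.restrict (Icc 0 T)), ∀ n : ℕ,
      U (tau (TopologicalSpace.denseSeq (E d) n) φ) t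
        = ∫ x, u (t, x) * tau (TopologicalSpace.denseSeq (E d) n) φ x :=
    ae_all_iff.2 fun n => hU.ae_eq _ (hφ.tau _)
  obtain ⟨A, hA0, hA⟩ := hφ.taylor_one
  obtain ⟨R, -, hR⟩ := hφ.exists_radius
  filter_upwards [h1, hu.ae_slice, integrable_slice_mul hu, ae_restrict_mem measurableSet_Icc]
    with t h2 h3 h4 ht a
  have key : ∀ F : E d → ℝ, (∀ H, ∃ C, ∀ a h, ‖a‖ ≤ H → ‖h‖ ≤ H → |F (a + h) - F a| ≤ C * ‖h‖) →
      Continuous F := by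
    intro F hF
    rw [continuous_iff_continuousAt]
    intro a
    obtain ⟨C, hC⟩ := hF (‖a‖ + 1)
    rw [ContinuousAt, tendsto_iff_norm_sub_tendsto_zero]
    have h5 : Tendsto (fun y => C * ‖y - a‖) (𝓝 a) (𝓝 0) := by
      have : Continuous fun y => C * ‖y - a‖ := by fun_prop
      simpa using this.tendsto a
    refine squeeze_zero' (Eventually.of_forall fun _ => norm_nonneg _) ?_ h5
    filter_upwards [Metric.ball_mem_nhds a one_pos] with y hy
    have := hC a (y - a) (by linarith) (by
      rw [Metric.mem_ball, dist_eq_norm] at hy; linarith [norm_nonneg a])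
    simpa using this
  have c1 : Continuous fun a => U (tau a φ) t := key _ fun H => by
    obtain ⟨C, -, hC⟩ := hU.taylor_one hT hu hφ H
    exact ⟨C, fun a h ha hh => hC a h ha hh t ht⟩
  have c2 : Continuous fun a => ∫ x, u (t, x) * tau a φ x := key _ fun H => by
    refine ⟨K * A * vol d (R + (H + H)), fun a h ha hh => ?_⟩
    rw [← integral_sub (h4 _ (hφ.tau _)) (h4 _ (hφ.tau _))]
    simp_rw [← mul_sub]
    refine (abs_integral_slice_le hu.nonneg h3.2 (A := A * ‖h‖) (R := R + (H + H)) (fun x => ?_)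
      (fun x hx => ?_)).trans (le_of_eq (by ring))
    · simp only [tau, ← add_assoc]; exact hA _ _
    · rw [tau_radius hR ((norm_add_le _ _).trans (add_le_add ha hh)) x hx,
        tau_radius hR (H := H + H) (by linarith [norm_nonneg h]) x hx, sub_zero]
  refine congrFun (c1.ext_on (TopologicalSpace.denseRange_denseSeq (E d)) c2 ?_) a
  rintro _ ⟨n, rfl⟩
  exact h2 n

end IsVersion

end RoughTransport
end

noncomputable section
namespace RoughTransport

/-! ### Geometric rough paths and the sewing estimate -/

variable {d : ℕ} {T γ : ℝ}

theorem IsHolder.exists_nonneg {F : Type*} [NormedAddCommGroup F] {ν : ℝ} {f : ℝ → F}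
    (hf : IsHolder T ν f) :
    ∃ C, 0 ≤ C ∧ ∀ s ∈ Icc 0 T, ∀ t ∈ Icc 0 T, ‖f t - f s‖ ≤ C * |t - s| ^ ν := by
  obtain ⟨C, hC⟩ := hf
  exact ⟨max C 0, le_max_right _ _, fun s hs t ht => (hC s hs t ht).trans
    (mul_le_mul_of_nonneg_right (le_max_left _ _) (by positivity))⟩

theorem IsHolderTwo.exists_nonneg {F : Type*} [NormedAddCommGroup F] {ν : ℝ} {f : ℝ → ℝ → F}
    (hf : IsHolderTwo T ν f) :
    ∃ C, 0 ≤ C ∧ ∀ s ∈ Icc 0 T, ∀ t ∈ Icc 0 T, ‖f s t‖ ≤ C * |t - s| ^ ν := by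
  obtain ⟨C, hC⟩ := hf.2.2
  exact ⟨max C 0, le_max_right _ _, fun s hs t ht => (hC s hs t ht).trans
    (mul_le_mul_of_nonneg_right (le_max_left _ _) (by positivity))⟩

theorem IsHolder.continuousOn {F : Type*} [NormedAddCommGroup F] {ν : ℝ} (hν : 0 < ν) {f : ℝ → F}
    (hf : IsHolder T ν f) : ContinuousOn f (Icc 0 T) := by
  obtain ⟨C, -, hC⟩ := hf.exists_nonneg
  intro s hs
  rw [ContinuousWithinAt, tendsto_iff_norm_sub_tendsto_zero]
  have h5 : Tendsto (fun t => C * |t - s| ^ ν) (𝓝[Icc 0 T] s) (𝓝 0) := by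
    have : Continuous fun t => C * |t - s| ^ ν :=
      continuous_const.mul ((continuous_abs.comp (continuous_sub_right s)).rpow_const
        fun _ => Or.inr hν.le)
    simpa [Real.zero_rpow hν.ne'] using (this.tendsto s).mono_left nhdsWithin_le_nhds
  refine squeeze_zero' (Eventually.of_forall fun _ => norm_nonneg _) ?_ h5
  filter_upwards [self_mem_nhdsWithin] with t ht using hC s hs t ht

/-- The two integrands add up to the derivative of the product of the increments, so the symmetric
part is determined by the fundamental theorem of calculus. -/
theorem naturalLift_symm (hT : 0 < T) {Y : ℝ → E d} (hY : ContDiffOn ℝ 1 Y (Icc 0 T)) {s t : ℝ}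
    (hs : 0 ≤ s) (hst : s ≤ t) (ht : t ≤ T) (i j : Fin d) :
    naturalLift T Y s t i j + naturalLift T Y s t j i = (Y t i - Y s i) * (Y t j - Y s j) := by
  have hsub : Icc s t ⊆ Icc 0 T := Icc_subset_Icc hs ht
  have hc : ∀ i, ContinuousOn (fun r => Y r i) (Icc s t) := fun i =>
    (EuclideanSpace.proj (𝕜 := ℝ) i).continuous.comp_continuousOn (hY.continuousOn.mono hsub)
  have hd : ∀ i, ContinuousOn (fun r => derivWithin Y (Icc 0 T) r i) (Icc s t) := fun i =>
    (EuclideanSpace.proj (𝕜 := ℝ) i).continuous.comp_continuousOn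
      ((hY.continuousOn_derivWithin (uniqueDiffOn_Icc hT) le_rfl).mono hsub)
  have hint : ∀ i j, IntervalIntegrable
      (fun r => (Y r i - Y s i) * derivWithin Y (Icc 0 T) r j) volume s t := fun i j =>
    (((hc i).sub continuousOn_const).mul (hd j)).intervalIntegrable_of_Icc hst
  have hder : ∀ i, ∀ r ∈ Ioo s t, HasDerivAt (fun r => Y r i) (derivWithin Y (Icc 0 T) r i) r := by
    intro i r hr
    have hr' : r ∈ Icc 0 T := hsub (Ioo_subset_Icc_self hr)
    have h1 := (hY.differentiableOn one_ne_zero r hr').hasDerivWithinAt.hasDerivAt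
      (Icc_mem_nhds (hs.trans_lt hr.1) (hr.2.trans_le ht))
    exact (EuclideanSpace.proj (𝕜 := ℝ) i).hasFDerivAt.comp_hasDerivAt r h1
  simp only [naturalLift, Matrix.of_apply]
  rw [← intervalIntegral.integral_add (hint i j) (hint j i),
    intervalIntegral.integral_eq_sub_of_hasDerivAt_of_le hst
      (f := fun r => (Y r i - Y s i) * (Y r j - Y s j))
      (f' := fun r => (Y r i - Y s i) * derivWithin Y (Icc 0 T) r j
        + (Y r j - Y s j) * derivWithin Y (Icc 0 T) r i)
      (((hc i).sub continuousOn_const).mul ((hc j).sub continuousOn_const)) (fun r hr => by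
        exact (((hder i r hr).sub_const (Y s i)).mul ((hder j r hr).sub_const (Y s j))).congr_deriv
          (by ring)) ((hint i j).add (hint j i))]
  ring

/-- The symmetric part of a geometric rough path is half the square of the increment. -/
theorem IsGeometricRoughPath.symm_part (hT : 0 < T) {X : ℝ → E d}
    {XX : ℝ → ℝ → Matrix (Fin d) (Fin d) ℝ} (hX : IsGeometricRoughPath T γ X XX) {s t : ℝ}
    (hs : 0 ≤ s) (hst : s ≤ t) (ht : t ≤ T) (i j : Fin d) :
    XX s t i j + XX s t j i = (X t i - X s i) * (X t j - X s j) := by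
  obtain ⟨-, Y, hY, hclose⟩ := hX
  have hs' : s ∈ Icc 0 T := ⟨hs, hst.trans ht⟩
  have ht' : t ∈ Icc 0 T := ⟨hs.trans hst, ht⟩
  -- At fixed s and t, closeness in the rough path distance is ordinary convergence; C stands for a
  -- power of |t - s| and may vanish, hence the division by C + 1.
  have lim : ∀ (f : ℕ → ℝ) (a C : ℝ), 0 ≤ C →
      (∀ ε > 0, ∀ᶠ n in atTop, |a - f n| ≤ ε * C) → Tendsto f atTop (𝓝 a) := by
    intro f a C hC h
    rw [Metric.tendsto_nhds]
    intro ε hε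
    filter_upwards [h (ε / (C + 1)) (by positivity)] with n hn
    rw [dist_comm, Real.dist_eq]
    refine hn.trans_lt ?_
    rw [div_mul_eq_mul_div, div_lt_iff₀ (by positivity)]
    nlinarith
  have hXX : ∀ i j, Tendsto (fun n => naturalLift T (Y n) s t i j) atTop (𝓝 (XX s t i j)) :=
    fun i j => lim _ _ _ (by positivity) fun ε hε => (hclose ε hε).mono fun n hn =>
      hn.2.2 s hs' t ht' i j
  have hXk : ∀ i, Tendsto (fun n => Y n t i - Y n s i) atTop (𝓝 (X t i - X s i)) :=
    fun i => lim _ _ (|t - s| ^ γ) (by positivity) fun ε hε => (hclose ε hε).mono fun n hn => by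
      refine le_trans ?_ (hn.2.1 s hs' t ht')
      refine le_trans (le_of_eq ?_) (abs_coord_le _ i)
      simp only [PiLp.sub_apply]
      congr 1; ring
  refine tendsto_nhds_unique ((hXX i j).add (hXX j i)) ?_
  simp_rw [naturalLift_symm hT (hY _) hs hst ht]
  exact (hXk i).mul (hXk j)

/-- `p` is a partition of `[s,t]` into `n` intervals, of mesh less than `δ`. -/
structure IsPartition (δ s t : ℝ) (n : ℕ) (p : ℕ → ℝ) : Prop where
  mono : Monotone p
  start : p 0 = s
  finish : p n = t
  mesh : ∀ i < n, p (i + 1) - p i < δ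

/-- Serves twice: to glue the two halves in the dyadic construction of the sewing estimate, and to
extend a partition of [0,s] to one of [0,t]. -/
theorem IsPartition.concat {δ s m t : ℝ} {n n' : ℕ} {p q : ℕ → ℝ} (hp : IsPartition δ s m n p)
    (hq : IsPartition δ m t n' q) : ∃ r, IsPartition δ s t (n + n') r ∧ ∀ Ξ : ℝ → ℝ → ℝ,
      ∑ i ∈ Finset.range (n + n'), Ξ (r i) (r (i + 1))
        = ∑ i ∈ Finset.range n, Ξ (p i) (p (i + 1))
          + ∑ i ∈ Finset.range n', Ξ (q i) (q (i + 1)) := by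
  set r : ℕ → ℝ := fun i => if i ≤ n then p i else q (i - n) with hr
  have r1 : ∀ i ≤ n, r i = p i := fun i hi => if_pos hi
  have r2 : ∀ i, r (n + i) = q i := fun i => by
    rcases Nat.eq_zero_or_pos i with rfl | hi
    · rw [add_zero, r1 n le_rfl, hp.finish, hq.start]
    · simp only [hr]; rw [if_neg (by omega), Nat.add_sub_cancel_left]
  refine ⟨r, ⟨monotone_nat_of_le_succ fun i => ?_, ?_, ?_, fun i hi => ?_⟩, fun Ξ => ?_⟩
  · rcases lt_or_ge i n with h | h
    · rw [r1 i h.le, r1 (i + 1) h]; exact hp.mono (Nat.le_succ i)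
    · obtain ⟨j, rfl⟩ := Nat.exists_eq_add_of_le h
      rw [add_assoc, r2, r2]; exact hq.mono (Nat.le_succ j)
  · rw [r1 0 (Nat.zero_le _), hp.start]
  · rw [r2, hq.finish]
  · rcases lt_or_ge i n with h | h
    · rw [r1 i h.le, r1 (i + 1) h]; exact hp.mesh i h
    · obtain ⟨j, rfl⟩ := Nat.exists_eq_add_of_le h
      rw [add_assoc, r2, r2]; exact hq.mesh j (by omega)
  · rw [Finset.sum_range_add]
    congr 1
    · refine Finset.sum_congr rfl fun i hi => ?_
      rw [Finset.mem_range] at hi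
      rw [r1 i hi.le, r1 (i + 1) hi]
    · refine Finset.sum_congr rfl fun i _ => ?_
      rw [add_assoc, r2, r2]

/-- Sewing: there are partitions of `[s,t]` of arbitrarily small mesh along which the Riemann sums
of an almost additive germ stay close to the germ. -/
theorem exists_partition_sewing {Ξ : ℝ → ℝ → ℝ} {C θ : ℝ} (hC : 0 ≤ C) (hθ : 1 < θ)
    (hΞ : ∀ s u t, 0 ≤ s → s ≤ u → u ≤ t → t ≤ T → |Ξ s t - Ξ s u - Ξ u t| ≤ C * (t - s) ^ θ)
    {δ : ℝ} (hδ : 0 < δ) {s t : ℝ} (hs : 0 ≤ s) (hst : s ≤ t) (ht : t ≤ T) :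
    ∃ n p, IsPartition δ s t n p ∧
      |∑ i ∈ Finset.range n, Ξ (p i) (p (i + 1)) - Ξ s t|
        ≤ C / (1 - 2 ^ (1 - θ)) * (t - s) ^ θ := by
  have h2 : (2 : ℝ) ^ (1 - θ) < 1 := Real.rpow_lt_one_of_one_lt_of_neg one_lt_two (by linarith)
  set B := C / (1 - 2 ^ (1 - θ)) with hB
  have hB0 : 0 ≤ B := div_nonneg hC (by linarith)
  -- B is the fixed point that closes the induction: bisection multiplies the accumulated error by
  -- 2^{1-θ} < 1 and adds one new defect C.
  have hBC : B * 2 ^ (1 - θ) + C = B := by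
    have : 1 - (2 : ℝ) ^ (1 - θ) ≠ 0 := by linarith
    rw [hB]; field_simp; ring
  -- The induction is on the number N of successive bisections that bring the length below δ.
  obtain ⟨N, hN⟩ : ∃ N : ℕ, t - s < δ * 2 ^ N := by
    obtain ⟨N, hN⟩ := pow_unbounded_of_one_lt ((t - s) / δ) (one_lt_two (α := ℝ))
    exact ⟨N, by rwa [div_lt_iff₀' hδ] at hN⟩
  induction N generalizing s t with
  | zero =>
    refine ⟨1, fun i => if i = 0 then s else t, ⟨fun i j hij => ?_, by simp, by simp,
      fun i hi => ?_⟩, ?_⟩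
    · change (if i = 0 then s else t) ≤ if j = 0 then s else t
      split_ifs <;> first | omega | simp
    · obtain rfl : i = 0 := by omega
      simpa using hN
    · have : 0 ≤ (t - s) ^ θ := Real.rpow_nonneg (by linarith) _
      simpa using mul_nonneg hB0 this
  | succ N ih =>
    set m := (s + t) / 2 with hm
    have h1 : s ≤ m := by rw [hm]; linarith
    have h3 : m ≤ t := by rw [hm]; linarith
    have e1 : m - s = (t - s) / 2 := by rw [hm]; ring
    have e2 : t - m = (t - s) / 2 := by rw [hm]; ring
    rw [pow_succ] at hN
    obtain ⟨n, p, hp, hp'⟩ := ih hs h1 (h3.trans ht) (by rw [e1]; linarith)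
    obtain ⟨n', q, hq, hq'⟩ := ih (hs.trans h1) h3 ht (by rw [e2]; linarith)
    obtain ⟨r, hr, hr'⟩ := hp.concat hq
    refine ⟨n + n', r, hr, ?_⟩
    have h4 := hΞ s m t hs h1 h3 ht
    rw [e1] at hp'
    rw [e2] at hq'
    have h5 : ((t - s) / 2) ^ θ + ((t - s) / 2) ^ θ = 2 ^ (1 - θ) * (t - s) ^ θ := by
      rw [Real.div_rpow (by linarith) zero_le_two, Real.rpow_sub two_pos, Real.rpow_one]; ring
    have h6 : B * (t - s) ^ θ = B * ((t - s) / 2) ^ θ + B * ((t - s) / 2) ^ θ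
        + C * (t - s) ^ θ := by
      rw [← mul_add, h5]; nth_rewrite 1 [← hBC]; ring
    rw [hr', h6]
    rw [abs_le] at *
    constructor <;> linarith [hp'.1, hp'.2, hq'.1, hq'.2, h4.1, h4.2]

/-- The local approximation of a controlled rough integral. -/
def germ (X : ℝ → E d) (XX : ℝ → ℝ → Matrix (Fin d) (Fin d) ℝ)
    (a : Fin d → ℝ → ℝ) (a' : Fin d → ℝ → E d) (s t : ℝ) : ℝ :=
  ∑ k, a k s * (X t k - X s k) + ∑ k, ∑ j, a' k s j * XX s t j k

theorem abs_double_sum_le {f : Fin d → Fin d → ℝ} {g : Fin d → Fin d → ℝ}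
    (h : ∀ k j, |f k j| ≤ g k j) : |∑ k, ∑ j, f k j| ≤ ∑ k, ∑ j, g k j :=
  (Finset.abs_sum_le_sum_abs _ _).trans (Finset.sum_le_sum fun k _ =>
    (Finset.abs_sum_le_sum_abs _ _).trans (Finset.sum_le_sum fun j _ => h k j))

theorem rpow_mul_rpow_le {α β s u t : ℝ} (hα : 0 ≤ α) (hβ : 0 ≤ β) (hsu : s ≤ u) (hut : u ≤ t) :
    |u - s| ^ α * |t - u| ^ β ≤ (t - s) ^ (α + β) := by
  rw [abs_of_nonneg (by linarith), abs_of_nonneg (by linarith),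
    Real.rpow_add_of_nonneg (by linarith) hα hβ]
  exact mul_le_mul (Real.rpow_le_rpow (by linarith) (by linarith) hα)
    (Real.rpow_le_rpow (by linarith) (by linarith) hβ)
    (Real.rpow_nonneg (by linarith) _) (Real.rpow_nonneg (by linarith) _)

/-- By Chen's relation the defect consists of the controlled remainder times an increment of X
(order 2γ + γ) and the increment of the derivative times 𝕏 (order γ + 2γ). It is therefore of order
3γ, as the sewing estimate requires. -/
theorem IsRoughPath.germ_defect (hγ : 0 < γ) {X : ℝ → E d}
    {XX : ℝ → ℝ → Matrix (Fin d) (Fin d) ℝ} (hX : IsRoughPath T γ X XX)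
    {a : Fin d → ℝ → ℝ} {a' : Fin d → ℝ → E d} (ha : ∀ k, IsControlled T γ X (a k) (a' k)) :
    ∃ C, 0 ≤ C ∧ ∀ s u t, 0 ≤ s → s ≤ u → u ≤ t → t ≤ T →
      |germ X XX a a' s t - germ X XX a a' s u - germ X XX a a' u t| ≤ C * (t - s) ^ (3 * γ) := by
  obtain ⟨C₁, h₁, hC₁⟩ := hX.path_holder.exists_nonneg
  choose C₂ h₂ hC₂ using fun i j => (hX.area_holder i j).exists_nonneg
  choose C₃ h₃ hC₃ using fun k => (ha k).2.1.exists_nonneg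
  choose C₄ h₄ hC₄ using fun k => (ha k).2.2.exists_nonneg
  refine ⟨∑ k, C₄ k * C₁ + ∑ k, ∑ j, C₃ k * C₂ j k, ?_, fun s u t hs hsu hut ht => ?_⟩
  · exact add_nonneg (Finset.sum_nonneg fun k _ => mul_nonneg (h₄ k) h₁)
      (Finset.sum_nonneg fun k _ => Finset.sum_nonneg fun j _ => mul_nonneg (h₃ k) (h₂ j k))
  have hs' : s ∈ Icc 0 T := ⟨hs, by linarith⟩
  have hu' : u ∈ Icc 0 T := ⟨by linarith, by linarith⟩
  have ht' : t ∈ Icc 0 T := ⟨by linarith, ht⟩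
  have e : germ X XX a a' s t - germ X XX a a' s u - germ X XX a a' u t
      = -∑ k, (a k u - a k s - ⟪a' k s, X u - X s⟫) * (X t k - X u k)
        + ∑ k, ∑ j, (a' k s j - a' k u j) * XX u t j k := by
    -- The product term of Chen's relation, contracted with a'_s, is exactly the linear part of a_u
    -- - a_s; only the remainder survives.
    have h : ∀ k j, XX s t j k = XX s u j k + XX u t j k + (X u j - X s j) * (X t k - X u k) :=
      fun k j => by have := hX.chen s u t hs hsu hut ht j k; linarith
    have hin : ∀ k, ⟪a' k s, X u - X s⟫ = ∑ j, a' k s j * (X u j - X s j) := fun k => by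
      simp [PiLp.inner_apply, mul_comm]
    simp only [germ, hin, ← Finset.sum_sub_distrib, ← Finset.sum_add_distrib,
      ← Finset.sum_neg_distrib]
    refine Finset.sum_congr rfl fun k _ => ?_
    simp only [h, sub_mul, mul_add, Finset.sum_add_distrib, Finset.sum_sub_distrib, Finset.sum_mul,
      mul_sub]
    simp only [← mul_assoc]
    ring
  rw [e, add_mul, Finset.sum_mul, Finset.sum_mul]
  simp_rw [Finset.sum_mul]
  have e3 : 3 * γ = 2 * γ + γ := by ring
  refine (abs_add_le _ _).trans (add_le_add ?_ (abs_double_sum_le fun k j => ?_))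
  · rw [abs_neg]
    refine (Finset.abs_sum_le_sum_abs _ _).trans (Finset.sum_le_sum fun k _ => ?_)
    rw [abs_mul]
    have b1 := hC₄ k s hs' u hu'
    have b2 := (abs_coord_le (X t - X u) k).trans (hC₁ u hu' t ht')
    rw [PiLp.sub_apply] at b2
    have b3 := rpow_mul_rpow_le (α := 2 * γ) (β := γ) (by positivity) hγ.le hsu hut
    rw [← e3] at b3
    calc _ ≤ (C₄ k * |u - s| ^ (2 * γ)) * (C₁ * |t - u| ^ γ) :=
          mul_le_mul b1 b2 (abs_nonneg _) (mul_nonneg (h₄ k) (by positivity))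
      _ = C₄ k * C₁ * (|u - s| ^ (2 * γ) * |t - u| ^ γ) := by ring
      _ ≤ _ := mul_le_mul_of_nonneg_left b3 (mul_nonneg (h₄ k) h₁)
  · rw [abs_mul]
    have b1 := (abs_coord_le (a' k u - a' k s) j).trans (hC₃ k s hs' u hu')
    rw [PiLp.sub_apply, abs_sub_comm] at b1
    have b2 := hC₂ j k u hu' t ht'
    have b3 := rpow_mul_rpow_le (α := γ) (β := 2 * γ) hγ.le (by positivity) hsu hut
    rw [add_comm, ← e3] at b3
    calc _ ≤ (C₃ k * |u - s| ^ γ) * (C₂ j k * |t - u| ^ (2 * γ)) :=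
          mul_le_mul b1 b2 (abs_nonneg _) (mul_nonneg (h₃ k) (by positivity))
      _ = C₃ k * C₂ j k * (|u - s| ^ γ * |t - u| ^ (2 * γ)) := by ring
      _ ≤ _ := mul_le_mul_of_nonneg_left b3 (mul_nonneg (h₃ k) (h₂ j k))

/-- The rough integral of a controlled path is approximated by its germ. -/
theorem IsRoughPath.exists_integral_bound (hγ : 1 / 3 < γ) {X : ℝ → E d}
    {XX : ℝ → ℝ → Matrix (Fin d) (Fin d) ℝ} (hX : IsRoughPath T γ X XX)
    {a : Fin d → ℝ → ℝ} {a' : Fin d → ℝ → E d} (ha : ∀ k, IsControlled T γ X (a k) (a' k)) :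
    ∃ C, 0 ≤ C ∧ ∀ s t I J, 0 ≤ s → s ≤ t → t ≤ T → HasRoughIntegral X XX a a' 0 s I →
      HasRoughIntegral X XX a a' 0 t J →
      |J - I - germ X XX a a' s t| ≤ C * (t - s) ^ (3 * γ) := by
  obtain ⟨C, hC, h⟩ := hX.germ_defect (by linarith) ha
  have hθ : 1 < 3 * γ := by linarith
  have h2 : (2 : ℝ) ^ (1 - 3 * γ) < 1 :=
    Real.rpow_lt_one_of_one_lt_of_neg one_lt_two (by linarith)
  refine ⟨_, div_nonneg hC (sub_nonneg.2 h2.le), fun s t I J hs hst ht hI hJ => ?_⟩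
  refine le_of_forall_pos_lt_add fun ε hε => ?_
  obtain ⟨δ, hδ, hδI⟩ := hI (ε / 2) (by positivity)
  obtain ⟨δ', hδ', hδJ⟩ := hJ (ε / 2) (by positivity)
  -- On [0,s] any partition fine enough for both integrals will do. Followed by a sewing partition
  -- of [s,t] it gives one of [0,t], and the sums over [0,s] cancel in J - I.
  obtain ⟨n, p, hp, -⟩ := exists_partition_sewing hC hθ h (lt_min hδ hδ') le_rfl hs (hst.trans ht)
  obtain ⟨n', q, hq, hq'⟩ := exists_partition_sewing hC hθ h (lt_min hδ hδ') hs hst ht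
  obtain ⟨r, hr, hr'⟩ := hp.concat hq
  have b1 := hδI n p hp.mono hp.start hp.finish fun i hi =>
    (hp.mesh i hi).trans_le (min_le_left _ _)
  have b2 := hδJ _ r hr.mono hr.start hr.finish fun i hi =>
    (hr.mesh i hi).trans_le (min_le_right _ _)
  have e1 := hr' (germ X XX a a')
  change |∑ i ∈ Finset.range n, germ X XX a a' (p i) (p (i + 1)) - I| < _ at b1
  change |∑ i ∈ Finset.range (n + n'), germ X XX a a' (r i) (r (i + 1)) - J| < _ at b2
  rw [e1] at b2
  rw [abs_lt] at *
  rw [abs_le] at hq'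
  constructor <;> linarith [hq'.1, hq'.2, b1.1, b1.2, b2.1, b2.2]

end RoughTransport
end

noncomputable section
namespace RoughTransport

/-! ### Removing the noise by a translation -/

variable {d : ℕ} {T γ K M D : ℝ}

/-- The function `(t,x) ↦ u(t, x + Z_t)`. -/
def shift (Z : ℝ → E d) (u : ℝ × E d → ℝ) : ℝ × E d → ℝ := fun z => u (z.1, z.2 + Z z.1)

/-- The vector field `(t,x) ↦ b_t(x + Z_t)`. -/
def shiftField (Z : ℝ → E d) (b : ℝ → E d → E d) : ℝ → E d → E d := fun t x => b t (x + Z t)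

/-- `v` is a weak solution of `∂_t v + c · ∇v = 0` with initial condition `v₀`. -/
def IsWeakTransport (T : ℝ) (c : ℝ → E d → E d) (v₀ : E d → ℝ) (v : ℝ × E d → ℝ) : Prop :=
  ∀ φ, IsTest φ → ∀ᵐ t ∂(volume.restrict (Icc 0 T)),
    ∫ x, v (t, x) * φ x = (∫ x, v₀ x * φ x) + ∫ s in (0 : ℝ)..t, drift v c s φ

theorem divergence_comp_add (c : E d → E d) (a x : E d) :
    divergence (fun x => c (x + a)) x = divergence c (x + a) := by
  simp only [divergence, fderiv_comp_add_right]

theorem drift_shift (Z : ℝ → E d) (u : ℝ × E d → ℝ) (b : ℝ → E d → E d) (r : ℝ) (φ : E d → ℝ) :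
    drift (shift Z u) (shiftField Z b) r φ = drift u b r (tau (-Z r) φ) := by
  rw [drift, drift]
  conv_rhs => rw [← integral_add_right_eq_self _ (Z r)]
  congr 1; funext x
  simp only [adv, shift, shiftField, fderiv_tau, tau, add_neg_cancel_right]
  congr 3
  exact divergence_comp_add _ _ _

theorem integral_shift (Z : ℝ → E d) (u : ℝ × E d → ℝ) (r : ℝ) (φ : E d → ℝ) :
    ∫ x, shift Z u (r, x) * φ x = ∫ x, u (r, x) * tau (-Z r) φ x := by
  conv_rhs => rw [← integral_add_right_eq_self _ (Z r)]
  congr 1; funext x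
  simp only [shift, tau, add_neg_cancel_right]

theorem partialDeriv_comm {φ : E d → ℝ} (hφ : IsTest φ) (j k : Fin d) :
    partialDeriv j (partialDeriv k φ) = partialDeriv k (partialDeriv j φ) := by
  have hd : Differentiable ℝ (fderiv ℝ φ) :=
    (hφ.1.fderiv_right (m := ∞) (by simp)).differentiable (by simp)
  have h : ∀ (j k : Fin d) (x : E d), partialDeriv j (partialDeriv k φ) x
      = fderiv ℝ (fderiv ℝ φ) x (EuclideanSpace.single j 1) (EuclideanSpace.single k 1) := by
    intro j k x
    have : HasFDerivAt (partialDeriv k φ) _ x :=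
      (hd x).hasFDerivAt.clm_apply (hasFDerivAt_const (EuclideanSpace.single k (1 : ℝ)) x)
    rw [partialDeriv, this.fderiv]
    simp
  funext x
  rw [h, h]
  exact (hφ.1.contDiffAt (x := x)).isSymmSndFDerivAt (by
    rw [minSmoothness_of_isRCLikeNormedField]; exact ENat.LEInfty.out) _ _

/-- A symmetric A only sees the symmetric part of B. Applied to second derivatives and to 𝕏, this
removes the Lévy area and leaves half the square of the increment. -/
theorem symm_contract {A : Fin d → Fin d → ℝ} (hA : ∀ k j, A k j = A j k)
    {B : Matrix (Fin d) (Fin d) ℝ} {x : Fin d → ℝ} (hB : ∀ i j, B i j + B j i = x i * x j) :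
    ∑ k, ∑ j, A k j * B j k = 1 / 2 * ∑ k, ∑ j, x k * x j * A k j := by
  have h1 : ∑ k, ∑ j, A k j * B j k = ∑ k, ∑ j, A k j * B k j := by
    rw [Finset.sum_comm]
    exact Finset.sum_congr rfl fun k _ => Finset.sum_congr rfl fun j _ => by rw [hA]
  have h2 : ∑ k, ∑ j, x k * x j * A k j
      = ∑ k, ∑ j, A k j * B k j + ∑ k, ∑ j, A k j * B j k := by
    rw [← Finset.sum_add_distrib]
    refine Finset.sum_congr rfl fun k _ => ?_
    rw [← Finset.sum_add_distrib]
    exact Finset.sum_congr rfl fun j _ => by rw [← hB]; ring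
  rw [h2, ← h1]; ring

/-- Replacing a moving translation by a frozen one in the drift costs δ·δ^γ after integration in
time; γ ≤ 1/2 is what makes this at most a multiple of δ^{3γ}. -/
theorem rpow_one_add_le (hγ : γ ≤ 1 / 2) (hγ0 : 0 ≤ γ) {δ : ℝ} (h0 : 0 ≤ δ) (hδ : δ ≤ T) :
    δ ^ (1 + γ) ≤ T ^ (1 - 2 * γ) * δ ^ (3 * γ) := by
  have : 1 + γ = (1 - 2 * γ) + 3 * γ := by ring
  rw [this, Real.rpow_add_of_nonneg h0 (by linarith) (by linarith)]
  exact mul_le_mul_of_nonneg_right (Real.rpow_le_rpow h0 hδ (by linarith)) (by positivity)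

theorem hasDerivWithinAt_zero_of_le {g : ℝ → ℝ} {C θ s : ℝ} (hθ : 1 < θ) (hs : s < T)
    (h : ∀ t, s ≤ t → t ≤ T → |g t - g s| ≤ C * (t - s) ^ θ) :
    HasDerivWithinAt g 0 (Ici s) s := by
  rw [hasDerivWithinAt_iff_isLittleO]
  have h1 : (fun t => g t - g s - (t - s) • (0 : ℝ)) =O[𝓝[≥] s] fun t => (t - s) ^ θ := by
    refine Asymptotics.IsBigO.of_bound |C| ?_
    filter_upwards [Icc_mem_nhdsGE hs] with t ht
    rw [smul_zero, sub_zero, Real.norm_eq_abs, Real.norm_eq_abs, ← abs_mul]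
    exact (h t ht.1 ht.2).trans (le_abs_self _)
  refine h1.trans_isLittleO ?_
  rw [Asymptotics.isLittleO_iff_tendsto' (by
    filter_upwards [self_mem_nhdsWithin] with t ht h0
    rw [h0, Real.zero_rpow (by linarith)])]
  have h2 : Tendsto (fun t => (t - s) ^ (θ - 1)) (𝓝[≥] s) (𝓝 0) := by
    have : Continuous fun t => (t - s) ^ (θ - 1) :=
      (continuous_sub_right s).rpow_const fun _ => Or.inr (by linarith)
    simpa [Real.zero_rpow (sub_pos.2 hθ).ne'] using (this.tendsto s).mono_left nhdsWithin_le_nhds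
  refine h2.congr' ?_
  filter_upwards [self_mem_nhdsWithin] with t ht
  rcases eq_or_lt_of_le (sub_nonneg.2 (mem_Ici.1 ht)) with h0 | h0
  · rw [← h0, Real.zero_rpow (sub_pos.2 hθ).ne']; simp
  · rw [Real.rpow_sub h0, Real.rpow_one]

theorem IsVersion.continuousOn_tau {u : ℝ × E d → ℝ} {U : (E d → ℝ) → ℝ → ℝ} (hT : 0 < T)
    (hu : IsBdd T K u) (hU : IsVersion T u U) {φ : E d → ℝ} (hφ : IsTest φ) {a : ℝ → E d}
    (ha : Continuous a) {H : ℝ} (hH : ∀ t, ‖a t‖ ≤ H) :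
    ContinuousOn (fun t => U (tau (a t) φ) t) (Icc 0 T) := by
  obtain ⟨C, -, hC⟩ := hU.taylor_one hT hu hφ (H + H)
  intro s hs
  have h1 : Tendsto (fun t => C * ‖a t - a s‖) (𝓝[Icc 0 T] s) (𝓝 0) := by
    have : Continuous fun t => C * ‖a t - a s‖ := by fun_prop
    simpa using (this.tendsto s).mono_left nhdsWithin_le_nhds
  have h2 : Tendsto (fun t => U (tau (a t) φ) t - U (tau (a s) φ) t) (𝓝[Icc 0 T] s) (𝓝 0) := by
    rw [tendsto_zero_iff_norm_tendsto_zero]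
    refine squeeze_zero' (Eventually.of_forall fun _ => norm_nonneg _) ?_ h1
    filter_upwards [self_mem_nhdsWithin] with t ht
    have := hC (a s) (a t - a s) (by linarith [hH s, norm_nonneg (a s)])
      ((norm_sub_le _ _).trans (add_le_add (hH t) (hH s))) t ht
    simpa using this
  have h3 := h2.add (hU.cont _ (hφ.tau (a s)) s hs)
  simpa [ContinuousWithinAt] using h3

/-- The properties of the versions in the definition of weak controlled solutions. -/
def IsSolutionVersion (T γ : ℝ) (b : ℝ → E d → E d) (X : ℝ → E d)
    (XX : ℝ → ℝ → Matrix (Fin d) (Fin d) ℝ) (u₀ : E d → ℝ) (u : ℝ × E d → ℝ)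
    (U : (E d → ℝ) → ℝ → ℝ) : Prop :=
  ∀ φ : E d → ℝ, IsTest φ →
    (∀ᵐ t ∂(volume.restrict (Icc 0 T)), U φ t = ∫ x, u (t, x) * φ x) ∧
    IsControlled T γ X (U φ) (fun t => WithLp.toLp 2 fun k => U (partialDeriv k φ) t) ∧
    ∀ t ∈ Icc 0 T, ∃ I : ℝ,
      HasRoughIntegral X XX (fun k => U (partialDeriv k φ))
        (fun k s => WithLp.toLp 2 fun j => U (partialDeriv j (partialDeriv k φ)) s) 0 t I ∧
      U φ t = (∫ x, u₀ x * φ x) + (∫ s in (0 : ℝ)..t, drift u b s φ) + I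

section

variable {b : ℝ → E d → E d} {X Z : ℝ → E d} {XX : ℝ → ℝ → Matrix (Fin d) (Fin d) ℝ}
  {u₀ : E d → ℝ} {u : ℝ × E d → ℝ} {U : (E d → ℝ) → ℝ → ℝ}

theorem IsSolutionVersion.isVersion (hγ : 0 < γ) (hU : IsSolutionVersion T γ b X XX u₀ u U) :
    IsVersion T u U :=
  ⟨fun φ hφ => (hU φ hφ).1, fun φ hφ => (hU φ hφ).2.1.1.continuousOn hγ⟩

theorem pow_three_le {x δ C : ℝ} (hx : 0 ≤ x) (hδ : 0 ≤ δ) (h : x ≤ C * δ ^ γ) :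
    x ^ 3 ≤ C ^ 3 * δ ^ (3 * γ) := by
  refine (pow_le_pow_left₀ hx h 3).trans (le_of_eq ?_)
  rw [mul_pow, mul_comm 3 γ, Real.rpow_mul hδ]
  norm_cast

/-- Geometricity is needed only here: the germ of the rough integral becomes the second-order Taylor
polynomial of a translation. -/
theorem germ_eq (hT : 0 < T) (hX : IsGeometricRoughPath T γ X XX) {φ : E d → ℝ} (hφ : IsTest φ)
    (U : (E d → ℝ) → ℝ → ℝ) {s t : ℝ} (hs : 0 ≤ s) (hst : s ≤ t) (ht : t ≤ T) :
    germ X XX (fun k => U (partialDeriv k φ))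
      (fun k s => WithLp.toLp 2 fun j => U (partialDeriv j (partialDeriv k φ)) s) s t
      = ∑ k, (X t - X s) k * U (partialDeriv k φ) s
        + 1 / 2 * ∑ k, ∑ j, (X t - X s) k * (X t - X s) j
          * U (partialDeriv j (partialDeriv k φ)) s := by
  rw [germ]
  congr 1
  · exact Finset.sum_congr rfl fun k _ => mul_comm _ _
  · exact symm_contract (A := fun k j => U (partialDeriv j (partialDeriv k φ)) s)
      (fun k j => by rw [partialDeriv_comm hφ]) (hX.symm_part hT hs hst ht)

/-- Let ψ = φ(· - X_s), x = X_t - X_s, P_r = Σ x_k U_r(∂_kψ) and Q_r = Σ x_k x_j U_r(∂_j∂_kψ). Up to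
order 3γ, moving the translation contributes -P_t + Q_t/2, the equation contributes P_s + Q_s/2
besides the drift, and control gives P_t - P_s = Q_s. The sum is (Q_t - Q_s)/2, again of order 3γ.
The constant depends on s through ψ, which is enough for a right derivative at s. -/
theorem IsSolutionVersion.local_bound (hT : 0 < T) (hγ : 1 / 3 < γ) (hγ' : γ ≤ 1 / 2)
    (hb : IsRegular T M D b) (hX : IsGeometricRoughPath T γ X XX) (hZ : Continuous Z)
    (hZX : ∀ t ∈ Icc 0 T, Z t = X t) {H : ℝ} (hH : ∀ t, ‖Z t‖ ≤ H) (hu : IsBdd T K u)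
    (hU : IsSolutionVersion T γ b X XX u₀ u U) {φ : E d → ℝ} (hφ : IsTest φ) {s : ℝ}
    (hs : s ∈ Icc 0 T) : ∃ C, ∀ t, s ≤ t → t ≤ T →
      |(U (tau (-Z t) φ) t - ∫ r in (0 : ℝ)..t, drift u b r (tau (-Z r) φ))
        - (U (tau (-Z s) φ) s - ∫ r in (0 : ℝ)..s, drift u b r (tau (-Z r) φ))|
        ≤ C * (t - s) ^ (3 * γ) := by
  have hγ0 : 0 < γ := by linarith
  have hV := hU.isVersion hγ0
  set ψ := tau (-Z s) φ with hψ_def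
  have hψ : IsTest ψ := hφ.tau _
  obtain ⟨C₀, h₀, hC₀⟩ := hX.1.path_holder.exists_nonneg
  obtain ⟨C₁, h₁, hC₁⟩ := hV.taylor_three hT hu hφ (H + H)
  obtain ⟨C₂, h₂, hC₂⟩ := hX.1.exists_integral_bound hγ
    (a := fun k => U (partialDeriv k ψ))
    (a' := fun k s => WithLp.toLp 2 fun j => U (partialDeriv j (partialDeriv k ψ)) s)
    (fun k => (hU _ (hψ.partialDeriv k)).2.1)
  choose C₃ h₃ hC₃ using fun k => (hU _ (hψ.partialDeriv k)).2.1.2.2.exists_nonneg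
  choose C₄ h₄ hC₄ using fun k j =>
    (hU _ ((hψ.partialDeriv k).partialDeriv j)).2.1.1.exists_nonneg
  obtain ⟨C₅, h₅, hC₅⟩ := hφ.exists_drift_lipschitz K M D H hu.nonneg hb.M_nonneg hb.D_nonneg
  refine ⟨C₁ * C₀ ^ 3 + C₂ + ∑ k, C₀ * C₃ k + 1 / 2 * (∑ k, ∑ j, C₀ * C₀ * C₄ k j)
    + C₅ * C₀ * T ^ (1 - 2 * γ), fun t hst htT => ?_⟩
  have ht : t ∈ Icc 0 T := ⟨hs.1.trans hst, htT⟩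
  have h0 : (0 : ℝ) ∈ Icc 0 T := ⟨le_rfl, hT.le⟩
  set δ := t - s with hδ
  have hδ0 : 0 ≤ δ := sub_nonneg.2 hst
  have habs : |t - s| = δ := abs_of_nonneg hδ0
  set x := X t - X s with hx
  have hxb : ‖x‖ ≤ C₀ * δ ^ γ := habs ▸ hC₀ s hs t ht
  have hxk : ∀ k, |x k| ≤ C₀ * δ ^ γ := fun k => (abs_coord_le x k).trans hxb
  -- Third-order Taylor expansion of the translation at the frozen time t.
  have T1 : |U (tau (-Z t) φ) t - U ψ t + ∑ k, x k * U (partialDeriv k ψ) t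
      - 1 / 2 * ∑ k, ∑ j, x k * x j * U (partialDeriv j (partialDeriv k ψ)) t|
      ≤ C₁ * C₀ ^ 3 * δ ^ (3 * γ) := by
    have e : -Z t = -Z s + -x := by rw [hx, hZX t ht, hZX s hs]; abel
    have hxH : ‖-x‖ ≤ H + H := by
      rw [norm_neg, hx, ← hZX t ht, ← hZX s hs]
      exact (norm_sub_le _ _).trans (add_le_add (hH t) (hH s))
    have := hC₁ (-Z s) (-x) (by rw [norm_neg]; linarith [hH s, norm_nonneg (Z s)]) hxH t ht
    rw [norm_neg, ← e] at this
    simp only [PiLp.neg_apply, mul_neg, neg_mul, neg_neg, Finset.sum_neg_distrib, sub_neg_eq_add,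
      ← partialDeriv_tau] at this
    refine this.trans ?_
    rw [mul_assoc]
    exact mul_le_mul_of_nonneg_left (pow_three_le (norm_nonneg _) hδ0 hxb) h₁
  -- The equation tested with the frozen function ψ, the rough integral being replaced by its germ.
  have T2 : |U ψ t - U ψ s - (∫ r in s..t, drift u b r ψ)
      - (∑ k, x k * U (partialDeriv k ψ) s
        + 1 / 2 * ∑ k, ∑ j, x k * x j * U (partialDeriv j (partialDeriv k ψ)) s)|
      ≤ C₂ * δ ^ (3 * γ) := by
    obtain ⟨I, hI, eI⟩ := (hU ψ hψ).2.2 s hs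
    obtain ⟨J, hJ, eJ⟩ := (hU ψ hψ).2.2 t ht
    have := hC₂ s t I J hs.1 hst htT hI hJ
    rw [germ_eq hT hX hψ U hs.1 hst htT] at this
    have e : J - I = U ψ t - U ψ s - (∫ r in s..t, drift u b r ψ) := by
      rw [eI, eJ, ← intervalIntegral.integral_add_adjacent_intervals
        (intervalIntegrable_drift hu hb hψ h0 hs) (intervalIntegrable_drift hu hb hψ hs ht)]
      ring
    rwa [e] at this
  -- The factor x has order γ and the controlled remainder of U(∂_kψ) has order 2γ.
  have T3 : |∑ k, x k * U (partialDeriv k ψ) t - ∑ k, x k * U (partialDeriv k ψ) s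
      - ∑ k, ∑ j, x k * x j * U (partialDeriv j (partialDeriv k ψ)) s|
      ≤ (∑ k, C₀ * C₃ k) * δ ^ (3 * γ) := by
    have e : ∑ k, x k * U (partialDeriv k ψ) t - ∑ k, x k * U (partialDeriv k ψ) s
      - ∑ k, ∑ j, x k * x j * U (partialDeriv j (partialDeriv k ψ)) s
      = ∑ k, x k * (U (partialDeriv k ψ) t - U (partialDeriv k ψ) s
        - ⟪(WithLp.toLp 2 fun j => U (partialDeriv j (partialDeriv k ψ)) s : E d), x⟫) := by
      simp only [mul_sub, Finset.sum_sub_distrib, PiLp.inner_apply, Finset.mul_sum]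
      congr 1
      refine Finset.sum_congr rfl fun k _ => Finset.sum_congr rfl fun j _ => ?_
      simp; ring
    rw [e, Finset.sum_mul]
    refine (Finset.abs_sum_le_sum_abs _ _).trans (Finset.sum_le_sum fun k _ => ?_)
    rw [abs_mul]
    have := hC₃ k s hs t ht
    rw [habs] at this
    refine (mul_le_mul (hxk k) this (abs_nonneg _) (by positivity)).trans (le_of_eq ?_)
    have e3 : 3 * γ = γ + 2 * γ := by ring
    rw [e3, Real.rpow_add_of_nonneg hδ0 hγ0.le (by positivity)]; ring
  have T4 : |∑ k, ∑ j, x k * x j * U (partialDeriv j (partialDeriv k ψ)) t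
      - ∑ k, ∑ j, x k * x j * U (partialDeriv j (partialDeriv k ψ)) s|
      ≤ (∑ k, ∑ j, C₀ * C₀ * C₄ k j) * δ ^ (3 * γ) := by
    simp only [← Finset.sum_sub_distrib, ← mul_sub, Finset.sum_mul]
    refine abs_double_sum_le fun k j => ?_
    rw [abs_mul, abs_mul]
    have := hC₄ k j s hs t ht
    rw [habs] at this
    refine (mul_le_mul (mul_le_mul (hxk k) (hxk j) (abs_nonneg _) (by positivity)) this
      (abs_nonneg _) (by positivity)).trans (le_of_eq ?_)
    have e3 : 3 * γ = γ + γ + γ := by ring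
    rw [e3, Real.rpow_add_of_nonneg hδ0 (by positivity) hγ0.le,
      Real.rpow_add_of_nonneg hδ0 hγ0.le hγ0.le]; ring
  have hint : ∀ {s t}, s ∈ Icc 0 T → t ∈ Icc 0 T →
      IntervalIntegrable (fun r => drift u b r (tau (-Z r) φ)) volume s t := fun hs ht =>
    intervalIntegrable_of_Icc (integrableOn_drift hu hb hφ (a := fun t => -Z t) hZ.neg (H := H)
      (fun t => by rw [norm_neg]; exact hH t)) hs ht
  -- Freezing the translation in the drift: Lipschitz dependence gives order γ, and the time
  -- integral gains one more power.
  have T5 : |∫ r in s..t, (drift u b r (tau (-Z r) φ) - drift u b r ψ)|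
      ≤ C₅ * C₀ * T ^ (1 - 2 * γ) * δ ^ (3 * γ) := by
    have h := abs_intervalIntegral_le (f := fun r => drift u b r (tau (-Z r) φ) - drift u b r ψ)
      (C := C₅ * (C₀ * δ ^ γ)) hs ht (by
      filter_upwards [ae_goodTime hu hb, ae_restrict_mem measurableSet_Icc] with r hr hrT hrst
      rw [uIoc_of_le hst] at hrst
      refine (hC₅ u b r hr (-Z r) (-Z s) (by rw [norm_neg]; exact hH r)
        (by rw [norm_neg]; exact hH s)).trans (mul_le_mul_of_nonneg_left ?_ h₅)
      rw [neg_sub_neg, norm_sub_rev, hZX r hrT, hZX s hs]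
      refine (hC₀ s hs r hrT).trans (mul_le_mul_of_nonneg_left ?_ h₀)
      rw [abs_of_nonneg (by linarith [hrst.1])]
      exact Real.rpow_le_rpow (by linarith [hrst.1]) (by linarith [hrst.2]) hγ0.le)
    refine h.trans ?_
    have h6 := rpow_one_add_le hγ' hγ0.le hδ0 (show δ ≤ T by linarith [hs.1])
    rw [Real.rpow_add_of_nonneg hδ0 zero_le_one hγ0.le, Real.rpow_one] at h6
    rw [habs]
    calc _ = C₅ * C₀ * (δ * δ ^ γ) := by ring
      _ ≤ C₅ * C₀ * (T ^ (1 - 2 * γ) * δ ^ (3 * γ)) :=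
        mul_le_mul_of_nonneg_left h6 (mul_nonneg h₅ h₀)
      _ = _ := by ring
  rw [intervalIntegral.integral_sub (hint hs ht) (intervalIntegrable_drift hu hb hψ hs ht)] at T5
  rw [← intervalIntegral.integral_add_adjacent_intervals (hint h0 hs) (hint hs ht)]
  rw [abs_le] at *
  constructor <;> linarith [T1.1, T1.2, T2.1, T2.2, T3.1, T3.2, T4.1, T4.2, T5.1, T5.2]

/-- Following the noise, a weak controlled solution becomes a weak solution of a transport
equation without noise. -/
theorem IsSolutionVersion.isWeakTransport (hT : 0 < T) (hγ : 1 / 3 < γ) (hγ' : γ ≤ 1 / 2)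
    (hb : IsRegular T M D b) (hX : IsGeometricRoughPath T γ X XX) (hZ : Continuous Z)
    (hZX : ∀ t ∈ Icc 0 T, Z t = X t) {H : ℝ} (hH : ∀ t, ‖Z t‖ ≤ H) (hu : IsBdd T K u)
    (hU : IsSolutionVersion T γ b X XX u₀ u U) :
    IsWeakTransport T (shiftField Z b) (fun x => u₀ (x + Z 0)) (shift Z u) := by
  intro φ hφ
  have hγ0 : 0 < γ := by linarith
  have hV := hU.isVersion hγ0
  have hH' : ∀ t, ‖-Z t‖ ≤ H := fun t => by rw [norm_neg]; exact hH t
  have h0 : (0 : ℝ) ∈ Icc 0 T := ⟨le_rfl, hT.le⟩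
  have hprim : ContinuousOn (fun t => ∫ r in (0 : ℝ)..t, drift u b r (tau (-Z r) φ)) (Icc 0 T) := by
    have := intervalIntegral.continuousOn_primitive_interval (a := 0) (b := T)
      (f := fun r => drift u b r (tau (-Z r) φ)) (μ := volume)
      (by rw [uIcc_of_le hT.le]; exact integrableOn_drift hu hb hφ (a := fun t => -Z t) hZ.neg hH')
    rwa [uIcc_of_le hT.le] at this
  -- Since 3γ > 1, the local bound gives a vanishing right derivative at every time before T; with
  -- continuity the path is constant.
  have hconst := constant_of_has_deriv_right_zero
    ((hV.continuousOn_tau hT hu hφ (a := fun t => -Z t) hZ.neg hH').sub hprim) (fun s hs => by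
      obtain ⟨C, hC⟩ := hU.local_bound hT hγ hγ' hb hX hZ hZX hH hu hφ (Ico_subset_Icc_self hs)
      exact hasDerivWithinAt_zero_of_le (C := C) (θ := 3 * γ) (by linarith) hs.2 hC)
  have hinit : U (tau (-Z 0) φ) 0 = ∫ x, u₀ (x + Z 0) * φ x := by
    obtain ⟨I, hI, eI⟩ := (hU _ (hφ.tau (-Z 0))).2.2 0 h0
    -- Over [0,0] the partition with n = 0 has an empty Riemann sum, which rules out any other value
    -- of the integral.
    have hI0 : I = 0 := by
      by_contra hne
      obtain ⟨δ, -, h⟩ := hI |I| (abs_pos.2 hne)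
      have := h 0 (fun _ => 0) monotone_const rfl rfl (by simp)
      simp [roughRiemannSum] at this
    rw [eI, hI0, intervalIntegral.integral_same, add_zero, add_zero,
      ← integral_add_right_eq_self _ (Z 0)]
    simp only [tau, add_neg_cancel_right]
  -- The translation varies with t, so the version must agree with the integral for all translates
  -- at once.
  filter_upwards [hV.ae_eq_tau hT hu hφ, ae_restrict_mem measurableSet_Icc] with t h1 ht
  have h2 := hconst t ht
  simp_rw [drift_shift]
  rw [integral_shift, ← h1, ← hinit]
  simp only [Pi.sub_apply, intervalIntegral.integral_same, sub_zero] at h2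
  linarith

end

end RoughTransport
end

noncomputable section
namespace RoughTransport

/-! ### Adding the noise by a translation -/

variable {d : ℕ} {T γ K M D : ℝ}

/-- The continuous version of `t ↦ ∫ v_t φ` given by the weak formulation. -/
def weakVersion (c : ℝ → E d → E d) (v₀ : E d → ℝ) (v : ℝ × E d → ℝ) (φ : E d → ℝ) (t : ℝ) : ℝ :=
  (∫ x, v₀ x * φ x) + ∫ s in (0 : ℝ)..t, drift v c s φ

section

variable {c b : ℝ → E d → E d} {v₀ u₀ : E d → ℝ} {v : ℝ × E d → ℝ} {X Z : ℝ → E d}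
  {XX : ℝ → ℝ → Matrix (Fin d) (Fin d) ℝ}

theorem weakVersion_sub (hT : 0 < T) (hv : IsBdd T K v) (hc : IsRegular T M D c) {φ : E d → ℝ}
    (hφ : IsTest φ) {s t : ℝ} (hs : s ∈ Icc 0 T) (ht : t ∈ Icc 0 T) :
    weakVersion c v₀ v φ t - weakVersion c v₀ v φ s = ∫ r in s..t, drift v c r φ := by
  have h0 : (0 : ℝ) ∈ Icc 0 T := ⟨le_rfl, hT.le⟩
  rw [weakVersion, weakVersion, ← intervalIntegral.integral_add_adjacent_intervals
    (intervalIntegrable_drift hv hc hφ h0 hs) (intervalIntegrable_drift hv hc hφ hs ht)]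
  ring

theorem IsWeakTransport.isVersion (hT : 0 < T) (hv : IsBdd T K v) (hc : IsRegular T M D c)
    (h : IsWeakTransport T c v₀ v) : IsVersion T v (weakVersion c v₀ v) := by
  refine ⟨fun φ hφ => ?_, fun φ hφ => continuousOn_const.add ?_⟩
  · filter_upwards [h φ hφ] with t ht using ht.symm
  · have h1 := integrableOn_drift hv hc hφ (a := fun _ => 0) continuous_const (H := 0) (by simp)
    simp only [tau_zero] at h1
    have := intervalIntegral.continuousOn_primitive_interval (a := 0) (b := T)
      (f := fun r => drift v c r φ) (μ := volume) (by rwa [uIcc_of_le hT.le])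
    rwa [uIcc_of_le hT.le] at this

/-- The rate is the bound on the drift. It has to be uniform over bounded translations because the
translation will move with time. -/
theorem exists_weakVersion_lipschitz (hT : 0 < T) (hv : IsBdd T K v) (hc : IsRegular T M D c)
    {φ : E d → ℝ} (hφ : IsTest φ) (H : ℝ) :
    ∃ C, 0 ≤ C ∧ ∀ a, ‖a‖ ≤ H → ∀ s ∈ Icc 0 T, ∀ t ∈ Icc 0 T,
      |weakVersion c v₀ v (tau a φ) t - weakVersion c v₀ v (tau a φ) s| ≤ C * |t - s| := by
  obtain ⟨C, h0, hC⟩ := hφ.exists_drift_bound K M D H hv.nonneg hc.M_nonneg hc.D_nonneg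
  refine ⟨C, h0, fun a ha s hs t ht => ?_⟩
  rw [weakVersion_sub hT hv hc (hφ.tau a) hs ht]
  refine abs_intervalIntegral_le hs ht ?_
  filter_upwards [ae_goodTime hv hc] with r hr _ using hC v c r hr a ha

theorem rpow_le_of_le {α β δ : ℝ} (h0 : 0 ≤ δ) (hδ : δ ≤ T) (hβ : 0 ≤ β) (hαβ : β ≤ α) :
    δ ^ α ≤ T ^ (α - β) * δ ^ β := by
  have : α = (α - β) + β := by ring
  nth_rewrite 1 [this]
  rw [Real.rpow_add_of_nonneg h0 (by linarith) hβ]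
  exact mul_le_mul_of_nonneg_right (Real.rpow_le_rpow h0 hδ (by linarith)) (by positivity)

theorem abs_sub_le_of_mem {s t : ℝ} (hs : s ∈ Icc 0 T) (ht : t ∈ Icc 0 T) : |t - s| ≤ T := by
  rw [abs_le]; constructor <;> linarith [hs.1, hs.2, ht.1, ht.2]

theorem toLp_norm_le (f : Fin d → ℝ) : ‖(WithLp.toLp 2 f : E d)‖ ≤ ∑ k, |f k| := by
  have h : (WithLp.toLp 2 f : E d) = ∑ k, f k • EuclideanSpace.single k (1 : ℝ) := by
    ext j; simp [Finset.sum_apply, Pi.single_apply]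
  rw [h]
  refine norm_sum_le_of_le _ fun k _ => ?_
  rw [norm_smul]; simp

/-- The version of `t ↦ ∫ u_t φ` for `u_t(x) = v_t(x - Z_t)`. -/
def shiftVersion (Z : ℝ → E d) (V : (E d → ℝ) → ℝ → ℝ) (φ : E d → ℝ) (t : ℝ) : ℝ :=
  V (tau (Z t) φ) t

section

variable (hT : 0 < T) (hγ : 1 / 3 < γ) (hγ' : γ ≤ 1 / 2) (hv : IsBdd T K v)
  (hc : IsRegular T M D c) (hw : IsWeakTransport T c v₀ v) (hX : IsGeometricRoughPath T γ X XX)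
  (hZ : Continuous Z) (hZX : ∀ t ∈ Icc 0 T, Z t = X t) {H : ℝ} (hH : ∀ t, ‖Z t‖ ≤ H)

include hT hγ hγ' hv hc hw hX hZX hH

/-- The increment splits into a change of time at a fixed translation, which is Lipschitz, and a
change of translation at a fixed time, which is of the order of |X_t - X_s|. -/
theorem isHolder_shiftVersion {φ : E d → ℝ} (hφ : IsTest φ) :
    IsHolder T γ (shiftVersion Z (weakVersion c v₀ v) φ) := by
  have hV := hw.isVersion hT hv hc
  obtain ⟨C₀, h₀, hC₀⟩ := hX.1.path_holder.exists_nonneg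
  obtain ⟨C₁, h₁, hC₁⟩ := exists_weakVersion_lipschitz (v₀ := v₀) hT hv hc hφ H
  obtain ⟨C₂, h₂, hC₂⟩ := hV.taylor_one hT hv hφ (H + H)
  refine ⟨C₁ * T ^ (1 - γ) + C₂ * C₀, fun s hs t ht => ?_⟩
  have b1 := hC₁ (Z t) (hH t) s hs t ht
  have b2 := hC₂ (Z s) (Z t - Z s) (by linarith [hH s, norm_nonneg (Z s)])
    ((norm_sub_le _ _).trans (add_le_add (hH t) (hH s))) s hs
  rw [add_sub_cancel] at b2
  have b3 := rpow_le_of_le (α := 1) (β := γ) (abs_nonneg _) (abs_sub_le_of_mem hs ht)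
    (by linarith) (by linarith)
  rw [Real.rpow_one] at b3
  have b4 : ‖Z t - Z s‖ ≤ C₀ * |t - s| ^ γ := by rw [hZX t ht, hZX s hs]; exact hC₀ s hs t ht
  rw [Real.norm_eq_abs, shiftVersion, shiftVersion, add_mul]
  have b5 := mul_le_mul_of_nonneg_left b3 h₁
  have b6 := mul_le_mul_of_nonneg_left b4 h₂
  rw [← mul_assoc] at b5 b6
  exact (abs_sub_le _ _ _).trans (add_le_add (b1.trans b5) (b2.trans b6))

/-- With the same splitting, the first-order part of the change of translation is the Gubinelli
derivative applied to X_t - X_s. The second-order error is of order 2γ, and the Lipschitz part is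
absorbed because 2γ ≤ 1. -/
theorem isControlled_shiftVersion {φ : E d → ℝ} (hφ : IsTest φ) :
    IsControlled T γ X (shiftVersion Z (weakVersion c v₀ v) φ)
      (fun t => WithLp.toLp 2 fun k =>
        shiftVersion Z (weakVersion c v₀ v) (partialDeriv k φ) t) := by
  have hγ0 : 0 < γ := by linarith
  have hV := hw.isVersion hT hv hc
  have hol := fun {ψ : E d → ℝ} (hψ : IsTest ψ) =>
    isHolder_shiftVersion hT hγ hγ' hv hc hw hX hZX hH hψ
  have hvec : IsHolder T γ (fun t => (WithLp.toLp 2 fun k =>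
      shiftVersion Z (weakVersion c v₀ v) (partialDeriv k φ) t : E d)) := by
    choose C hC using fun k => hol (hφ.partialDeriv k)
    refine ⟨∑ k, C k, fun s hs t ht => ?_⟩
    rw [← WithLp.toLp_sub, Finset.sum_mul]
    exact (toLp_norm_le _).trans (Finset.sum_le_sum fun k _ => hC k s hs t ht)
  refine ⟨hol hφ, hvec, ?_, fun s _ => by simp, ?_⟩
  · have c1 : ContinuousOn (fun p : ℝ × ℝ => p.1) (Icc 0 T ×ˢ Icc 0 T) := continuousOn_fst
    have c2 : ContinuousOn (fun p : ℝ × ℝ => p.2) (Icc 0 T ×ˢ Icc 0 T) := continuousOn_snd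
    have m1 : MapsTo (fun p : ℝ × ℝ => p.1) (Icc 0 T ×ˢ Icc 0 T) (Icc 0 T) := fun p hp => hp.1
    have m2 : MapsTo (fun p : ℝ × ℝ => p.2) (Icc 0 T ×ˢ Icc 0 T) (Icc 0 T) := fun p hp => hp.2
    have k1 := (hol hφ).continuousOn hγ0
    have k2 := hX.1.path_holder.continuousOn hγ0
    exact ((k1.comp c2 m2).sub (k1.comp c1 m1)).sub
      (((hvec.continuousOn hγ0).comp c1 m1).inner ((k2.comp c2 m2).sub (k2.comp c1 m1)))
  · obtain ⟨C₀, h₀, hC₀⟩ := hX.1.path_holder.exists_nonneg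
    obtain ⟨C₁, h₁, hC₁⟩ := exists_weakVersion_lipschitz (v₀ := v₀) hT hv hc hφ H
    obtain ⟨C₂, h₂, hC₂⟩ := hV.taylor_two hT hv hφ (H + H)
    refine ⟨C₁ * T ^ (1 - 2 * γ) + C₂ * C₀ ^ 2, fun s hs t ht => ?_⟩
    have b1 := hC₁ (Z t) (hH t) s hs t ht
    have b2 := hC₂ (Z s) (Z t - Z s) (by linarith [hH s, norm_nonneg (Z s)])
      ((norm_sub_le _ _).trans (add_le_add (hH t) (hH s))) s hs
    rw [add_sub_cancel] at b2
    have b3 := rpow_le_of_le (α := 1) (β := 2 * γ) (abs_nonneg _) (abs_sub_le_of_mem hs ht)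
      (by linarith) (by linarith)
    rw [Real.rpow_one] at b3
    have b4 : ‖Z t - Z s‖ ^ 2 ≤ C₀ ^ 2 * |t - s| ^ (2 * γ) := by
      rw [hZX t ht, hZX s hs]
      refine (pow_le_pow_left₀ (norm_nonneg _) (hC₀ s hs t ht) 2).trans (le_of_eq ?_)
      rw [mul_pow, mul_comm 2 γ, Real.rpow_mul (abs_nonneg _)]; norm_cast
    have e : ⟪(WithLp.toLp 2 fun k =>
        shiftVersion Z (weakVersion c v₀ v) (partialDeriv k φ) s : E d), X t - X s⟫
        = ∑ k, (Z t - Z s) k * weakVersion c v₀ v (tau (Z s) (partialDeriv k φ)) s := by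
      rw [hZX t ht, hZX s hs]
      simp [PiLp.inner_apply, shiftVersion, hZX s hs]
    beta_reduce
    rw [Real.norm_eq_abs, e, add_mul]
    have b5 := mul_le_mul_of_nonneg_left b3 h₁
    have b6 := mul_le_mul_of_nonneg_left b4 h₂
    rw [← mul_assoc] at b5 b6
    simp only [shiftVersion]
    rw [abs_le] at *
    constructor <;> linarith [b1.1, b1.2, b2.1, b2.2]

include hZ

/-- The change of time cancels the drift up to the error of replacing Z_r by Z_t, of order 1 + γ.
The change of translation is Taylor expanded to third order, and its first two orders are the germ.
The constant is uniform in s and t, so that the bounds can be summed over a partition. -/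
theorem exists_shiftVersion_local_bound {φ : E d → ℝ} (hφ : IsTest φ) :
    ∃ C, 0 ≤ C ∧ ∀ s t, 0 ≤ s → s ≤ t → t ≤ T →
      |(shiftVersion Z (weakVersion c v₀ v) φ t - ∫ r in (0 : ℝ)..t, drift v c r (tau (Z r) φ))
        - (shiftVersion Z (weakVersion c v₀ v) φ s - ∫ r in (0 : ℝ)..s, drift v c r (tau (Z r) φ))
        - germ X XX (fun k => shiftVersion Z (weakVersion c v₀ v) (partialDeriv k φ))
          (fun k s => WithLp.toLp 2 fun j =>
            shiftVersion Z (weakVersion c v₀ v) (partialDeriv j (partialDeriv k φ)) s) s t|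
        ≤ C * (t - s) ^ (3 * γ) := by
  have hγ0 : 0 < γ := by linarith
  have hV := hw.isVersion hT hv hc
  obtain ⟨C₀, h₀, hC₀⟩ := hX.1.path_holder.exists_nonneg
  obtain ⟨C₁, h₁, hC₁⟩ := hV.taylor_three hT hv hφ (H + H)
  obtain ⟨C₅, h₅, hC₅⟩ := hφ.exists_drift_lipschitz K M D H hv.nonneg hc.M_nonneg hc.D_nonneg
  refine ⟨C₁ * C₀ ^ 3 + C₅ * C₀ * T ^ (1 - 2 * γ), by positivity, fun s t hs0 hst htT => ?_⟩
  have hs : s ∈ Icc 0 T := ⟨hs0, hst.trans htT⟩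
  have ht : t ∈ Icc 0 T := ⟨hs0.trans hst, htT⟩
  have h0 : (0 : ℝ) ∈ Icc 0 T := ⟨le_rfl, hT.le⟩
  set δ := t - s with hδ
  have hδ0 : 0 ≤ δ := sub_nonneg.2 hst
  have habs : |t - s| = δ := abs_of_nonneg hδ0
  have hZb : ‖Z t - Z s‖ ≤ C₀ * δ ^ γ := by
    rw [hZX t ht, hZX s hs]; exact habs ▸ hC₀ s hs t ht
  have T1 := hC₁ (Z s) (Z t - Z s) (by linarith [hH s, norm_nonneg (Z s)])
      ((norm_sub_le _ _).trans (add_le_add (hH t) (hH s))) s hs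
  rw [add_sub_cancel] at T1
  replace T1 := T1.trans (mul_le_mul_of_nonneg_left (pow_three_le (norm_nonneg _) hδ0 hZb) h₁)
  have hint : ∀ {s t}, s ∈ Icc 0 T → t ∈ Icc 0 T →
      IntervalIntegrable (fun r => drift v c r (tau (Z r) φ)) volume s t := fun hs ht =>
    intervalIntegrable_of_Icc (integrableOn_drift hv hc hφ hZ hH) hs ht
  have T5 : |∫ r in s..t, (drift v c r (tau (Z t) φ) - drift v c r (tau (Z r) φ))|
      ≤ C₅ * C₀ * T ^ (1 - 2 * γ) * δ ^ (3 * γ) := by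
    have h := abs_intervalIntegral_le
      (f := fun r => drift v c r (tau (Z t) φ) - drift v c r (tau (Z r) φ))
      (C := C₅ * (C₀ * δ ^ γ)) hs ht (by
      filter_upwards [ae_goodTime hv hc, ae_restrict_mem measurableSet_Icc] with r hr hrT hrst
      rw [uIoc_of_le hst] at hrst
      refine (hC₅ v c r hr (Z t) (Z r) (hH t) (hH r)).trans (mul_le_mul_of_nonneg_left ?_ h₅)
      rw [hZX r hrT, hZX t ht]
      refine (hC₀ r hrT t ht).trans (mul_le_mul_of_nonneg_left ?_ h₀)
      rw [abs_of_nonneg (by linarith [hrst.2])]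
      exact Real.rpow_le_rpow (by linarith [hrst.2]) (by linarith [hrst.1]) hγ0.le)
    refine h.trans ?_
    have h6 := rpow_one_add_le hγ' hγ0.le hδ0 (show δ ≤ T by linarith [hs.1])
    rw [Real.rpow_add_of_nonneg hδ0 zero_le_one hγ0.le, Real.rpow_one] at h6
    rw [habs]
    calc _ = C₅ * C₀ * (δ * δ ^ γ) := by ring
      _ ≤ C₅ * C₀ * (T ^ (1 - 2 * γ) * δ ^ (3 * γ)) :=
        mul_le_mul_of_nonneg_left h6 (mul_nonneg h₅ h₀)
      _ = _ := by ring
  rw [intervalIntegral.integral_sub (intervalIntegrable_drift hv hc (hφ.tau _) hs ht)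
    (hint hs ht), ← weakVersion_sub (v₀ := v₀) hT hv hc (hφ.tau _) hs ht] at T5
  rw [germ_eq hT hX hφ _ hs0 hst htT,
    ← intervalIntegral.integral_add_adjacent_intervals (hint h0 hs) (hint hs ht),
    ← hZX t ht, ← hZX s hs]
  simp only [shiftVersion]
  rw [abs_le] at *
  constructor <;> linarith [T1.1, T1.2, T5.1, T5.2]

/-- Weak solutions of the transport equation without noise give weak controlled solutions. -/
theorem isSolutionVersion_shiftVersion (hcb : c = shiftField Z b)
    (hv₀ : v₀ = fun x => u₀ (x + Z 0)) :
    IsSolutionVersion T γ b X XX u₀ (shift (fun t => -Z t) v)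
      (shiftVersion Z (weakVersion c v₀ v)) := by
  intro φ hφ
  have hV := hw.isVersion hT hv hc
  have hdrift : ∀ r, drift (shift (fun t => -Z t) v) b r φ = drift v c r (tau (Z r) φ) := by
    intro r
    -- The original field is recovered from c by the opposite shift, so the change of variables
    -- applies with -Z.
    have hb : b = shiftField (fun t => -Z t) c := by
      funext t x; simp [hcb, shiftField]
    rw [hb, drift_shift, neg_neg]
  refine ⟨?_, isControlled_shiftVersion hT hγ hγ' hv hc hw hX hZX hH hφ, fun t ht => ?_⟩
  · filter_upwards [hV.ae_eq_tau hT hv hφ] with t ht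
    rw [integral_shift, neg_neg, shiftVersion, ht]
  obtain ⟨C, hC0, hC⟩ := exists_shiftVersion_local_bound hT hγ hγ' hv hc hw hX hZ hZX hH hφ
  simp_rw [hdrift]
  have hinit : shiftVersion Z (weakVersion c v₀ v) φ 0 = ∫ x, u₀ x * φ x := by
    rw [shiftVersion, weakVersion, intervalIntegral.integral_same, add_zero, hv₀]
    exact integral_add_right_eq_self (fun x => u₀ x * φ x) (Z 0)
  set F : ℝ → ℝ := fun t =>
    shiftVersion Z (weakVersion c v₀ v) φ t - ∫ r in (0 : ℝ)..t, drift v c r (tau (Z r) φ) with hF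
  have hF0 : F 0 = ∫ x, u₀ x * φ x := by simp only [hF, hinit]; simp
  -- The rough integral is identified as the increment of F: increments telescope along a partition
  -- and each differs from the germ by at most C(p_{i+1} - p_i)^{3γ}.
  refine ⟨F t - F 0, fun ε hε => ?_, by rw [hF0]; simp only [hF]; ring⟩
  have hθ : 0 < 3 * γ - 1 := by linarith
  -- The mesh is chosen so that its power 3γ - 1 equals ε / (CT + 1); the remaining factors of
  -- length sum to t ≤ T.
  refine ⟨(ε / (C * T + 1)) ^ (3 * γ - 1)⁻¹, by positivity, fun n p hp hp0 hpn hmesh => ?_⟩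
  have hpm : ∀ i ≤ n, p i ∈ Icc 0 t := fun i hi => ⟨hp0 ▸ hp (Nat.zero_le i), hpn ▸ hp hi⟩
  have e1 : roughRiemannSum X XX (fun k => shiftVersion Z (weakVersion c v₀ v) (partialDeriv k φ))
      (fun k s => WithLp.toLp 2 fun j =>
        shiftVersion Z (weakVersion c v₀ v) (partialDeriv j (partialDeriv k φ)) s) n p
      - (F t - F 0) = -∑ i ∈ Finset.range n, (F (p (i + 1)) - F (p i)
        - germ X XX (fun k => shiftVersion Z (weakVersion c v₀ v) (partialDeriv k φ))
          (fun k s => WithLp.toLp 2 fun j =>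
            shiftVersion Z (weakVersion c v₀ v) (partialDeriv j (partialDeriv k φ)) s)
          (p i) (p (i + 1))) := by
    rw [Finset.sum_sub_distrib, Finset.sum_range_sub (fun i => F (p i)), hp0, hpn, neg_sub]
    rfl
  have hsum : ∑ i ∈ Finset.range n, (p (i + 1) - p i) = t := by
    rw [Finset.sum_range_sub, hp0, hpn, sub_zero]
  have hCT : 0 < C * T + 1 := by positivity
  rw [e1, abs_neg]
  calc _ ≤ ∑ i ∈ Finset.range n, C * (p (i + 1) - p i) * (ε / (C * T + 1)) := by
        refine (Finset.abs_sum_le_sum_abs _ _).trans (Finset.sum_le_sum fun i hi => ?_)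
        rw [Finset.mem_range] at hi
        have hd : 0 ≤ p (i + 1) - p i := sub_nonneg.2 (hp (Nat.le_succ i))
        refine (hC _ _ (hpm i hi.le).1 (hp (Nat.le_succ i))
          ((hpm (i + 1) hi).2.trans ht.2)).trans ?_
        have e3 : 3 * γ = 1 + (3 * γ - 1) := by ring
        rw [mul_assoc, e3, Real.rpow_add_of_nonneg hd zero_le_one hθ.le, Real.rpow_one]
        refine mul_le_mul_of_nonneg_left (mul_le_mul_of_nonneg_left ?_ hd) hC0
        have := Real.rpow_le_rpow hd (hmesh i hi).le hθ.le
        rwa [Real.rpow_inv_rpow (by positivity) hθ.ne'] at this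
    _ = C * t * (ε / (C * T + 1)) := by
        rw [← Finset.sum_mul, ← Finset.mul_sum, hsum]
    _ < ε := by
        rw [← mul_div_assoc, div_lt_iff₀ hCT]
        have : C * t ≤ C * T := mul_le_mul_of_nonneg_left ht.2 hC0
        nlinarith

end

end

end RoughTransport
end

noncomputable section
namespace RoughTransport

/-! ### A duality lemma -/

theorem integral_norm_le_Lp_two {α : Type*} [MeasurableSpace α] {ν : Measure α} [IsFiniteMeasure ν]
    (g : Lp ℝ 2 ν) : ∫ x, |g x| ∂ν ≤ (ν univ ^ (1 / 2 : ℝ)).toReal * ‖g‖ := by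
  have h1 : ∫ x, |g x| ∂ν = (eLpNorm g 1 ν).toReal := by
    rw [eLpNorm_one_eq_lintegral_enorm, ← integral_norm_eq_lintegral_enorm
      (Lp.aestronglyMeasurable g)]
    rfl
  have h2 := eLpNorm_le_eLpNorm_mul_rpow_measure_univ (μ := ν) (p := 1) (q := 2) (by norm_num)
    (Lp.aestronglyMeasurable g)
  have h3 : (1 / (1 : ℝ≥0∞).toReal - 1 / (2 : ℝ≥0∞).toReal) = (1 / 2 : ℝ) := by norm_num
  rw [h3] at h2
  rw [h1, Lp.norm_def, mul_comm, ← ENNReal.toReal_mul]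
  exact ENNReal.toReal_mono (ENNReal.mul_ne_top (Lp.eLpNorm_ne_top g)
    (ENNReal.rpow_ne_top_of_nonneg (by norm_num) (measure_ne_top ν univ))) h2

/-- A form of the duality between L¹ and L^∞. Hahn–Banach extends the functional from the range of A
to all of L², dominated by K times the L¹ norm; since the measure is finite this is L²-continuous,
and the Riesz theorem yields v. The L¹ domination, tested on indicators, gives |v| ≤ K. -/
theorem exists_bounded_representation {α : Type*} [MeasurableSpace α] {ν : Measure α}
    [IsFiniteMeasure ν] {S : Type*} [AddCommGroup S] [Module ℝ S] (A : S →ₗ[ℝ] Lp ℝ 2 ν)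
    (l : S →ₗ[ℝ] ℝ) {K : ℝ} (hK : 0 ≤ K) (h : ∀ s, l s ≤ K * ∫ x, |A s x| ∂ν) :
    ∃ v : α → ℝ, AEStronglyMeasurable v ν ∧ (∀ᵐ x ∂ν, |v x| ≤ K) ∧
      ∀ s, ∫ x, v x * A s x ∂ν = l s := by
  have hint : ∀ g : Lp ℝ 2 ν, Integrable g ν := fun g => (Lp.memLp g).integrable (by norm_num)
  -- A linear section R of A onto its range makes l ∘ R a functional on the range, without assuming
  -- A injective.
  obtain ⟨R, hR⟩ := A.rangeRestrict.exists_rightInverse_of_surjective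
    (LinearMap.range_rangeRestrict A)
  have hR' : ∀ y : LinearMap.range A, A (R y) = y := fun y => by
    have := congrArg Subtype.val (LinearMap.congr_fun hR y)
    simpa using this
  obtain ⟨F, hF, hFle⟩ := exists_extension_of_le_sublinear
    (⟨LinearMap.range A, l.comp R⟩ : Lp ℝ 2 ν →ₗ.[ℝ] ℝ) (fun g => K * ∫ x, |g x| ∂ν)
    (fun c hc g => by
      have : ∫ x, |(c • g : Lp ℝ 2 ν) x| ∂ν = c * ∫ x, |g x| ∂ν := by
        rw [← integral_const_mul]
        refine integral_congr_ae ?_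
        filter_upwards [Lp.coeFn_smul c g] with x hx
        rw [hx, Pi.smul_apply, smul_eq_mul, abs_mul, abs_of_pos hc]
      rw [this]; ring)
    (fun g g' => by
      rw [← mul_add, ← integral_add (hint g).abs (hint g').abs]
      refine mul_le_mul_of_nonneg_left (integral_mono_ae (hint _).abs
        ((hint g).abs.add (hint g').abs) ?_) hK
      filter_upwards [Lp.coeFn_add g g'] with x hx
      rw [hx]; exact abs_add_le _ _)
    (fun y => by
      have := h (R y)
      rwa [hR'] at this)
  have hFA : ∀ s, F (A s) = l s := fun s => by
    have h1 := hF ⟨A s, LinearMap.mem_range_self A s⟩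
    -- The domination applied to s and -s kills l on the kernel of A, so the choice of section is
    -- immaterial.
    have h2 : ∀ s, A s = 0 → l s = 0 := fun s hs => by
      have b1 := h s
      have b2 := h (-s)
      have e : ∫ x, |(0 : Lp ℝ 2 ν) x| ∂ν = 0 := by
        rw [integral_congr_ae (g := fun _ => 0)
          ((Lp.coeFn_zero ℝ 2 ν).mono fun x hx => by rw [hx]; simp)]
        simp
      rw [hs, e] at b1
      rw [map_neg, map_neg, hs, neg_zero, e] at b2
      linarith
    have h3 := h2 (R ⟨A s, LinearMap.mem_range_self A s⟩ - s) (by rw [map_sub, hR', sub_self])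
    rw [map_sub] at h3
    change F (A s) = l (R _) at h1
    linarith
  have e2 : ∀ g : Lp ℝ 2 ν, |F g| ≤ K * ∫ x, |g x| ∂ν := fun g => by
    have b1 := hFle g
    have b2 := hFle (-g)
    have e : ∫ x, |(-g : Lp ℝ 2 ν) x| ∂ν = ∫ x, |g x| ∂ν :=
      integral_congr_ae ((Lp.coeFn_neg g).mono fun x hx => by beta_reduce; rw [hx]; simp)
    rw [map_neg, e] at b2
    exact abs_le.2 ⟨by linarith, b1⟩
  have hbd : ∀ g, ‖F g‖ ≤ (K * (ν univ ^ (1 / 2 : ℝ)).toReal) * ‖g‖ := fun g => by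
    have h1 := mul_le_mul_of_nonneg_left (integral_norm_le_Lp_two g) hK
    rw [← mul_assoc] at h1
    exact (e2 g).trans h1
  set v : Lp ℝ 2 ν := (InnerProductSpace.toDual ℝ (Lp ℝ 2 ν)).symm (F.mkContinuous _ hbd) with hv
  have hvF : ∀ g : Lp ℝ 2 ν, ⟪v, g⟫ = F g := fun g => by
    rw [hv, InnerProductSpace.toDual_symm_apply]; rfl
  -- Set integrals of v are values of F on indicators, whose L¹ norms are the measures of the sets.
  have hvset : ∀ s, MeasurableSet s → |∫ x in s, v x ∂ν| ≤ ∫ _x in s, K ∂ν := fun s hs => by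
    have e1 : ∫ x in s, v x ∂ν = F (indicatorConstLp 2 hs (measure_ne_top ν s) 1) := by
      rw [← hvF, real_inner_comm]
      exact (L2.inner_indicatorConstLp_one hs (measure_ne_top ν s) v).symm
    rw [e1]
    refine (e2 _).trans (le_of_eq ?_)
    have e3 : ∫ x, |(indicatorConstLp 2 hs (measure_ne_top ν s) (1 : ℝ) : Lp ℝ 2 ν) x| ∂ν
        = ∫ x, s.indicator (fun _ => (1 : ℝ)) x ∂ν := by
      refine integral_congr_ae ?_
      filter_upwards [indicatorConstLp_coeFn (p := 2) (hs := hs) (hμs := measure_ne_top ν s)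
        (c := (1 : ℝ))] with x hx
      rw [hx]
      by_cases hxs : x ∈ s <;> simp [hxs]
    rw [e3, integral_indicator hs, setIntegral_const, setIntegral_const]
    simp [mul_comm]
  refine ⟨v, Lp.aestronglyMeasurable v, ?_, fun s => ?_⟩
  · have b1 := ae_le_of_forall_setIntegral_le (hint v) (integrable_const K)
      fun s hs _ => (le_abs_self _).trans (hvset s hs)
    have b2 := ae_le_of_forall_setIntegral_le (hint v).neg (integrable_const K)
      fun s hs _ => by
        simp only [Pi.neg_apply, integral_neg]
        exact (neg_le_abs _).trans (hvset s hs)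
    filter_upwards [b1, b2] with x h1 h2
    exact abs_le.2 ⟨by simp only [Pi.neg_apply] at h2; linarith, h1⟩
  · rw [← hFA, ← hvF, L2.inner_def]
    congr 1; funext x
    simp [mul_comm]

/-! ### An integrable weight -/

variable {d : ℕ} {T K M D : ℝ}

/-- The weight `(1 + |x|²)^{-(d+1)}`. -/
def weight (x : E d) : ℝ := ((1 + ‖x‖ ^ 2) ^ (d + 1))⁻¹

theorem weight_pos (x : E d) : 0 < weight x := by unfold weight; positivity

theorem contDiff_weight {n : WithTop ℕ∞} : ContDiff ℝ n (weight (d := d)) := by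
  unfold weight
  exact ((contDiff_const.add (contDiff_norm_sq ℝ)).pow _).inv fun x => by positivity

theorem integrable_weight : Integrable (weight (d := d)) := by
  have h := integrable_rpow_neg_one_add_norm_sq (E := E d) (μ := volume)
    (r := 2 * ((d + 1 : ℕ) : ℝ)) (by
      rw [finrank_euclideanSpace_fin]; push_cast; nlinarith [(Nat.cast_nonneg d : (0 : ℝ) ≤ d)])
  refine h.congr (Eventually.of_forall fun x => ?_)
  have : -(2 * ((d + 1 : ℕ) : ℝ)) / 2 = -((d + 1 : ℕ) : ℝ) := by ring
  simp only [weight]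
  rw [this, Real.rpow_neg (by positivity), Real.rpow_natCast]

/-! ### Integrability on `[0,T] × ℝ^d` -/

theorem integrable_cyl {f : ℝ × E d → ℝ} {B R : ℝ} (hf : AEStronglyMeasurable f (spaceTime d T))
    (hB : ∀ᵐ z ∂(spaceTime d T), |f z| ≤ B) (hR : ∀ z : ℝ × E d, R < ‖z.2‖ → f z = 0) :
    Integrable f (spaceTime d T) := by
  have h : Integrable (fun z : ℝ × E d => (Metric.closedBall (0 : E d) R).indicator
      (fun _ => B) z.2) (spaceTime d T) :=
    (integrable_indicator_ball B R).comp_snd (volume.restrict (Icc (0 : ℝ) T))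
  refine h.mono' hf ?_
  filter_upwards [hB] with z hz
  by_cases hzR : z.2 ∈ Metric.closedBall (0 : E d) R
  · rwa [indicator_of_mem hzR]
  · rw [indicator_of_notMem hzR, hR z (by simpa using hzR), norm_zero]

theorem ae_spaceTime_of_ae_time {p : ℝ → Prop} (h : ∀ᵐ t ∂(volume.restrict (Icc 0 T)), p t) :
    ∀ᵐ z ∂(spaceTime d T), p z.1 :=
  Measure.quasiMeasurePreserving_fst.ae h

theorem ae_mem_spaceTime : ∀ᵐ z ∂(spaceTime d T), z.1 ∈ Icc 0 T :=
  ae_spaceTime_of_ae_time (ae_restrict_mem measurableSet_Icc)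

end RoughTransport
end

noncomputable section
namespace RoughTransport

/-! ### The a priori estimate for the adjoint equation -/

variable {d : ℕ} {T K M D : ℝ}

/-- The `C¹` functions on `ℝ × ℝ^d` with bounded support in space that vanish at time `T`. -/
def spaceTimeTest (d : ℕ) (T : ℝ) : Submodule ℝ (ℝ × E d → ℝ) where
  carrier := {Φ | ContDiff ℝ 1 Φ ∧ (∃ R, ∀ z : ℝ × E d, R < ‖z.2‖ → Φ z = 0) ∧
    ∀ x, Φ (T, x) = 0}
  add_mem' := by
    rintro Φ Ψ ⟨h1, ⟨R, hR⟩, h2⟩ ⟨h3, ⟨R', hR'⟩, h4⟩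
    refine ⟨h1.add h3, ⟨max R R', fun z hz => ?_⟩, fun x => by simp [h2, h4]⟩
    simp [hR z ((le_max_left _ _).trans_lt hz), hR' z ((le_max_right _ _).trans_lt hz)]
  zero_mem' := ⟨contDiff_const, ⟨0, fun _ _ => rfl⟩, fun _ => rfl⟩
  smul_mem' := by
    rintro a Φ ⟨h1, ⟨R, hR⟩, h2⟩
    exact ⟨contDiff_const.smul h1, ⟨R, fun z hz => by simp [hR z hz]⟩, fun x => by simp [h2]⟩

/-- The slice of `Φ` at time `t`. -/
def slice (Φ : ℝ × E d → ℝ) (t : ℝ) : E d → ℝ := fun x => Φ (t, x)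

/-- The operator `∂_t Φ + c · ∇Φ + (div c) Φ`. -/
def dualOp (c : ℝ → E d → E d) (Φ : ℝ × E d → ℝ) (z : ℝ × E d) : ℝ :=
  fderiv ℝ Φ z (1, 0) + adv (c z.1) (slice Φ z.1) z.2

theorem hasFDerivAt_slice {Φ : ℝ × E d → ℝ} (hΦ : ContDiff ℝ 1 Φ) (t : ℝ) (x : E d) :
    HasFDerivAt (slice Φ t) ((fderiv ℝ Φ (t, x)).comp (ContinuousLinearMap.inr ℝ ℝ (E d))) x :=
  (hΦ.differentiable one_ne_zero (t, x)).hasFDerivAt.comp x (hasFDerivAt_prodMk_right t x)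

theorem fderiv_slice_apply {Φ : ℝ × E d → ℝ} (hΦ : ContDiff ℝ 1 Φ) (t : ℝ) (x y : E d) :
    fderiv ℝ (slice Φ t) x y = fderiv ℝ Φ (t, x) (0, y) := by
  rw [(hasFDerivAt_slice hΦ t x).fderiv]; simp

theorem hasDerivAt_time {Φ : ℝ × E d → ℝ} (hΦ : ContDiff ℝ 1 Φ) (t : ℝ) (x : E d) :
    HasDerivAt (fun s => Φ (s, x)) (fderiv ℝ Φ (t, x) (1, 0)) t := by
  have h : HasDerivAt (fun s : ℝ => (s, x)) ((1 : ℝ), (0 : E d)) t :=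
    (hasDerivAt_id t).prodMk (hasDerivAt_const t x)
  exact (hΦ.differentiable one_ne_zero (t, x)).hasFDerivAt.comp_hasDerivAt t h

theorem contDiff_slice {Φ : ℝ × E d → ℝ} (hΦ : ContDiff ℝ 1 Φ) (t : ℝ) :
    ContDiff ℝ 1 (slice Φ t) := hΦ.comp (contDiff_const.prodMk contDiff_id)

theorem fderiv_zero_of_cyl {Φ : ℝ × E d → ℝ} {R : ℝ}
    (hR : ∀ z : ℝ × E d, R < ‖z.2‖ → Φ z = 0) {z : ℝ × E d} (hz : R < ‖z.2‖) :
    fderiv ℝ Φ z = 0 := by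
  have : Φ =ᶠ[𝓝 z] fun _ => 0 :=
    ((continuous_norm.comp continuous_snd).isOpen_preimage _ isOpen_Ioi).eventually_mem hz |>.mono
      fun y hy => hR y hy
  rw [this.fderiv_eq]; simp

theorem exists_cyl_bound {Φ : ℝ × E d → ℝ} (hΦ : ContDiff ℝ 1 Φ) {R : ℝ}
    (hR : ∀ z : ℝ × E d, R < ‖z.2‖ → Φ z = 0) (T : ℝ) :
    ∃ B, 0 ≤ B ∧ ∀ z : ℝ × E d, z.1 ∈ Icc 0 T → |Φ z| ≤ B ∧ ‖fderiv ℝ Φ z‖ ≤ B := by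
  have hK : IsCompact (Icc (0 : ℝ) T ×ˢ Metric.closedBall (0 : E d) R) :=
    isCompact_Icc.prod (isCompact_closedBall _ _)
  obtain ⟨B₁, h1⟩ := hK.exists_bound_of_continuousOn hΦ.continuous.continuousOn
  obtain ⟨B₂, h2⟩ := hK.exists_bound_of_continuousOn
    (hΦ.continuous_fderiv one_ne_zero).continuousOn
  refine ⟨max 0 (max B₁ B₂), le_max_left _ _, fun z hz => ?_⟩
  by_cases hzR : ‖z.2‖ ≤ R
  · have hm : z ∈ Icc (0 : ℝ) T ×ˢ Metric.closedBall (0 : E d) R := ⟨hz, by simpa using hzR⟩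
    exact ⟨(h1 z hm).trans ((le_max_left _ _).trans (le_max_right _ _)),
      (h2 z hm).trans ((le_max_right _ _).trans (le_max_right _ _))⟩
  · rw [hR z (not_le.1 hzR), fderiv_zero_of_cyl hR (not_le.1 hzR)]
    simp

theorem aestronglyMeasurable_fderiv_field {c : ℝ → E d → E d} (hc : IsRegular T M D c)
    {Φ : ℝ × E d → ℝ} (hΦ : ContDiff ℝ 1 Φ) :
    AEStronglyMeasurable (fun z : ℝ × E d => fderiv ℝ (slice Φ z.1) z.2 (c z.1 z.2))
      (spaceTime d T) := by
  simp_rw [fderiv_slice_apply hΦ]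
  have h1 : AEStronglyMeasurable (fun z : ℝ × E d => fderiv ℝ Φ (z.1, z.2)) (spaceTime d T) :=
    (hΦ.continuous_fderiv one_ne_zero).aestronglyMeasurable
  have h2 : AEStronglyMeasurable (fun z : ℝ × E d => ((0 : ℝ), c z.1 z.2)) (spaceTime d T) :=
    aestronglyMeasurable_const.prodMk hc.meas
  exact (isBoundedBilinearMap_apply (𝕜 := ℝ) (E := ℝ × E d) (F := ℝ)).continuous
    |>.comp_aestronglyMeasurable (h1.prodMk h2)

theorem aestronglyMeasurable_dualOp {c : ℝ → E d → E d} (hc : IsRegular T M D c)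
    {Φ : ℝ × E d → ℝ} (hΦ : ContDiff ℝ 1 Φ) :
    AEStronglyMeasurable (dualOp c Φ) (spaceTime d T) := by
  refine AEStronglyMeasurable.add ?_ ((aestronglyMeasurable_fderiv_field hc hΦ).add
    (hc.div_meas.mul hΦ.continuous.aestronglyMeasurable))
  exact ((hΦ.continuous_fderiv one_ne_zero).clm_apply continuous_const).aestronglyMeasurable

theorem dualOp_zero_of_cyl {c : ℝ → E d → E d} {Φ : ℝ × E d → ℝ} {R : ℝ}
    (hR : ∀ z : ℝ × E d, R < ‖z.2‖ → Φ z = 0) {z : ℝ × E d} (hz : R < ‖z.2‖) :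
    dualOp c Φ z = 0 := by
  rw [dualOp, fderiv_zero_of_cyl hR hz,
    adv_eq_zero_of_radius (φ := slice Φ z.1) (R := R) (fun x hx => hR (z.1, x) hx) hz]
  simp

theorem exists_dualOp_bound {c : ℝ → E d → E d} (hc : IsRegular T M D c)
    {Φ : ℝ × E d → ℝ} (hΦ : ContDiff ℝ 1 Φ) {R : ℝ}
    (hR : ∀ z : ℝ × E d, R < ‖z.2‖ → Φ z = 0) :
    ∃ B, ∀ᵐ z ∂(spaceTime d T), |dualOp c Φ z| ≤ B := by
  obtain ⟨B, hB0, hB⟩ := exists_cyl_bound hΦ hR T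
  refine ⟨B + (B * M + D * B), ?_⟩
  filter_upwards [ae_mem_spaceTime, ae_spaceTime_of_ae_time hc.bound,
    ae_spaceTime_of_ae_time hc.div_bound] with z h1 h2 h3
  refine (abs_add_le _ _).trans (add_le_add ?_ ((abs_add_le _ _).trans (add_le_add ?_ ?_)))
  · refine ((fderiv ℝ Φ z).le_opNorm _).trans ?_
    simpa [Prod.norm_def] using (hB z h1).2
  · rw [fderiv_slice_apply hΦ]
    refine ((fderiv ℝ Φ z).le_opNorm _).trans (mul_le_mul (hB z h1).2 ?_ (norm_nonneg _) hB0)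
    simpa [Prod.norm_def] using h2 z.2
  · rw [abs_mul]
    exact mul_le_mul (h3 _) (hB z h1).1 (abs_nonneg _) hc.D_nonneg

theorem integrable_dualOp {c : ℝ → E d → E d} (hc : IsRegular T M D c)
    {Φ : ℝ × E d → ℝ} (hΦ : ContDiff ℝ 1 Φ) {R : ℝ}
    (hR : ∀ z : ℝ × E d, R < ‖z.2‖ → Φ z = 0) : Integrable (dualOp c Φ) (spaceTime d T) := by
  obtain ⟨B, hB⟩ := exists_dualOp_bound hc hΦ hR
  exact integrable_cyl (aestronglyMeasurable_dualOp hc hΦ) hB fun z hz => dualOp_zero_of_cyl hR hz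

/-- For `Φ` vanishing at time `T`, `∫ Φ_0 = -∫∫ (∂_t Φ + div(c Φ))`. -/
theorem integral_dualOp (hT : 0 < T) {c : ℝ → E d → E d} (hc : IsRegular T M D c)
    {Φ : ℝ × E d → ℝ} (hΦ : Φ ∈ spaceTimeTest d T) :
    ∫ z, dualOp c Φ z ∂(spaceTime d T) = -∫ x, Φ (0, x) := by
  obtain ⟨h1, ⟨R, hR⟩, h2⟩ := hΦ
  have hcont : Continuous fun z : ℝ × E d => fderiv ℝ Φ z (1, 0) :=
    (h1.continuous_fderiv one_ne_zero).clm_apply continuous_const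
  obtain ⟨B, hB0, hB⟩ := exists_cyl_bound h1 hR T
  have i1 : Integrable (fun z : ℝ × E d => fderiv ℝ Φ z (1, 0)) (spaceTime d T) := by
    refine integrable_cyl (B := B) (R := R) hcont.aestronglyMeasurable ?_ fun z hz => by
      rw [fderiv_zero_of_cyl hR hz]; simp
    filter_upwards [ae_mem_spaceTime] with z hz
    refine ((fderiv ℝ Φ z).le_opNorm _).trans ?_
    simpa [Prod.norm_def] using (hB z hz).2
  have i2 : Integrable (fun z : ℝ × E d => adv (c z.1) (slice Φ z.1) z.2) (spaceTime d T) :=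
    ((integrable_dualOp hc h1 hR).sub i1).congr (Eventually.of_forall fun z => by
      simp [dualOp])
  have e : ∫ z, dualOp c Φ z ∂(spaceTime d T) = (∫ z, fderiv ℝ Φ z (1, 0) ∂(spaceTime d T))
      + ∫ z, adv (c z.1) (slice Φ z.1) z.2 ∂(spaceTime d T) := integral_add i1 i2
  -- At almost every time the spatial part is the integral of a divergence; only the time derivative
  -- contributes, and Φ vanishes at T.
  have e2 : ∫ z, adv (c z.1) (slice Φ z.1) z.2 ∂(spaceTime d T) = 0 := by
    rw [spaceTime, integral_prod _ i2]
    refine integral_eq_zero_of_ae ?_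
    filter_upwards [hc.contDiff] with t ht
    refine integral_adv_eq_zero ht (contDiff_slice h1 t) ?_
    exact HasCompactSupport.intro (isCompact_closedBall (0 : E d) R) fun x hx =>
      hR (t, x) (by simpa using hx)
  have e3 : ∫ z, fderiv ℝ Φ z (1, 0) ∂(spaceTime d T) = -∫ x, Φ (0, x) := by
    rw [spaceTime, integral_prod_symm _ i1, ← integral_neg]
    congr 1; funext x
    rw [integral_Icc_eq_integral_Ioc, ← intervalIntegral.integral_of_le hT.le,
      intervalIntegral.integral_eq_sub_of_hasDerivAt (f := fun s => Φ (s, x))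
        (fun t _ => hasDerivAt_time h1 t x)
        ((hcont.comp (continuous_id.prodMk continuous_const)).intervalIntegrable _ _), h2, zero_sub]
  rw [e, e2, e3, add_zero]

/-! ### Renormalization by a smooth absolute value. -/

/-- A smooth approximation of the absolute value. -/
def smoothAbs (δ r : ℝ) : ℝ := √(r ^ 2 + δ ^ 2) - δ

theorem contDiff_smoothAbs {δ : ℝ} (hδ : 0 < δ) : ContDiff ℝ 1 (smoothAbs δ) :=
  (((contDiff_id.pow 2).add contDiff_const).sqrt fun r => by positivity).sub contDiff_const

theorem hasDerivAt_smoothAbs {δ : ℝ} (hδ : 0 < δ) (r : ℝ) :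
    HasDerivAt (smoothAbs δ) (r / √(r ^ 2 + δ ^ 2)) r := by
  have h : HasDerivAt (fun r : ℝ => r ^ 2 + δ ^ 2) (2 * r) r := by
    simpa using (hasDerivAt_pow 2 r).add_const (δ ^ 2)
  have := (h.sqrt (by positivity)).sub_const δ
  refine this.congr_deriv ?_
  field_simp

/-- The subtraction of δ in `smoothAbs` serves this: the composition with Φ keeps the bounded
support and the vanishing at time T. -/
theorem smoothAbs_zero {δ : ℝ} (hδ : 0 < δ) : smoothAbs δ 0 = 0 := by
  simp [smoothAbs, Real.sqrt_sq hδ.le]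

theorem abs_sub_le_smoothAbs (δ r : ℝ) : |r| - δ ≤ smoothAbs δ r := by
  have : |r| ≤ √(r ^ 2 + δ ^ 2) := Real.abs_le_sqrt (by nlinarith [sq_nonneg δ])
  unfold smoothAbs; linarith

theorem abs_deriv_smoothAbs_le {δ : ℝ} (hδ : 0 < δ) (r : ℝ) : |r / √(r ^ 2 + δ ^ 2)| ≤ 1 := by
  have h0 : 0 < √(r ^ 2 + δ ^ 2) := Real.sqrt_pos.2 (by positivity)
  rw [abs_div, abs_of_pos h0, div_le_one h0]
  exact Real.abs_le_sqrt (by nlinarith [sq_nonneg δ])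

/-- The absolute value is homogeneous of degree one, so β(r) - β'(r) r would vanish; for its smooth
version it is O(δ). This is the factor that multiplies div c after renormalization. -/
theorem abs_smoothAbs_sub_le {δ : ℝ} (hδ : 0 < δ) (r : ℝ) :
    |smoothAbs δ r - r / √(r ^ 2 + δ ^ 2) * r| ≤ δ := by
  have h0 : 0 < √(r ^ 2 + δ ^ 2) := Real.sqrt_pos.2 (by positivity)
  have h1 : δ ≤ √(r ^ 2 + δ ^ 2) := Real.le_sqrt_of_sq_le (by nlinarith [sq_nonneg r])
  have h2 : √(r ^ 2 + δ ^ 2) ^ 2 = r ^ 2 + δ ^ 2 := Real.sq_sqrt (by positivity)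
  have e : smoothAbs δ r - r / √(r ^ 2 + δ ^ 2) * r = δ * (δ / √(r ^ 2 + δ ^ 2)) - δ := by
    rw [smoothAbs]; field_simp; nlinarith
  have h3 : 0 ≤ δ / √(r ^ 2 + δ ^ 2) := by positivity
  have h4 : δ / √(r ^ 2 + δ ^ 2) ≤ 1 := (div_le_one h0).2 h1
  rw [e, abs_le]
  constructor <;> nlinarith

theorem dualOp_smoothAbs {c : ℝ → E d → E d} {Φ : ℝ × E d → ℝ} (hΦ : ContDiff ℝ 1 Φ) {δ : ℝ}
    (hδ : 0 < δ) (z : ℝ × E d) :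
    dualOp c (fun z => smoothAbs δ (Φ z)) z
      = Φ z / √(Φ z ^ 2 + δ ^ 2) * dualOp c Φ z
        + divergence (c z.1) z.2 * (smoothAbs δ (Φ z) - Φ z / √(Φ z ^ 2 + δ ^ 2) * Φ z) := by
  have h1 : fderiv ℝ (fun z => smoothAbs δ (Φ z)) z
      = (Φ z / √(Φ z ^ 2 + δ ^ 2)) • fderiv ℝ Φ z :=
    ((hasDerivAt_smoothAbs hδ (Φ z)).comp_hasFDerivAt z
      (hΦ.differentiable one_ne_zero z).hasFDerivAt).fderiv
  have hΦ' : ContDiff ℝ 1 fun z => smoothAbs δ (Φ z) := (contDiff_smoothAbs hδ).comp hΦ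
  simp only [dualOp, adv, fderiv_slice_apply hΦ, fderiv_slice_apply hΦ', h1, slice]
  simp only [smul_apply, smul_eq_mul]
  ring

/-- The a priori estimate: `∫ |Φ_0| ≤ ∫∫ |∂_t Φ + div(c Φ)|`. -/
theorem integral_abs_le_dualOp (hT : 0 < T) {c : ℝ → E d → E d} (hc : IsRegular T M D c)
    {Φ : ℝ × E d → ℝ} (hΦ : Φ ∈ spaceTimeTest d T) :
    ∫ x, |Φ (0, x)| ≤ ∫ z, |dualOp c Φ z| ∂(spaceTime d T) := by
  obtain ⟨h1, ⟨R, hR⟩, h2⟩ := id hΦ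
  set ball : ℝ × E d → ℝ := fun z => (Metric.closedBall (0 : E d) R).indicator (fun _ => 1) z.2
  have hball : Integrable ball (spaceTime d T) :=
    (integrable_indicator_ball 1 R).comp_snd (volume.restrict (Icc (0 : ℝ) T))
  set C := D * ∫ z, ball z ∂(spaceTime d T)
  have hcs : ∀ f : ℝ → ℝ, f 0 = 0 → HasCompactSupport fun x => f (Φ (0, x)) := fun f hf =>
    HasCompactSupport.intro (isCompact_closedBall (0 : E d) R) fun x hx => by
      rw [hR (0, x) (by simpa using hx), hf]
  have hΦ0 : Continuous fun x => Φ (0, x) := h1.continuous.comp (by fun_prop)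
  have key : ∀ δ > 0, ∫ x, |Φ (0, x)| ≤ (∫ z, |dualOp c Φ z| ∂(spaceTime d T))
      + δ * (C + vol d R) := by
    intro δ hδ
    have hΨ : (fun z => smoothAbs δ (Φ z)) ∈ spaceTimeTest d T :=
      ⟨(contDiff_smoothAbs hδ).comp h1, ⟨R, fun z hz => by beta_reduce; rw [hR z hz, smoothAbs_zero hδ]⟩,
        fun x => by beta_reduce; rw [h2, smoothAbs_zero hδ]⟩
    -- The integral identity is applied to the renormalized function. The chain rule has a factor of
    -- modulus at most 1 in front of `dualOp c Φ`, and the divergence error is at most δD on the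
    -- support of Φ.
    have a1 : ∫ x, smoothAbs δ (Φ (0, x)) ≤ (∫ z, |dualOp c Φ z| ∂(spaceTime d T)) + δ * C := by
      have e := integral_dualOp hT hc hΨ
      have e' : ∫ x, smoothAbs δ (Φ (0, x))
          = ∫ z, -dualOp c (fun z => smoothAbs δ (Φ z)) z ∂(spaceTime d T) := by
        rw [integral_neg, e, neg_neg]
      have e2 : (∫ z, |dualOp c Φ z| ∂(spaceTime d T)) + δ * C
          = ∫ z, (|dualOp c Φ z| + δ * (D * ball z)) ∂(spaceTime d T) := by
        rw [integral_add (integrable_dualOp hc h1 hR).abs ((hball.const_mul D).const_mul δ),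
          integral_const_mul, integral_const_mul]
      rw [e', e2]
      refine integral_mono_ae (integrable_dualOp hc hΨ.1 (R := R)
        fun z hz => by rw [hR z hz, smoothAbs_zero hδ]).neg
        ((integrable_dualOp hc h1 hR).abs.add ((hball.const_mul D).const_mul δ)) ?_
      filter_upwards [ae_spaceTime_of_ae_time hc.div_bound] with z hz
      rw [dualOp_smoothAbs h1 hδ]
      refine (neg_le_abs _).trans ((abs_add_le _ _).trans (add_le_add ?_ ?_))
      · rw [abs_mul]
        exact mul_le_of_le_one_left (abs_nonneg _) (abs_deriv_smoothAbs_le hδ _)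
      · by_cases hzR : z.2 ∈ Metric.closedBall (0 : E d) R
        · have : ball z = 1 := indicator_of_mem hzR _
          rw [this, abs_mul, mul_one, mul_comm δ]
          exact mul_le_mul (hz _) (abs_smoothAbs_sub_le hδ _) (abs_nonneg _) hc.D_nonneg
        · have : ball z = 0 := indicator_of_notMem hzR _
          rw [this, hR z (by simpa using hzR), smoothAbs_zero hδ]; simp
    have a2 : ∫ x, |Φ (0, x)| ≤ (∫ x, smoothAbs δ (Φ (0, x))) + δ * vol d R := by
      have e : ∫ x, (Metric.closedBall (0 : E d) R).indicator (fun _ => δ) x = δ * vol d R := by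
        rw [integral_indicator Metric.isClosed_closedBall.measurableSet, setIntegral_const,
          smul_eq_mul, mul_comm]; rfl
      have i1 : Integrable fun x => smoothAbs δ (Φ (0, x)) :=
        (((contDiff_smoothAbs hδ).continuous).comp hΦ0).integrable_of_hasCompactSupport
          (hcs _ (smoothAbs_zero hδ))
      rw [← e, ← integral_add i1 (integrable_indicator_ball δ R)]
      refine integral_mono (hΦ0.abs.integrable_of_hasCompactSupport (hcs _ abs_zero))
        (i1.add (integrable_indicator_ball δ R)) fun x => ?_
      by_cases hxR : x ∈ Metric.closedBall (0 : E d) R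
      · have := abs_sub_le_smoothAbs δ (Φ (0, x))
        simp only [indicator_of_mem hxR]; linarith
      · simp only [indicator_of_notMem hxR, hR (0, x) (by simpa using hxR),
          smoothAbs_zero hδ]; simp
    linarith
  refine le_of_forall_pos_le_add fun ε hε => ?_
  have hCn : 0 ≤ C + vol d R := add_nonneg (mul_nonneg hc.D_nonneg (integral_nonneg fun z =>
    indicator_nonneg (fun _ _ => zero_le_one) _)) (vol_nonneg R)
  refine (key (ε / (C + vol d R + 1)) (by positivity)).trans (add_le_add_right ?_ _)
  rw [div_mul_eq_mul_div, div_le_iff₀ (by positivity)]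
  nlinarith

end RoughTransport
end

noncomputable section
namespace RoughTransport

/-! ### Existence of weak solutions of the transport equation -/

variable {d : ℕ} {T K M D : ℝ}

/-- The finite measure on `[0,T] × ℝ^d` with density `weight`. -/
def weightedMeasure (d : ℕ) (T : ℝ) : Measure (ℝ × E d) :=
  (spaceTime d T).withDensity fun z => ENNReal.ofReal (weight z.2)

theorem measurable_weight_snd :
    Measurable fun z : ℝ × E d => ENNReal.ofReal (weight z.2) :=
  ENNReal.measurable_ofReal.comp
    ((contDiff_weight (n := 0)).continuous.measurable.comp measurable_snd)

instance : IsFiniteMeasure (weightedMeasure d T) :=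
  isFiniteMeasure_withDensity_ofReal
    (integrable_weight.comp_snd (volume.restrict (Icc (0 : ℝ) T))).hasFiniteIntegral

theorem weightedMeasure_ac : weightedMeasure d T ≪ spaceTime d T :=
  withDensity_absolutelyContinuous _ _

theorem ac_weightedMeasure : spaceTime d T ≪ weightedMeasure d T :=
  withDensity_absolutelyContinuous' measurable_weight_snd.aemeasurable
    (Eventually.of_forall fun z => (ENNReal.ofReal_pos.2 (weight_pos z.2)).ne')

theorem integral_weightedMeasure (f : ℝ × E d → ℝ) :
    ∫ z, f z ∂(weightedMeasure d T) = ∫ z, weight z.2 * f z ∂(spaceTime d T) := by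
  rw [weightedMeasure, integral_withDensity_eq_integral_toReal_smul measurable_weight_snd
    (Eventually.of_forall fun z => ENNReal.ofReal_lt_top)]
  congr 1; funext z
  rw [ENNReal.toReal_ofReal (weight_pos _).le, smul_eq_mul]

theorem dualOp_add {c : ℝ → E d → E d} {Φ Ψ : ℝ × E d → ℝ} (hΦ : ContDiff ℝ 1 Φ)
    (hΨ : ContDiff ℝ 1 Ψ) : dualOp c (Φ + Ψ) = dualOp c Φ + dualOp c Ψ := by
  funext z
  have h : ContDiff ℝ 1 (Φ + Ψ) := hΦ.add hΨ
  simp only [dualOp, adv, fderiv_slice_apply hΦ, fderiv_slice_apply hΨ,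
    fderiv_slice_apply h, Pi.add_apply, slice]
  rw [fderiv_add (hΦ.differentiable one_ne_zero z) (hΨ.differentiable one_ne_zero z)]
  simp only [add_apply]; ring

theorem dualOp_smul {c : ℝ → E d → E d} {Φ : ℝ × E d → ℝ} (hΦ : ContDiff ℝ 1 Φ) (a : ℝ) :
    dualOp c (a • Φ) = a • dualOp c Φ := by
  funext z
  have h : ContDiff ℝ 1 (a • Φ) := hΦ.const_smul a
  simp only [dualOp, adv, fderiv_slice_apply hΦ, fderiv_slice_apply h,
    Pi.smul_apply, slice]
  rw [fderiv_const_smul (hΦ.differentiable one_ne_zero z)]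
  simp only [smul_apply, smul_eq_mul]; ring

/-- Dividing by the weight turns the Lebesgue pairing into the pairing for the finite measure. The
quotient is essentially bounded because 1/weight ≤ (1 + R²)^{d+1} on the support. -/
theorem memLp_dualOp_div {c : ℝ → E d → E d} (hc : IsRegular T M D c) {Φ : ℝ × E d → ℝ}
    (hΦ : Φ ∈ spaceTimeTest d T) :
    MemLp (fun z => dualOp c Φ z / weight z.2) 2 (weightedMeasure d T) := by
  obtain ⟨h1, ⟨R, hR⟩, -⟩ := hΦ
  obtain ⟨B, hB⟩ := exists_dualOp_bound hc h1 hR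
  have hm : AEStronglyMeasurable (fun z => dualOp c Φ z / weight z.2) (spaceTime d T) :=
    (aestronglyMeasurable_dualOp hc h1).div₀
      ((contDiff_weight (n := 0)).continuous.comp continuous_snd).aestronglyMeasurable
  refine MemLp.of_bound (hm.mono_ac weightedMeasure_ac) (|B| * (1 + R ^ 2) ^ (d + 1))
    (weightedMeasure_ac.ae_le ?_)
  filter_upwards [hB] with z hz
  by_cases hzR : ‖z.2‖ ≤ R
  · rw [weight, div_inv_eq_mul, norm_mul, Real.norm_eq_abs, Real.norm_of_nonneg (by positivity)]
    refine mul_le_mul (hz.trans (le_abs_self B)) ?_ (by positivity) (abs_nonneg _)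
    gcongr
  · rw [dualOp_zero_of_cyl hR (not_le.1 hzR), zero_div, norm_zero]
    positivity

/-- The a priori estimate says exactly that -∫v₀Φ_0 is dominated by K times the L¹ norm of `dualOp c
Φ`. The duality lemma then produces v with the same bound K as the initial datum. -/
theorem exists_dual_solution (hT : 0 < T) {c : ℝ → E d → E d} (hc : IsRegular T M D c)
    {v₀ : E d → ℝ} (hm : AEStronglyMeasurable v₀) (hK : 0 ≤ K) (hb : ∀ᵐ x, |v₀ x| ≤ K) :
    ∃ v : ℝ × E d → ℝ, IsBdd T K v ∧ ∀ Φ ∈ spaceTimeTest d T,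
      ∫ z, v z * dualOp c Φ z ∂(spaceTime d T) = -∫ x, v₀ x * Φ (0, x) := by
  have hcs : ∀ Φ ∈ spaceTimeTest d T, Continuous (fun x => Φ (0, x)) ∧
      HasCompactSupport fun x => Φ (0, x) := by
    rintro Φ ⟨h1, ⟨R, hR⟩, -⟩
    exact ⟨h1.continuous.comp (by fun_prop), HasCompactSupport.intro
      (isCompact_closedBall (0 : E d) R) fun x hx => hR (0, x) (by simpa using hx)⟩
  have hint : ∀ Φ ∈ spaceTimeTest d T, Integrable fun x => v₀ x * Φ (0, x) := fun Φ hΦ => by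
    refine ((hcs Φ hΦ).1.integrable_of_hasCompactSupport (hcs Φ hΦ).2).bdd_mul hm
      (c := K) hb
  let A : spaceTimeTest d T →ₗ[ℝ] Lp ℝ 2 (weightedMeasure d T) :=
    { toFun := fun Φ => (memLp_dualOp_div hc Φ.2).toLp _
      map_add' := fun Φ Ψ => by
        rw [← MemLp.toLp_add]
        congr 1; funext z
        simp only [Submodule.coe_add, dualOp_add Φ.2.1 Ψ.2.1, Pi.add_apply, add_div]
      map_smul' := fun a Φ => by
        rw [RingHom.id_apply, ← MemLp.toLp_const_smul]
        congr 1; funext z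
        simp only [Submodule.coe_smul, dualOp_smul Φ.2.1, Pi.smul_apply, smul_eq_mul,
          mul_div_assoc] }
  let l : spaceTimeTest d T →ₗ[ℝ] ℝ :=
    { toFun := fun Φ => -∫ x, v₀ x * (Φ : ℝ × E d → ℝ) (0, x)
      map_add' := fun Φ Ψ => by
        rw [← neg_add, ← integral_add (hint Φ Φ.2) (hint Ψ Ψ.2)]
        simp [mul_add]
      map_smul' := fun a Φ => by
        rw [RingHom.id_apply, smul_eq_mul, mul_neg, ← integral_const_mul]
        congr 2; funext x
        simp; ring }
  have hA : ∀ Φ : spaceTimeTest d T, A Φ =ᵐ[weightedMeasure d T]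
      fun z => dualOp c Φ z / weight z.2 := fun Φ => (memLp_dualOp_div hc Φ.2).coeFn_toLp
  have hcancel : ∀ a : ℝ, ∀ x : E d, weight x * (a / weight x) = a := fun a x =>
    mul_div_cancel₀ a (weight_pos x).ne'
  obtain ⟨v, hvm, hvb, hv⟩ := exists_bounded_representation A l hK fun Φ => by
    have e : ∫ z, |A Φ z| ∂(weightedMeasure d T) = ∫ z, |dualOp c Φ z| ∂(spaceTime d T) := by
      rw [integral_congr_ae ((hA Φ).mono fun z hz => congrArg abs hz), integral_weightedMeasure]
      congr 1; funext z
      rw [abs_div, abs_of_pos (weight_pos z.2), hcancel]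
    rw [e]
    calc l Φ ≤ |∫ x, v₀ x * (Φ : ℝ × E d → ℝ) (0, x)| := neg_le_abs _
      _ ≤ ∫ x, K * |(Φ : ℝ × E d → ℝ) (0, x)| := by
        have hi : Integrable fun x => (Φ : ℝ × E d → ℝ) (0, x) :=
          (hcs Φ Φ.2).1.integrable_of_hasCompactSupport (hcs Φ Φ.2).2
        refine norm_integral_le_of_norm_le (f := fun x => v₀ x * (Φ : ℝ × E d → ℝ) (0, x))
          (g := fun x => K * |(Φ : ℝ × E d → ℝ) (0, x)|) (hi.abs.const_mul K) ?_
        filter_upwards [hb] with x hx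
        rw [norm_mul]
        exact mul_le_mul_of_nonneg_right hx (norm_nonneg _)
      _ = K * ∫ x, |(Φ : ℝ × E d → ℝ) (0, x)| := integral_const_mul _ _
      _ ≤ _ := mul_le_mul_of_nonneg_left (integral_abs_le_dualOp hT hc Φ.2) hK
  refine ⟨v, ⟨hK, hvm.mono_ac ac_weightedMeasure, ac_weightedMeasure.ae_le hvb⟩, fun Φ hΦ => ?_⟩
  have := hv ⟨Φ, hΦ⟩
  rw [integral_congr_ae ((hA ⟨Φ, hΦ⟩).mono fun z hz => congrArg (v z * ·) hz),
    integral_weightedMeasure] at this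
  refine Eq.trans ?_ this
  congr 1; funext z
  rw [mul_left_comm, hcancel]

/-! ### Integration by parts in time and the weak formulation. -/

theorem primitive_ac {f : ℝ → ℝ} (hT : 0 < T) (hf : IntegrableOn f (Icc 0 T)) :
    AbsolutelyContinuousOnInterval (fun t => ∫ s in (0 : ℝ)..t, f s) 0 T ∧
      ∀ᵐ t ∂(volume.restrict (Icc 0 T)), HasDerivAt (fun t => ∫ s in (0 : ℝ)..t, f s) (f t) t := by
  have hi : IntervalIntegrable f volume 0 T :=
    intervalIntegrable_of_Icc hf ⟨le_rfl, hT.le⟩ ⟨hT.le, le_rfl⟩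
  have h0 : (0 : ℝ) ∈ uIcc 0 T := left_mem_uIcc
  refine ⟨hi.absolutelyContinuousOnInterval_intervalIntegral h0, ?_⟩
  rw [ae_restrict_iff' measurableSet_Icc]
  filter_upwards [hi.ae_hasDerivAt_integral] with t ht htT
  exact ht (by rwa [uIcc_of_le hT.le]) 0 h0

/-- Integration by parts for an absolutely continuous path and a `C¹` path vanishing at `T`. -/
theorem integral_primitive_mul (hT : 0 < T) {β η : ℝ → ℝ} (hβ : IntegrableOn β (Icc 0 T))
    (hη : Continuous η) :
    ∫ t in (0 : ℝ)..T, (-∫ s in T..t, η s) * β t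
      = ∫ t in (0 : ℝ)..T, η t * ∫ s in (0 : ℝ)..t, β s := by
  obtain ⟨h1, h2⟩ := primitive_ac hT hβ
  have hd : ∀ t, HasDerivAt (fun t => -∫ s in T..t, η s) (-η t) t := fun t =>
    (hη.integral_hasStrictDerivAt T t).hasDerivAt.neg
  have h3 : AbsolutelyContinuousOnInterval (fun t => -∫ s in T..t, η s) 0 T :=
    ((hη.intervalIntegrable 0 T).absolutelyContinuousOnInterval_intervalIntegral
      right_mem_uIcc).neg
  have := h3.integral_mul_deriv_eq_deriv_mul h1
  have e1 : ∫ t in (0 : ℝ)..T, (-∫ s in T..t, η s) * deriv (fun t => ∫ s in (0 : ℝ)..t, β s) t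
      = ∫ t in (0 : ℝ)..T, (-∫ s in T..t, η s) * β t := by
    refine intervalIntegral.integral_congr_ae ?_
    filter_upwards [(ae_restrict_iff' measurableSet_Icc).1 h2] with t ht htT
    rw [uIoc_of_le hT.le] at htT
    rw [(ht (Ioc_subset_Icc_self htT)).deriv]
  rw [e1] at this
  rw [this]
  simp only [(hd _).deriv, intervalIntegral.integral_same, neg_zero, zero_mul, mul_zero, sub_zero,
    neg_mul, intervalIntegral.integral_neg, sub_neg_eq_add, zero_add]

/-- The dual formulation is tested with products θ(t)φ(x), where θ' = -η and θ(T) = 0. As η is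
arbitrary and need not vanish at the endpoints, the fundamental lemma of the calculus of variations
yields the integrated equation together with its initial condition, through θ(0) = ∫η. -/
theorem exists_isWeakTransport (hT : 0 < T) {c : ℝ → E d → E d} (hc : IsRegular T M D c)
    {v₀ : E d → ℝ} (hm : AEStronglyMeasurable v₀) (hK : 0 ≤ K) (hb : ∀ᵐ x, |v₀ x| ≤ K) :
    ∃ v : ℝ × E d → ℝ, IsBdd T K v ∧ IsWeakTransport T c v₀ v := by
  obtain ⟨v, hv, hdual⟩ := exists_dual_solution hT hc hm hK hb
  refine ⟨v, hv, fun φ hφ => ?_⟩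
  set m₀ := ∫ x, v₀ x * φ x with hm₀
  set m : ℝ → ℝ := fun t => ∫ x, v (t, x) * φ x with hmdef
  have hβ : IntegrableOn (fun r => drift v c r φ) (Icc 0 T) := by
    have := integrableOn_drift hv hc hφ (a := fun _ => 0) continuous_const (H := 0) (by simp)
    simpa only [tau_zero] using this
  have hmint : IntegrableOn m (Icc 0 T) := by
    obtain ⟨A, -, hA⟩ := hφ.exists_bound
    obtain ⟨R, -, hR⟩ := hφ.exists_radius
    refine Integrable.of_bound (C := K * A * vol d R) ?_ ?_
    · exact (hv.meas.mul (hφ.continuous.comp continuous_snd).aestronglyMeasurable).integral_prod_right'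
    · filter_upwards [hv.ae_slice] with t ht
      exact abs_integral_slice_le hK ht.2 hA hR
  set B : ℝ → ℝ := fun t => ∫ s in (0 : ℝ)..t, drift v c s φ with hB
  have hBint : IntegrableOn B (Icc 0 T) := by
    have := (primitive_ac hT hβ).1.continuousOn
    rw [uIcc_of_le hT.le] at this
    exact this.integrableOn_Icc
  have hg : IntegrableOn (fun t => m t - (m₀ + B t)) (Icc 0 T) :=
    hmint.sub ((integrable_const m₀).add hBint)
  have key : ∀ η : ℝ → ℝ, ContDiff ℝ ∞ η → HasCompactSupport η →
      ∫ t, η t • (m t - (m₀ + B t)) ∂(volume.restrict (Icc 0 T)) = 0 := by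
    intro η hη _
    set θ : ℝ → ℝ := fun t => -∫ s in T..t, η s with hθ
    have hd : ∀ t, HasDerivAt θ (-η t) t := fun t =>
      (hη.continuous.integral_hasStrictDerivAt T t).hasDerivAt.neg
    have hθ1 : ContDiff ℝ 1 θ := by
      rw [contDiff_one_iff_deriv]
      refine ⟨fun t => (hd t).differentiableAt, ?_⟩
      have : deriv θ = fun t => -η t := funext fun t => (hd t).deriv
      rw [this]; exact hη.continuous.neg
    obtain ⟨R, -, hR⟩ := hφ.exists_radius
    have hφ1 : ContDiff ℝ 1 φ := hφ.1.of_le (by simp)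
    have hΦ1 : ContDiff ℝ 1 fun z : ℝ × E d => θ z.1 * φ z.2 :=
      (hθ1.comp contDiff_fst).mul (hφ1.comp contDiff_snd)
    have hΦ : (fun z : ℝ × E d => θ z.1 * φ z.2) ∈ spaceTimeTest d T :=
      ⟨hΦ1, ⟨R, fun z hz => by beta_reduce; rw [hR _ hz, mul_zero]⟩, fun x => by simp [hθ]⟩
    have hop : ∀ z : ℝ × E d, dualOp c (fun z : ℝ × E d => θ z.1 * φ z.2) z
        = -η z.1 * φ z.2 + θ z.1 * adv (c z.1) φ z.2 := by
      intro z
      have e1 : fderiv ℝ (fun z : ℝ × E d => θ z.1 * φ z.2) z (1, 0) = -η z.1 * φ z.2 :=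
        (hasDerivAt_time hΦ1 z.1 z.2).unique (show HasDerivAt (fun s => θ s * φ z.2) _ z.1 from
          (hd z.1).mul_const _)
      have e2 : slice (fun z : ℝ × E d => θ z.1 * φ z.2) z.1 = fun x => θ z.1 * φ x := rfl
      rw [dualOp, e1, e2, adv, fderiv_const_mul (hφ.differentiable z.2), adv]
      simp only [smul_apply, smul_eq_mul]; ring
    have h1 := hdual _ hΦ
    obtain ⟨A, hA⟩ := exists_dualOp_bound hc hΦ1 (R := R) fun z hz => by rw [hR _ hz, mul_zero]
    have hi : Integrable (fun z => v z * dualOp c (fun z : ℝ × E d => θ z.1 * φ z.2) z)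
        (spaceTime d T) := (integrable_dualOp hc hΦ1 (R := R) fun z hz => by
      rw [hR _ hz, mul_zero]).bdd_mul hv.meas (c := K) hv.bound
    rw [spaceTime, integral_prod _ hi] at h1
    have h2 : ∫ t in Icc 0 T, ∫ x, v (t, x) * dualOp c (fun z : ℝ × E d => θ z.1 * φ z.2) (t, x)
        = ∫ t in Icc 0 T, (-(η t * m t) + θ t * drift v c t φ) := by
      refine integral_congr_ae ?_
      filter_upwards [ae_goodTime hv hc] with t ht
      simp only [hop]
      have a1 := ht.integrable_mul hφ.continuous hφ.2
      have a2 := ht.integrable_drift hφ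
      have : ∀ x, v (t, x) * (-η t * φ x + θ t * adv (c t) φ x)
          = -η t * (v (t, x) * φ x) + θ t * (v (t, x) * adv (c t) φ x) := fun x => by ring
      simp_rw [this]
      rw [integral_add (a1.const_mul _) (a2.const_mul _), integral_const_mul, integral_const_mul]
      simp only [hmdef, drift]; ring
    have i1 : IntegrableOn (fun t => η t * m t) (Icc 0 T) :=
      hmint.continuousOn_mul hη.continuous.continuousOn isCompact_Icc
    have i2 : IntegrableOn (fun t => θ t * drift v c t φ) (Icc 0 T) :=
      hβ.continuousOn_mul hθ1.continuous.continuousOn isCompact_Icc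
    have i3 : IntegrableOn (fun t => η t * B t) (Icc 0 T) :=
      hBint.continuousOn_mul hη.continuous.continuousOn isCompact_Icc
    have i4 : IntegrableOn η (Icc 0 T) := hη.continuous.integrableOn_Icc
    have i1' : IntegrableOn (fun t => -(η t * m t)) (Icc 0 T) := i1.neg
    rw [h2, integral_add i1' i2, integral_neg] at h1
    have h3 : ∫ t in Icc 0 T, θ t * drift v c t φ = ∫ t in Icc 0 T, η t * B t := by
      have := integral_primitive_mul hT hβ hη.continuous
      rwa [intervalIntegral.integral_of_le hT.le, intervalIntegral.integral_of_le hT.le,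
        ← integral_Icc_eq_integral_Ioc, ← integral_Icc_eq_integral_Ioc] at this
    have h4 : ∫ x, v₀ x * (θ 0 * φ x) = θ 0 * m₀ := by
      rw [hm₀, ← integral_const_mul]; congr 1; funext x; ring
    have h5 : θ 0 = ∫ t in Icc 0 T, η t := by
      rw [hθ]; beta_reduce
      rw [intervalIntegral.integral_symm, neg_neg, intervalIntegral.integral_of_le hT.le,
        integral_Icc_eq_integral_Ioc]
    rw [h3, h4] at h1
    have h6 : ∀ t, η t • (m t - (m₀ + B t)) = η t * m t - (m₀ * η t + η t * B t) := fun t => by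
      rw [smul_eq_mul]; ring
    simp_rw [h6]
    have i5 : IntegrableOn (fun t => m₀ * η t + η t * B t) (Icc 0 T) := (i4.const_mul m₀).add i3
    rw [integral_sub i1 i5, integral_add (i4.const_mul m₀) i3,
      integral_const_mul, ← h5]
    linarith
  have := ae_eq_zero_of_integral_contDiff_smul_eq_zero (μ := volume.restrict (Icc 0 T))
    (Integrable.locallyIntegrable hg) key
  filter_upwards [this] with t ht
  exact sub_eq_zero.1 ht

end RoughTransport
end

noncomputable section
namespace RoughTransport

/-! ### Mollification and commutators -/

variable {d : ℕ} {T K M D : ℝ}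

/-- `k` is a mollification kernel at scale `ε`. -/
structure IsKernel (A ε : ℝ) (k : E d → ℝ) : Prop where
  isTest : IsTest k
  integral_eq_one : ∫ x, k x = 1
  bound : ∀ x, |k x| ≤ A * ε⁻¹ ^ d
  fderiv_bound : ∀ x, ‖fderiv ℝ k x‖ ≤ A * ε⁻¹ ^ d * ε⁻¹
  radius : ∀ x, ε < ‖x‖ → k x = 0

/-- The kernels are rescalings of one normalized bump, so the constant does not depend on the scale.
-/
theorem exists_isKernel (d : ℕ) :
    ∃ A, 0 ≤ A ∧ ∀ ε > 0, ∃ k : E d → ℝ, IsKernel A ε k := by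
  let f : ContDiffBump (0 : E d) := ⟨1 / 2, 1, by norm_num, by norm_num⟩
  set ρ : E d → ℝ := f.normed volume with hρ
  have hc : ContDiff ℝ ∞ ρ := f.contDiff_normed
  have hs : HasCompactSupport ρ := f.hasCompactSupport_normed
  obtain ⟨A₀, h0⟩ := hs.exists_bound_of_continuous hc.continuous
  obtain ⟨A₁, h1⟩ := (hs.fderiv (𝕜 := ℝ)).exists_bound_of_continuous
    (hc.continuous_fderiv (by simp))
  refine ⟨max 0 (max A₀ A₁), le_max_left _ _, fun ε hε => ?_⟩
  have hε' : ε⁻¹ ≠ 0 := inv_ne_zero hε.ne'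
  have hd : ∀ x, HasFDerivAt (fun x => ε⁻¹ ^ d * ρ (ε⁻¹ • x))
      (ε⁻¹ ^ d • (ε⁻¹ • fderiv ℝ ρ (ε⁻¹ • x))) x := fun x => by
    have h2 : HasFDerivAt (fun x : E d => ε⁻¹ • x) (ε⁻¹ • ContinuousLinearMap.id ℝ (E d)) x :=
      (hasFDerivAt_id x).const_smul ε⁻¹
    have h3 := ((hc.differentiable (by simp) (ε⁻¹ • x)).hasFDerivAt.comp x h2).const_mul (ε⁻¹ ^ d)
    exact h3.congr_fderiv (by ext y; simp)
  refine ⟨fun x => ε⁻¹ ^ d * ρ (ε⁻¹ • x), ⟨contDiff_const.mul (hc.comp (contDiff_const_smul _)),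
    (hs.comp_smul hε').mul_left⟩, ?_, fun x => ?_, fun x => ?_, fun x hx => ?_⟩
  · rw [integral_const_mul, Measure.integral_comp_smul, finrank_euclideanSpace_fin,
      f.integral_normed, smul_eq_mul, mul_one, abs_of_pos (by positivity)]
    exact mul_inv_cancel₀ (by positivity)
  · rw [abs_mul, abs_of_pos (by positivity), mul_comm]
    exact mul_le_mul_of_nonneg_right
      ((h0 _).trans ((le_max_left _ _).trans (le_max_right _ _))) (by positivity)
  · rw [(hd x).fderiv, norm_smul, norm_smul, Real.norm_of_nonneg (by positivity),
      Real.norm_of_nonneg (by positivity)]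
    have := (h1 (ε⁻¹ • x)).trans ((le_max_right A₀ A₁).trans (le_max_right 0 _))
    calc ε⁻¹ ^ d * (ε⁻¹ * ‖fderiv ℝ ρ (ε⁻¹ • x)‖)
        ≤ ε⁻¹ ^ d * (ε⁻¹ * max 0 (max A₀ A₁)) := by gcongr
      _ = _ := by ring
  · have : ε⁻¹ • x ∉ Function.support ρ := by
      rw [hρ, f.support_normed_eq, mem_ball_zero_iff, norm_smul, Real.norm_of_nonneg
        (by positivity), not_lt, inv_mul_eq_div]
      exact (one_le_div hε).2 hx.le
    beta_reduce
    rw [Function.notMem_support.1 this, mul_zero]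

namespace IsKernel

variable {A ε : ℝ} {k : E d → ℝ}

theorem tau_radius (hk : IsKernel A ε k) {x y : E d} (h : ε < ‖y - x‖) : tau (-x) k y = 0 := by
  rw [tau, ← sub_eq_add_neg]; exact hk.radius _ h

theorem fderiv_tau_radius (hk : IsKernel A ε k) {x y : E d} (h : ε < ‖y - x‖) :
    fderiv ℝ (tau (-x) k) y = 0 := by
  rw [fderiv_tau, ← sub_eq_add_neg]; exact fderiv_eq_zero_of_radius hk.radius h

theorem integral_tau (hk : IsKernel A ε k) (x : E d) : ∫ y, tau (-x) k y = 1 :=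
  (integral_add_right_eq_self k (-x)).trans hk.integral_eq_one

end IsKernel

/-- The volume of the unit ball. -/
def unitVol (d : ℕ) : ℝ := volume.real (Metric.ball (0 : E d) 1)

theorem unitVol_nonneg : 0 ≤ unitVol d := measureReal_nonneg

theorem pow_mul_setIntegral_eq (ε : ℝ) (hε : 0 < ε) (x : E d) (h : E d → ℝ) :
    ε⁻¹ ^ d * ∫ y in Metric.closedBall x ε, h y
      = unitVol d * ⨍ y in Metric.closedBall x ε, h y := by
  have hV : unitVol d ≠ 0 :=
    (ENNReal.toReal_pos (Metric.measure_ball_pos volume _ one_pos).ne' measure_ball_lt_top.ne).ne'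
  rw [setAverage_eq, Measure.addHaar_real_closedBall _ _ hε.le, finrank_euclideanSpace_fin,
    smul_eq_mul]
  change _ = unitVol d * ((ε ^ d * unitVol d)⁻¹ * _)
  rw [inv_pow, mul_inv, ← mul_assoc, mul_comm (unitVol d), mul_assoc (ε ^ d)⁻¹,
    inv_mul_cancel₀ hV, mul_one]

/-- Bounds of size ε^{-d} on a ball of radius ε become averages over that ball, the quantities
controlled by Lebesgue differentiation. -/
theorem abs_integral_mul_le_average {h F : E d → ℝ} {B ε : ℝ} {x : E d} (hε : 0 < ε)
    (hh : LocallyIntegrable h) (hF : ∀ y, |F y| ≤ B * ε⁻¹ ^ d) (h0 : ∀ y, ε < ‖y - x‖ → F y = 0) :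
    |∫ y, h y * F y| ≤ B * unitVol d * ⨍ y in Metric.closedBall x ε, ‖h y‖ := by
  have hi : IntegrableOn (fun y => B * ε⁻¹ ^ d * ‖h y‖) (Metric.closedBall x ε) :=
    ((hh.integrableOn_isCompact (isCompact_closedBall x ε)).norm).const_mul _
  have := norm_integral_le_of_norm_le (f := fun y => h y * F y)
    ((integrable_indicator_iff Metric.isClosed_closedBall.measurableSet).2 hi)
    (Eventually.of_forall fun y => by
      by_cases hy : y ∈ Metric.closedBall x ε
      · rw [indicator_of_mem hy, norm_mul, mul_comm]
        exact mul_le_mul_of_nonneg_right (hF y) (norm_nonneg _)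
      · rw [indicator_of_notMem hy, h0 y (by
          rw [Metric.mem_closedBall, dist_eq_norm] at hy; exact not_le.1 hy), mul_zero, norm_zero])
  refine this.trans (le_of_eq ?_)
  rw [integral_indicator Metric.isClosed_closedBall.measurableSet, integral_const_mul, mul_assoc,
    pow_mul_setIntegral_eq ε hε, mul_assoc]

theorem average_le {h : E d → ℝ} {ε : ℝ} {x : E d} (hε : 0 < ε) (hK : ∀ᵐ y, ‖h y‖ ≤ K) :
    ⨍ y in Metric.closedBall x ε, ‖h y‖ ≤ K := by
  have hp : 0 < volume.real (Metric.closedBall x ε) :=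
    ENNReal.toReal_pos (Metric.measure_closedBall_pos volume _ hε).ne' measure_closedBall_lt_top.ne
  rw [setAverage_eq, smul_eq_mul, inv_mul_le_iff₀ hp]
  have := norm_setIntegral_le_of_norm_le_const_ae' (μ := volume) (f := fun y => ‖h y‖)
    (s := Metric.closedBall x ε) (C := K) measure_closedBall_lt_top
    (hK.mono fun y hy _ => by rwa [norm_norm])
  rw [mul_comm]
  exact (le_abs_self _).trans this

/-- The mollification `x ↦ ∫ v_t(y) k(y - x) dy`. -/
def mollify (v : ℝ × E d → ℝ) (k : E d → ℝ) (z : ℝ × E d) : ℝ :=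
  ∫ y, v (z.1, y) * tau (-z.2) k y

/-- The commutator of mollification and transport. -/
def commutator (v : ℝ × E d → ℝ) (c : ℝ → E d → E d) (k : E d → ℝ) (z : ℝ × E d) : ℝ :=
  ∫ y, v (z.1, y) * adv (fun y => c z.1 y - c z.1 z.2) (tau (-z.2) k) y

theorem divergence_sub_const (c : E d → E d) (a : E d) :
    divergence (fun y => c y - a) = divergence c := by
  funext x; simp only [divergence, fderiv_sub_const]

theorem adv_sub_const (c : E d → E d) (a : E d) (φ : E d → ℝ) (y : E d) :
    adv (fun y => c y - a) φ y = adv c φ y - fderiv ℝ φ y a := by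
  rw [adv, adv, divergence_sub_const, map_sub]; ring

namespace GoodTime

variable {v : ℝ × E d → ℝ} {c : ℝ → E d → E d} {t : ℝ} {A ε : ℝ} {k : E d → ℝ}

theorem locallyIntegrable (h : GoodTime K M D v c t) : LocallyIntegrable fun x => v (t, x) := by
  have : MemLp (fun x => v (t, x)) ∞ volume := memLp_top_of_bound h.meas K h.bound
  exact this.locallyIntegrable le_top

theorem hasFDerivAt_mollify (h : GoodTime K M D v c t) (hk : IsTest k) :
    ContDiff ℝ 1 (fun x => mollify v k (t, x)) ∧ ∀ x a,
      fderiv ℝ (fun x => mollify v k (t, x)) x a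
        = -∫ y, v (t, y) * fderiv ℝ (tau (-x) k) y a := by
  -- The kernel is evaluated at y - x, so the mollification is a convolution with the reflected
  -- kernel; this accounts for the sign of the gradient.
  set q : E d → ℝ := fun z => k (-z) with hq
  have hqc : ContDiff ℝ 1 q := (hk.1.of_le (by simp)).comp contDiff_neg
  have hqs : HasCompactSupport q := hk.2.comp_homeomorph (Homeomorph.neg (E d))
  have e : (fun x => mollify v k (t, x))
      = convolution (fun x => v (t, x)) q (ContinuousLinearMap.mul ℝ ℝ) volume := by
    funext x
    simp only [mollify, convolution_def, hq, tau, ContinuousLinearMap.mul_apply',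
      sub_eq_add_neg, neg_add, neg_neg, add_comm]
  have hfd : ∀ z, fderiv ℝ q z = -fderiv ℝ k (-z) := fun z => by
    have := (hk.differentiable (-z)).hasFDerivAt.comp z (hasFDerivAt_id z).neg
    exact (this.congr_fderiv (by ext y; simp)).fderiv
  rw [e]
  refine ⟨hqs.contDiff_convolution_right _ h.locallyIntegrable hqc, fun x a => ?_⟩
  rw [(hqs.hasFDerivAt_convolution_right _ h.locallyIntegrable hqc x).fderiv,
    convolution_precompR_apply _ h.locallyIntegrable (hqs.fderiv (𝕜 := ℝ))
      (hqc.continuous_fderiv one_ne_zero), convolution_def, ← integral_neg]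
  congr 1; funext y
  rw [hfd, fderiv_tau]
  simp [sub_eq_add_neg]

/-- Write c(y) = c(x) + (c(y) - c(x)). The constant field has no divergence and produces the
transport of the mollification; the difference produces the commutator. So the mollification solves
the same equation with the commutator as source. -/
theorem drift_tau_eq (h : GoodTime K M D v c t) (hk : IsTest k) (x : E d) :
    drift v c t (tau (-x) k)
      = commutator v c k (t, x) - fderiv ℝ (fun x => mollify v k (t, x)) x (c t x) := by
  rw [(h.hasFDerivAt_mollify hk).2, sub_neg_eq_add]
  have h1 := h.integrable_drift (hk.tau (-x))
  have hf : Continuous (fderiv ℝ (tau (-x) k)) := (hk.tau (-x)).1.continuous_fderiv (by simp)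
  have h2 : Integrable fun y => v (t, y) * fderiv ℝ (tau (-x) k) y (c t x) :=
    h.integrable_mul (hf.clm_apply continuous_const) ((hk.tau (-x)).2.fderiv_apply (𝕜 := ℝ) _)
  simp only [commutator, adv_sub_const, mul_sub]
  rw [integral_sub h1 h2, drift, sub_add_cancel]

theorem abs_mollify_le (h : GoodTime K M D v c t) (hA : 0 ≤ A) (hε : 0 < ε)
    (hk : IsKernel A ε k) (x : E d) : |mollify v k (t, x)| ≤ A * unitVol d * K :=
  (abs_integral_mul_le_average hε h.locallyIntegrable (fun _ => hk.bound _)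
    fun _ hy => hk.tau_radius hy).trans (mul_le_mul_of_nonneg_left (average_le hε h.bound)
      (mul_nonneg hA unitVol_nonneg))

theorem integral_sub_value (h : GoodTime K M D v c t) {F : E d → ℝ} (hF : Continuous F)
    (hF' : HasCompactSupport F) (a : ℝ) :
    ∫ y, (v (t, y) - a) * F y = (∫ y, v (t, y) * F y) - a * ∫ y, F y := by
  simp_rw [sub_mul]
  rw [integral_sub (h.integrable_mul hF hF')
    ((hF.integrable_of_hasCompactSupport hF').const_mul a), integral_const_mul]

theorem locallyIntegrable_sub (h : GoodTime K M D v c t) (a : ℝ) :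
    LocallyIntegrable fun x => v (t, x) - a := h.locallyIntegrable.sub (locallyIntegrable_const a)

theorem abs_mollify_sub_le (h : GoodTime K M D v c t) (hε : 0 < ε)
    (hk : IsKernel A ε k) (x : E d) : |mollify v k (t, x) - v (t, x)|
      ≤ A * unitVol d * ⨍ y in Metric.closedBall x ε, ‖v (t, y) - v (t, x)‖ := by
  have := h.integral_sub_value (hk.isTest.tau (-x)).continuous (hk.isTest.tau (-x)).2 (v (t, x))
  rw [hk.integral_tau, mul_one] at this
  rw [mollify, ← this]
  exact abs_integral_mul_le_average hε (h.locallyIntegrable_sub _) (fun _ => hk.bound _)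
    fun _ hy => hk.tau_radius hy

/-- The extra factor ε^{-1} in the gradient of the kernel is compensated by |c(y) - c(x)| ≤ Lε on
its support. The derivative bound is taken on radius R + 1 because ε ≤ 1. -/
theorem abs_adv_tau_le (h : GoodTime K M D v c t) (hA : 0 ≤ A) (hε : 0 < ε) (hε' : ε ≤ 1)
    (hk : IsKernel A ε k) {L R : ℝ} (hL : ∀ x, ‖x‖ ≤ R + 1 → ‖fderiv ℝ (c t) x‖ ≤ L)
    {x : E d} (hx : ‖x‖ ≤ R) (y : E d) :
    |adv (fun y => c t y - c t x) (tau (-x) k) y| ≤ (L * A + D * A) * ε⁻¹ ^ d := by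
  have hL0 : 0 ≤ L := (norm_nonneg _).trans (hL x (by linarith))
  have hD0 : 0 ≤ D := (abs_nonneg _).trans (h.div_bound x)
  by_cases hy : ε < ‖y - x‖
  · rw [adv, hk.tau_radius hy, hk.fderiv_tau_radius hy]
    simp only [zero_apply, mul_zero, add_zero, abs_zero]
    positivity
  have hy' := not_lt.1 hy
  have hyR : ‖y‖ ≤ R + 1 := by
    have := norm_add_le (y - x) x
    rw [sub_add_cancel] at this
    linarith
  have h1 : ‖c t y - c t x‖ ≤ L * ‖y - x‖ :=
    (convex_closedBall (0 : E d) (R + 1)).norm_image_sub_le_of_norm_fderiv_le (𝕜 := ℝ)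
      (fun z _ => h.contDiff.differentiable one_ne_zero z)
      (fun z hz => hL z (by simpa using hz)) (by simpa using hx.trans (by linarith))
      (by simpa using hyR)
  rw [adv, divergence_sub_const, add_mul]
  refine (abs_add_le _ _).trans (add_le_add ?_ ?_)
  · refine ((fderiv ℝ (tau (-x) k) y).le_opNorm (c t y - c t x)).trans ?_
    rw [fderiv_tau]
    calc ‖fderiv ℝ k (y + -x)‖ * ‖c t y - c t x‖
        ≤ (A * ε⁻¹ ^ d * ε⁻¹) * (L * ε) :=
          mul_le_mul (hk.fderiv_bound _) (h1.trans (mul_le_mul_of_nonneg_left hy' hL0))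
            (norm_nonneg _) (by positivity)
      _ = L * A * ε⁻¹ ^ d := by field_simp
  · rw [abs_mul, mul_assoc]
    exact mul_le_mul (h.div_bound y) (hk.bound _) (abs_nonneg _) hD0

/-- The first bound dominates. For the second, the kernel of the commutator is a divergence in y and
has zero integral, so the constant v(t,x) may be subtracted from v; the resulting mean oscillation
vanishes in the limit at Lebesgue points. -/
theorem commutator_bounds (h : GoodTime K M D v c t) (hA : 0 ≤ A) (hε : 0 < ε) (hε' : ε ≤ 1)
    (hk : IsKernel A ε k) {L R : ℝ} (hL : ∀ x, ‖x‖ ≤ R + 1 → ‖fderiv ℝ (c t) x‖ ≤ L)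
    {x : E d} (hx : ‖x‖ ≤ R) :
    |commutator v c k (t, x)| ≤ (L * A + D * A) * unitVol d * K ∧
    |commutator v c k (t, x)| ≤ (L * A + D * A) * unitVol d *
      ⨍ y in Metric.closedBall x ε, ‖v (t, y) - v (t, x)‖ := by
  have hL0 : 0 ≤ L := (norm_nonneg _).trans (hL x (by linarith))
  have hD0 : 0 ≤ D := (abs_nonneg _).trans (h.div_bound x)
  have h0 : ∀ y, ε < ‖y - x‖ → adv (fun y => c t y - c t x) (tau (-x) k) y = 0 := fun y hy => by
    rw [adv, hk.tau_radius hy, hk.fderiv_tau_radius hy]; simp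
  have hb := h.abs_adv_tau_le hA hε hε' hk hL hx
  have hc : ContDiff ℝ 1 fun y => c t y - c t x := h.contDiff.sub contDiff_const
  have hk1 : ContDiff ℝ 1 (tau (-x) k) := (hk.isTest.tau (-x)).1.of_le (by simp)
  refine ⟨(abs_integral_mul_le_average hε h.locallyIntegrable hb h0).trans
    (mul_le_mul_of_nonneg_left (average_le hε h.bound)
      (mul_nonneg (by positivity) unitVol_nonneg)), ?_⟩
  have := h.integral_sub_value (continuous_adv hc hk1)
    (HasCompactSupport.intro (isCompact_closedBall x ε) fun y hy => h0 y (by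
      rw [Metric.mem_closedBall, dist_eq_norm] at hy; exact not_le.1 hy)) (v (t, x))
  rw [integral_adv_eq_zero hc hk1 (hk.isTest.tau (-x)).2, mul_zero, sub_zero] at this
  simp only [commutator]
  rw [← this]
  exact abs_integral_mul_le_average hε (h.locallyIntegrable_sub _) hb h0

theorem ae_tendsto_average (h : GoodTime K M D v c t) {δ : ℕ → ℝ} (hδ : ∀ n, 0 < δ n)
    (hδ' : Tendsto δ atTop (𝓝 0)) : ∀ᵐ x, Tendsto
      (fun n => ⨍ y in Metric.closedBall x (δ n), ‖v (t, y) - v (t, x)‖) atTop (𝓝 0) := by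
  filter_upwards [IsUnifLocDoublingMeasure.ae_tendsto_average_norm_sub volume h.locallyIntegrable 1]
    with x hx
  exact hx (fun _ => x) δ (tendsto_nhdsWithin_iff.2 ⟨hδ', Eventually.of_forall hδ⟩)
    (Eventually.of_forall fun n => by
      rw [Metric.mem_closedBall, dist_self, one_mul]; exact (hδ n).le)

/-- The energy identity for the mollified equation at a fixed time. -/
theorem integral_mollify_mul_drift (h : GoodTime K M D v c t) (hk : IsTest k) {χ : E d → ℝ}
    (hχ : ContDiff ℝ 1 χ) (hχ' : HasCompactSupport χ)
    (hi : Integrable fun x => χ x * mollify v k (t, x) * commutator v c k (t, x)) :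
    2 * ∫ x, χ x * mollify v k (t, x) * drift v c t (tau (-x) k)
      = ∫ x, (mollify v k (t, x) ^ 2 * adv (c t) χ x
        + 2 * (χ x * mollify v k (t, x) * commutator v c k (t, x))) := by
  set g : E d → ℝ := fun x => mollify v k (t, x) with hg
  obtain ⟨hg1, -⟩ := h.hasFDerivAt_mollify hk
  have hgf : Continuous (fderiv ℝ g) := hg1.continuous_fderiv one_ne_zero
  have hf1 : ContDiff ℝ 1 fun x => χ x * g x ^ 2 := hχ.mul (hg1.pow 2)
  -- The divergence theorem for χ g² c trades the term 2χ g c·∇g for g² times `adv c χ`, which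
  -- contains no derivative of g.
  have h0 := integral_adv_eq_zero h.contDiff hf1 hχ'.mul_right
  have e : ∀ x, adv (c t) (fun x => χ x * g x ^ 2) x
      = g x ^ 2 * adv (c t) χ x + 2 * (χ x * g x * fderiv ℝ g x (c t x)) := fun x => by
    have h1 : HasFDerivAt (fun x => χ x * g x ^ 2) _ x :=
      (hχ.differentiable one_ne_zero x).hasFDerivAt.mul
        ((hg1.differentiable one_ne_zero x).hasFDerivAt.pow 2)
    rw [adv, h1.fderiv, adv]
    simp only [add_apply, smul_apply, smul_eq_mul]
    ring
  have i1 : Integrable fun x => χ x * g x * fderiv ℝ g x (c t x) :=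
    ((hχ.continuous.mul hg1.continuous).mul (hgf.clm_apply
      h.contDiff.continuous)).integrable_of_hasCompactSupport hχ'.mul_right.mul_right
  have hχa : HasCompactSupport (adv (c t) χ) := by
    obtain ⟨R, -, hR⟩ := exists_radius hχ'
    exact HasCompactSupport.intro (isCompact_closedBall (0 : E d) R) fun x hx =>
      adv_eq_zero_of_radius hR (by simpa using hx)
  have i2 : Integrable fun x => g x ^ 2 * adv (c t) χ x :=
    ((hg1.continuous.pow 2).mul (continuous_adv h.contDiff hχ)).integrable_of_hasCompactSupport
      hχa.mul_left
  rw [integral_congr_ae (Eventually.of_forall e)] at h0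
  rw [integral_add i2 (i1.const_mul 2), integral_const_mul] at h0
  have e2 : ∀ x, χ x * g x * drift v c t (tau (-x) k)
      = χ x * g x * commutator v c k (t, x) - χ x * g x * fderiv ℝ g x (c t x) := fun x => by
    rw [h.drift_tau_eq hk, mul_sub]
  rw [integral_congr_ae (Eventually.of_forall e2), integral_sub hi i1, integral_add i2 (hi.const_mul 2), integral_const_mul]
  linarith

end GoodTime

end RoughTransport
end

noncomputable section
namespace RoughTransport

/-! ### Energy estimate and uniqueness of weak solutions of the transport equation -/

variable {d : ℕ} {T K M D : ℝ}

/-- Forgetting the middle variable carries measurability in (t,y) over to ((t,x),y), as needed for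
integrals over y with parameters (t,x). -/
theorem quasiMeasurePreserving_skip (d : ℕ) (T : ℝ) :
    Measure.QuasiMeasurePreserving (fun p : (ℝ × E d) × E d => (p.1.1, p.2))
      ((spaceTime d T).prod volume) (spaceTime d T) := by
  have h1 : Measure.QuasiMeasurePreserving (MeasurableEquiv.prodAssoc (α := ℝ) (β := E d)
      (γ := E d)) ((spaceTime d T).prod volume)
      ((volume.restrict (Icc (0 : ℝ) T)).prod (volume.prod volume)) :=
    (measurePreserving_prodAssoc _ _ _).quasiMeasurePreserving
  have h2 : Measure.QuasiMeasurePreserving (Prod.map id Prod.snd : ℝ × E d × E d → ℝ × E d)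
      ((volume.restrict (Icc (0 : ℝ) T)).prod (volume.prod volume)) (spaceTime d T) :=
    QuasiMeasurePreserving.prodMap (Measure.QuasiMeasurePreserving.id _) Measure.quasiMeasurePreserving_snd
  exact h2.comp h1

theorem aestronglyMeasurable_skip {F : Type*} [TopologicalSpace F] {f : ℝ × E d → F}
    (hf : AEStronglyMeasurable f (spaceTime d T)) :
    AEStronglyMeasurable (fun p : (ℝ × E d) × E d => f (p.1.1, p.2))
      ((spaceTime d T).prod volume) :=
  hf.comp_quasiMeasurePreserving (quasiMeasurePreserving_skip d T)

theorem aestronglyMeasurable_mollify {v : ℝ × E d → ℝ} (hv : IsBdd T K v) {k : E d → ℝ}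
    (hk : IsTest k) : AEStronglyMeasurable (mollify v k) (spaceTime d T) := by
  have h : AEStronglyMeasurable (fun p : (ℝ × E d) × E d => v (p.1.1, p.2) * tau (-p.1.2) k p.2)
      ((spaceTime d T).prod volume) := by
    refine (aestronglyMeasurable_skip hv.meas).mul (Continuous.aestronglyMeasurable ?_)
    exact hk.continuous.comp (by fun_prop)
  exact h.integral_prod_right'

theorem aestronglyMeasurable_fderiv_apply {α : Type*} [MeasurableSpace α] {μ : Measure α}
    {k : E d → ℝ} (hk : IsTest k) {a b : α → E d} (ha : AEStronglyMeasurable a μ)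
    (hb : AEStronglyMeasurable b μ) :
    AEStronglyMeasurable (fun y => fderiv ℝ k (a y) (b y)) μ := by
  have h1 : AEStronglyMeasurable (fun y => fderiv ℝ k (a y)) μ :=
    (hk.1.continuous_fderiv (by simp)).comp_aestronglyMeasurable ha
  exact (isBoundedBilinearMap_apply (𝕜 := ℝ) (E := E d) (F := ℝ)).continuous
    |>.comp_aestronglyMeasurable (h1.prodMk hb)

theorem aestronglyMeasurable_drift_tau {v : ℝ × E d → ℝ} {c : ℝ → E d → E d} (hv : IsBdd T K v)
    (hc : IsRegular T M D c) {k : E d → ℝ} (hk : IsTest k) :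
    AEStronglyMeasurable (fun z : ℝ × E d => drift v c z.1 (tau (-z.2) k)) (spaceTime d T) := by
  have h : AEStronglyMeasurable
      (fun p : (ℝ × E d) × E d => v (p.1.1, p.2) * adv (c p.1.1) (tau (-p.1.2) k) p.2)
      ((spaceTime d T).prod volume) := by
    refine (aestronglyMeasurable_skip hv.meas).mul (AEStronglyMeasurable.add ?_
      ((aestronglyMeasurable_skip hc.div_meas).mul (Continuous.aestronglyMeasurable
        (hk.continuous.comp (by fun_prop)))))
    simp_rw [fderiv_tau]
    exact aestronglyMeasurable_fderiv_apply hk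
      (Continuous.aestronglyMeasurable (by fun_prop)) (aestronglyMeasurable_skip hc.meas)
  exact h.integral_prod_right'

theorem aestronglyMeasurable_commutator {v : ℝ × E d → ℝ} {c : ℝ → E d → E d} (hv : IsBdd T K v)
    (hc : IsRegular T M D c) {k : E d → ℝ} (hk : IsTest k) :
    AEStronglyMeasurable (commutator v c k) (spaceTime d T) := by
  have h : AEStronglyMeasurable (fun p : (ℝ × E d) × E d => v (p.1.1, p.2) *
        adv (fun y => c p.1.1 y - c p.1.1 p.1.2) (tau (-p.1.2) k) p.2)
      ((spaceTime d T).prod volume) := by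
    simp only [adv, divergence_sub_const]
    refine (aestronglyMeasurable_skip hv.meas).mul (AEStronglyMeasurable.add ?_
      ((aestronglyMeasurable_skip hc.div_meas).mul (Continuous.aestronglyMeasurable
        (hk.continuous.comp (by fun_prop)))))
    simp_rw [fderiv_tau]
    exact aestronglyMeasurable_fderiv_apply hk
      (Continuous.aestronglyMeasurable (by fun_prop))
      ((aestronglyMeasurable_skip hc.meas).sub hc.meas.comp_fst)
  exact h.integral_prod_right'

theorem aestronglyMeasurable_adv {c : ℝ → E d → E d} (hc : IsRegular T M D c) {χ : E d → ℝ}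
    (hχ : ContDiff ℝ 1 χ) :
    AEStronglyMeasurable (fun z : ℝ × E d => adv (c z.1) χ z.2) (spaceTime d T) := by
  refine AEStronglyMeasurable.add ?_ (hc.div_meas.mul
    (hχ.continuous.comp continuous_snd).aestronglyMeasurable)
  have h1 : AEStronglyMeasurable (fun z : ℝ × E d => fderiv ℝ χ z.2) (spaceTime d T) :=
    ((hχ.continuous_fderiv one_ne_zero).comp continuous_snd).aestronglyMeasurable
  exact (isBoundedBilinearMap_apply (𝕜 := ℝ) (E := E d) (F := ℝ)).continuous
    |>.comp_aestronglyMeasurable (h1.prodMk hc.meas)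

/-- The weighted energy of a primitive vanishing at time zero. -/
theorem energy_primitive_le (hT : 0 < T) {β : ℝ → ℝ} (hβ : IntegrableOn β (Icc 0 T)) (l : ℝ) :
    l * ∫ t in Icc 0 T, Real.exp (-l * t) * (∫ s in (0 : ℝ)..t, β s) ^ 2
      ≤ 2 * ∫ t in Icc 0 T, Real.exp (-l * t) * ((∫ s in (0 : ℝ)..t, β s) * β t) := by
  obtain ⟨h1, h2⟩ := primitive_ac hT hβ
  set B : ℝ → ℝ := fun t => ∫ s in (0 : ℝ)..t, β s with hB
  have he : Continuous fun t : ℝ => Real.exp (-l * t) := by fun_prop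
  have hd : ∀ t, HasDerivAt (fun t : ℝ => Real.exp (-l * t)) (Real.exp (-l * t) * -l) t :=
    fun t => by simpa using ((hasDerivAt_id t).const_mul (-l)).exp
  have h3 : AbsolutelyContinuousOnInterval (fun t : ℝ => Real.exp (-l * t)) 0 T := by
    have hi : Continuous fun t : ℝ => Real.exp (-l * t) * -l := by fun_prop
    have := ((hi.intervalIntegrable 0 T).absolutelyContinuousOnInterval_intervalIntegral
      (left_mem_uIcc (a := (0 : ℝ)) (b := T)))
    have h4 : AbsolutelyContinuousOnInterval (fun _ : ℝ => (1 : ℝ)) 0 T :=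
      (LipschitzOnWith.absolutelyContinuousOnInterval (K := 0)
        ((LipschitzWith.const (1 : ℝ)).lipschitzOnWith))
    have h5 := h4.add this
    have e : (fun t : ℝ => Real.exp (-l * t))
        = (fun _ : ℝ => (1 : ℝ)) + fun t => ∫ s in (0 : ℝ)..t, Real.exp (-l * s) * -l := by
      funext t
      rw [Pi.add_apply, intervalIntegral.integral_eq_sub_of_hasDerivAt (fun s _ => hd s)
        (hi.intervalIntegrable _ _)]
      simp
    rwa [e]
  have hBc : ContinuousOn B (Icc 0 T) := by
    have := h1.continuousOn
    rwa [uIcc_of_le hT.le] at this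
  have h6 := (h3.mul (h1.mul h1)).integral_deriv_eq_sub
  have hB0 : B 0 = 0 := intervalIntegral.integral_same
  -- The derivative of e^{-lt}B² integrates to its value at T, which is nonnegative, since B(0) = 0;
  -- dropping that value gives the inequality.
  have h7 : 0 ≤ ∫ t in (0 : ℝ)..T, deriv ((fun t : ℝ => Real.exp (-l * t)) * (B * B)) t := by
    rw [h6]
    simp only [Pi.mul_apply, hB0, mul_zero, sub_zero]
    exact mul_nonneg (Real.exp_pos _).le (mul_self_nonneg _)
  have i1 : IntegrableOn (fun t => Real.exp (-l * t) * B t ^ 2) (Icc 0 T) :=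
    (he.continuousOn.mul (hBc.pow 2)).integrableOn_Icc
  have i2 : IntegrableOn (fun t => Real.exp (-l * t) * (B t * β t)) (Icc 0 T) :=
    (hβ.continuousOn_mul hBc isCompact_Icc).continuousOn_mul he.continuousOn isCompact_Icc
  have h8 : ∫ t in (0 : ℝ)..T, deriv ((fun t : ℝ => Real.exp (-l * t)) * (B * B)) t
      = ∫ t in Icc 0 T, (2 * (Real.exp (-l * t) * (B t * β t))
        - l * (Real.exp (-l * t) * B t ^ 2)) := by
    rw [intervalIntegral.integral_of_le hT.le, ← integral_Icc_eq_integral_Ioc]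
    refine integral_congr_ae ?_
    filter_upwards [h2] with t ht
    have := ((hd t).mul (ht.mul ht)).deriv
    refine this.trans ?_
    simp only [Pi.mul_apply]; ring
  rw [h8, integral_sub (i2.const_mul 2) (i1.const_mul l), integral_const_mul,
    integral_const_mul] at h7
  linarith

/-- For a fixed x, testing with the translated kernel and zero initial datum shows that t ↦ `mollify
v k (t, x)` agrees almost everywhere with the primitive of its drift. -/
theorem IsWeakTransport.integral_mollify_sq_le (hT : 0 < T) {v : ℝ × E d → ℝ}
    {c : ℝ → E d → E d} (hv : IsBdd T K v) (hc : IsRegular T M D c)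
    (hw : IsWeakTransport T c (fun _ => 0) v) {k : E d → ℝ} (hk : IsTest k) (l : ℝ) (x : E d) :
    l * ∫ t in Icc 0 T, Real.exp (-l * t) * mollify v k (t, x) ^ 2
      ≤ 2 * ∫ t in Icc 0 T, Real.exp (-l * t) *
        (mollify v k (t, x) * drift v c t (tau (-x) k)) := by
  have hβ : IntegrableOn (fun r => drift v c r (tau (-x) k)) (Icc 0 T) :=
    integrableOn_drift hv hc hk (a := fun _ => -x) continuous_const (H := ‖x‖) (by simp)
  have h := energy_primitive_le hT hβ l
  have e : ∀ᵐ t ∂(volume.restrict (Icc 0 T)),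
      mollify v k (t, x) = ∫ s in (0 : ℝ)..t, drift v c s (tau (-x) k) := by
    filter_upwards [hw _ (hk.tau (-x))] with t ht
    rw [mollify, ht]; simp
  rw [integral_congr_ae (f := fun t => Real.exp (-l * t) * mollify v k (t, x) ^ 2)
      (e.mono fun t ht => by beta_reduce; rw [ht]),
    integral_congr_ae (f := fun t => Real.exp (-l * t) *
      (mollify v k (t, x) * drift v c t (tau (-x) k))) (g := fun t => Real.exp (-l * t) *
      ((∫ s in (0 : ℝ)..t, drift v c s (tau (-x) k)) * drift v c t (tau (-x) k)))
      (e.mono fun t ht => by beta_reduce; rw [ht])]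
  exact h

theorem exp_neg_mul_le {l t : ℝ} (hl : 0 ≤ l) (ht : 0 ≤ t) : Real.exp (-l * t) ≤ 1 := by
  rw [Real.exp_le_one_iff, neg_mul]
  exact neg_nonpos.2 (mul_nonneg hl ht)

theorem exists_adv_bound {c : ℝ → E d → E d} (hc : IsRegular T M D c) {χ : E d → ℝ}
    (hχ : ContDiff ℝ 1 χ) (hχ' : HasCompactSupport χ) :
    ∃ B, 0 ≤ B ∧ ∀ᵐ z ∂(spaceTime d T), |adv (c z.1) χ z.2| ≤ B := by
  obtain ⟨A₀, h0⟩ := hχ'.exists_bound_of_continuous hχ.continuous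
  obtain ⟨A₁, h1⟩ := (hχ'.fderiv (𝕜 := ℝ)).exists_bound_of_continuous
    (hχ.continuous_fderiv one_ne_zero)
  have hA0 : 0 ≤ A₀ := (norm_nonneg _).trans (h0 0)
  have hA1 : 0 ≤ A₁ := (norm_nonneg _).trans (h1 0)
  have := hc.M_nonneg
  have := hc.D_nonneg
  refine ⟨A₁ * M + D * A₀, by positivity, ?_⟩
  filter_upwards [ae_spaceTime_of_ae_time hc.bound, ae_spaceTime_of_ae_time hc.div_bound]
    with z h2 h3
  refine (abs_add_le _ _).trans (add_le_add ?_ ?_)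
  · exact ((fderiv ℝ χ z.2).le_opNorm _).trans (mul_le_mul (h1 _) (h2 _) (norm_nonneg _) hA1)
  · rw [abs_mul]; exact mul_le_mul (h3 _) (h0 _) (abs_nonneg _) hc.D_nonneg

/-- The localized energy inequality for the mollified equation. -/
theorem IsWeakTransport.energy_mollify_le (hT : 0 < T) {v : ℝ × E d → ℝ}
    {c : ℝ → E d → E d} (hv : IsBdd T K v) (hc : IsRegular T M D c)
    (hw : IsWeakTransport T c (fun _ => 0) v) {k : E d → ℝ} {A ε : ℝ} (hA : 0 ≤ A) (hε : 0 < ε)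
    (hε' : ε ≤ 1) (hk : IsKernel A ε k) {l : ℝ} (hl : 0 ≤ l) {χ : E d → ℝ} (hχ : ContDiff ℝ 1 χ)
    (hχ0 : ∀ x, 0 ≤ χ x) (hχ' : HasCompactSupport χ) :
    l * ∫ z, Real.exp (-l * z.1) * (χ z.2 * mollify v k z ^ 2) ∂(spaceTime d T)
      ≤ ∫ z, Real.exp (-l * z.1) * (mollify v k z ^ 2 * adv (c z.1) χ z.2
        + 2 * (χ z.2 * mollify v k z * commutator v c k z)) ∂(spaceTime d T) := by
  obtain ⟨A₀, h0⟩ := hχ'.exists_bound_of_continuous hχ.continuous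
  have hA0 : 0 ≤ A₀ := (norm_nonneg _).trans (h0 0)
  obtain ⟨R, -, hR⟩ := exists_radius hχ'
  obtain ⟨L, hL⟩ := hc.deriv_bound (R + 1)
  obtain ⟨B, hB0, hB⟩ := exists_adv_bound hc hχ hχ'
  have hgood := ae_spaceTime_of_ae_time (d := d) (ae_goodTime hv hc)
  have hexp : ∀ᵐ z ∂(spaceTime d T), |Real.exp (-l * z.1)| ≤ 1 := by
    filter_upwards [ae_mem_spaceTime] with z hz
    rw [abs_of_pos (Real.exp_pos _)]
    exact exp_neg_mul_le hl hz.1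
  have me : AEStronglyMeasurable (fun z : ℝ × E d => Real.exp (-l * z.1)) (spaceTime d T) :=
    Continuous.aestronglyMeasurable (by fun_prop)
  have mχ : AEStronglyMeasurable (fun z : ℝ × E d => χ z.2) (spaceTime d T) :=
    (hχ.continuous.comp continuous_snd).aestronglyMeasurable
  have mg := aestronglyMeasurable_mollify (k := k) hv hk.isTest
  have mw := aestronglyMeasurable_drift_tau (k := k) hv hc hk.isTest
  have mr := aestronglyMeasurable_commutator (k := k) hv hc hk.isTest
  have ma := aestronglyMeasurable_adv hc hχ
  set G := A * unitVol d * K with hG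
  have hG0 : 0 ≤ G := mul_nonneg (mul_nonneg hA unitVol_nonneg) hv.nonneg
  have bg : ∀ᵐ z ∂(spaceTime d T), |mollify v k z| ≤ G := by
    filter_upwards [hgood] with z hz using hz.abs_mollify_le hA hε hk z.2
  obtain ⟨W, hW0, hW⟩ := hk.isTest.exists_drift_bound K M D R hv.nonneg hc.M_nonneg hc.D_nonneg
  have i1 : Integrable (fun z : ℝ × E d => Real.exp (-l * z.1) * (χ z.2 * mollify v k z ^ 2))
      (spaceTime d T) := by
    refine integrable_cyl (B := 1 * (A₀ * G ^ 2)) (R := R) (me.mul (mχ.mul (mg.pow 2))) ?_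
      fun z hz => by rw [hR _ hz, zero_mul, mul_zero]
    filter_upwards [hexp, bg] with z h1 h2
    rw [abs_mul, abs_mul, abs_pow]
    gcongr
    exact h0 _
  have i2 : Integrable (fun z : ℝ × E d => Real.exp (-l * z.1) *
      (χ z.2 * mollify v k z * drift v c z.1 (tau (-z.2) k))) (spaceTime d T) := by
    refine integrable_cyl (B := 1 * (A₀ * G * W)) (R := R) (me.mul ((mχ.mul mg).mul mw)) ?_
      fun z hz => by rw [hR _ hz, zero_mul, zero_mul, mul_zero]
    filter_upwards [hexp, bg, hgood] with z h1 h2 h3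
    by_cases hz : ‖z.2‖ ≤ R
    · have h4 := hW v c z.1 h3 (-z.2) (by rwa [norm_neg])
      rw [abs_mul, abs_mul, abs_mul]
      gcongr
      exact h0 _
    · rw [hR _ (not_le.1 hz), zero_mul, zero_mul, mul_zero, abs_zero]; positivity
  have br : ∀ᵐ z ∂(spaceTime d T),
      |χ z.2 * mollify v k z * commutator v c k z| ≤ A₀ * G * |(L * A + D * A) * unitVol d * K| := by
    filter_upwards [bg, hgood, ae_spaceTime_of_ae_time hL] with z h2 h3 h4
    by_cases hz : ‖z.2‖ ≤ R
    · have h5 := ((h3.commutator_bounds hA hε hε' hk h4 hz).1).trans (le_abs_self _)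
      rw [abs_mul, abs_mul]
      gcongr
      exact h0 _
    · rw [hR _ (not_le.1 hz), zero_mul, zero_mul, abs_zero]; positivity
  have i4 : Integrable (fun z : ℝ × E d => χ z.2 * mollify v k z * commutator v c k z)
      (spaceTime d T) :=
    integrable_cyl ((mχ.mul mg).mul mr) br fun z hz => by rw [hR _ hz, zero_mul, zero_mul]
  have i5 : Integrable (fun z : ℝ × E d => mollify v k z ^ 2 * adv (c z.1) χ z.2)
      (spaceTime d T) := by
    refine integrable_cyl (B := G ^ 2 * B) (R := R) ((mg.pow 2).mul ma) ?_
      fun z hz => by rw [adv_eq_zero_of_radius hR hz, mul_zero]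
    filter_upwards [bg, hB] with z h1 h2
    rw [abs_mul, abs_pow]
    gcongr
  have i3 : Integrable (fun z : ℝ × E d => Real.exp (-l * z.1) *
      (mollify v k z ^ 2 * adv (c z.1) χ z.2
        + 2 * (χ z.2 * mollify v k z * commutator v c k z))) (spaceTime d T) :=
    (i5.add (i4.const_mul 2)).bdd_mul me (c := 1) hexp
  have i4s : ∀ᵐ t ∂(volume.restrict (Icc 0 T)), Integrable fun x =>
      χ x * mollify v k (t, x) * commutator v c k (t, x) := i4.prod_right_ae
  -- The right-hand side is rewritten at each fixed time by the spatial energy identity.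
  have e1 : ∫ z, Real.exp (-l * z.1) * (mollify v k z ^ 2 * adv (c z.1) χ z.2
        + 2 * (χ z.2 * mollify v k z * commutator v c k z)) ∂(spaceTime d T)
      = 2 * ∫ z, Real.exp (-l * z.1) *
        (χ z.2 * mollify v k z * drift v c z.1 (tau (-z.2) k)) ∂(spaceTime d T) := by
    rw [spaceTime, integral_prod _ i3, integral_prod _ i2, ← integral_const_mul]
    refine integral_congr_ae ?_
    filter_upwards [ae_goodTime hv hc, i4s] with t ht hit
    simp only [integral_const_mul]
    rw [← ht.integral_mollify_mul_drift hk.isTest hχ hχ' hit]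
    ring
  -- The order of integration is now reversed: the energy inequality in time is used at each fixed x
  -- and integrated against χ.
  rw [e1, spaceTime, integral_prod_symm _ i1, integral_prod_symm _ i2, ← integral_const_mul,
    ← integral_const_mul]
  refine integral_mono (i1.integral_prod_right.const_mul l) (i2.integral_prod_right.const_mul 2)
    fun x => ?_
  have h := mul_le_mul_of_nonneg_left
    (hw.integral_mollify_sq_le hT hv hc hk.isTest l x) (hχ0 x)
  have f1 : ∀ t, Real.exp (-l * t) * (χ x * mollify v k (t, x) ^ 2)
      = χ x * (Real.exp (-l * t) * mollify v k (t, x) ^ 2) := fun t => by ring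
  have f2 : ∀ t, Real.exp (-l * t) * (χ x * mollify v k (t, x) * drift v c t (tau (-x) k))
      = χ x * (Real.exp (-l * t) * (mollify v k (t, x) * drift v c t (tau (-x) k))) :=
    fun t => by ring
  simp only [f1, f2, integral_const_mul]
  linarith

end RoughTransport
end

/-! ### Removal of the mollification and the weighted Gronwall argument. -/

noncomputable section
namespace RoughTransport

variable {d : ℕ} {T K M D : ℝ}

/-- Passing from almost every x at almost every t to almost every (t,x) requires a measurable set of
convergence, obtained by replacing the functions with measurable representatives. -/
theorem ae_tendsto_of_ae_ae {f : ℕ → ℝ × E d → ℝ} {g : ℝ × E d → ℝ}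
    (hf : ∀ n, AEStronglyMeasurable (f n) (spaceTime d T))
    (hg : AEStronglyMeasurable g (spaceTime d T))
    (h : ∀ᵐ t ∂(volume.restrict (Icc 0 T)), ∀ᵐ x, Tendsto (fun n => f n (t, x)) atTop
      (𝓝 (g (t, x)))) :
    ∀ᵐ z ∂(spaceTime d T), Tendsto (fun n => f n z) atTop (𝓝 (g z)) := by
  have h1 : ∀ᵐ z ∂(spaceTime d T), (∀ n, f n z = (hf n).mk _ z) ∧ g z = hg.mk _ z :=
    (ae_all_iff.2 fun n => (hf n).ae_eq_mk).and hg.ae_eq_mk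
  have hS : MeasurableSet {z | Tendsto (fun n => (hf n).mk _ z - hg.mk _ z) atTop (𝓝 0)} :=
    measurableSet_tendsto _ fun n =>
      ((hf n).stronglyMeasurable_mk.sub hg.stronglyMeasurable_mk).measurable
  have h2 : ∀ᵐ z ∂(spaceTime d T),
      z ∈ {z | Tendsto (fun n => (hf n).mk _ z - hg.mk _ z) atTop (𝓝 0)} := by
    refine (Measure.ae_prod_mem_iff_ae_ae_mem hS).2 ?_
    filter_upwards [h, Measure.ae_ae_of_ae_prod h1] with t h3 h4
    filter_upwards [h3, h4] with x h5 h6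
    simp only [← h6.1, ← h6.2]
    exact tendsto_sub_nhds_zero_iff.2 h5
  filter_upwards [h1, h2] with z h3 h4
  simp only [← h3.1, ← h3.2] at h4
  exact tendsto_sub_nhds_zero_iff.1 h4

/-- The localized energy inequality. -/
theorem IsWeakTransport.energy_le (hT : 0 < T) {v : ℝ × E d → ℝ}
    {c : ℝ → E d → E d} (hv : IsBdd T K v) (hc : IsRegular T M D c)
    (hw : IsWeakTransport T c (fun _ => 0) v) {l : ℝ} (hl : 0 ≤ l) {χ : E d → ℝ}
    (hχ : ContDiff ℝ 1 χ) (hχ0 : ∀ x, 0 ≤ χ x) (hχ' : HasCompactSupport χ) :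
    l * ∫ z, Real.exp (-l * z.1) * (χ z.2 * v z ^ 2) ∂(spaceTime d T)
      ≤ ∫ z, Real.exp (-l * z.1) * (v z ^ 2 * adv (c z.1) χ z.2) ∂(spaceTime d T) := by
  obtain ⟨A, hA, hker⟩ := exists_isKernel d
  set δ : ℕ → ℝ := fun n => 1 / ((n : ℝ) + 1) with hδ
  have hδ0 : ∀ n, 0 < δ n := fun n => Nat.one_div_pos_of_nat
  have hδ1 : ∀ n, δ n ≤ 1 := fun n => by
    rw [hδ]; beta_reduce
    rw [div_le_one (by positivity)]
    linarith [(Nat.cast_nonneg n : (0 : ℝ) ≤ n)]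
  have hδt : Tendsto δ atTop (𝓝 0) := tendsto_one_div_add_atTop_nhds_zero_nat
  choose k hk using fun n => hker (δ n) (hδ0 n)
  obtain ⟨A₀, h0⟩ := hχ'.exists_bound_of_continuous hχ.continuous
  have hA0 : 0 ≤ A₀ := (norm_nonneg _).trans (h0 0)
  obtain ⟨R, -, hR⟩ := exists_radius hχ'
  obtain ⟨L, hL⟩ := hc.deriv_bound (R + 1)
  obtain ⟨B, hB0, hB⟩ := exists_adv_bound hc hχ hχ'
  have hgood := ae_spaceTime_of_ae_time (d := d) (ae_goodTime hv hc)
  have hexp : ∀ᵐ z ∂(spaceTime d T), |Real.exp (-l * z.1)| ≤ 1 := by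
    filter_upwards [ae_mem_spaceTime] with z hz
    rw [abs_of_pos (Real.exp_pos _)]
    exact exp_neg_mul_le hl hz.1
  have me : AEStronglyMeasurable (fun z : ℝ × E d => Real.exp (-l * z.1)) (spaceTime d T) :=
    Continuous.aestronglyMeasurable (by fun_prop)
  have mχ : AEStronglyMeasurable (fun z : ℝ × E d => χ z.2) (spaceTime d T) :=
    (hχ.continuous.comp continuous_snd).aestronglyMeasurable
  have mg := fun n => aestronglyMeasurable_mollify hv (hk n).isTest
  have mr := fun n => aestronglyMeasurable_commutator hv hc (hk n).isTest
  have ma := aestronglyMeasurable_adv hc hχ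
  set G := A * unitVol d * K with hG
  have hG0 : 0 ≤ G := mul_nonneg (mul_nonneg hA unitVol_nonneg) hv.nonneg
  set Q := |(L * A + D * A) * unitVol d * K| with hQ
  have bg : ∀ n, ∀ᵐ z ∂(spaceTime d T), |mollify v (k n) z| ≤ G := fun n => by
    filter_upwards [hgood] with z hz using hz.abs_mollify_le hA (hδ0 n) (hk n) z.2
  have br : ∀ n, ∀ᵐ z ∂(spaceTime d T), |χ z.2 * commutator v c (k n) z| ≤ A₀ * Q := fun n => by
    filter_upwards [hgood, ae_spaceTime_of_ae_time hL] with z h3 h4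
    by_cases hz : ‖z.2‖ ≤ R
    · have h5 := ((h3.commutator_bounds hA (hδ0 n) (hδ1 n) (hk n) h4 hz).1).trans (le_abs_self _)
      rw [abs_mul]
      gcongr
      exact h0 _
    · rw [hR _ (not_le.1 hz), zero_mul, abs_zero]; positivity
  have tg : ∀ᵐ z ∂(spaceTime d T), Tendsto (fun n => mollify v (k n) z) atTop (𝓝 (v z)) := by
    refine ae_tendsto_of_ae_ae mg hv.meas ?_
    filter_upwards [ae_goodTime hv hc] with t ht
    filter_upwards [ht.ae_tendsto_average hδ0 hδt] with x hx
    rw [← tendsto_sub_nhds_zero_iff]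
    refine squeeze_zero_norm (fun n => ht.abs_mollify_sub_le (hδ0 n) (hk n) x) ?_
    simpa using hx.const_mul (A * unitVol d)
  -- The cutoff χ confines x to a ball on which the commutator is bounded by a constant times the
  -- mean oscillation of v.
  have tr : ∀ᵐ z ∂(spaceTime d T),
      Tendsto (fun n => χ z.2 * commutator v c (k n) z) atTop (𝓝 0) := by
    refine ae_tendsto_of_ae_ae (g := fun _ => 0) (fun n => mχ.mul (mr n))
      aestronglyMeasurable_const ?_
    filter_upwards [ae_goodTime hv hc, hL] with t ht htL
    filter_upwards [ht.ae_tendsto_average hδ0 hδt] with x hx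
    by_cases hxR : ‖x‖ ≤ R
    · have h1 : Tendsto (fun n => commutator v c (k n) (t, x)) atTop (𝓝 0) := by
        refine squeeze_zero_norm
          (fun n => (ht.commutator_bounds hA (hδ0 n) (hδ1 n) (hk n) htL hxR).2) ?_
        simpa using hx.const_mul ((L * A + D * A) * unitVol d)
      simpa using h1.const_mul (χ x)
    · simp [hR x (not_le.1 hxR)]
  have hball : ∀ b : ℝ, Integrable (fun z : ℝ × E d =>
      (Metric.closedBall (0 : E d) R).indicator (fun _ => b) z.2) (spaceTime d T) := fun b =>
    (integrable_indicator_ball b R).comp_snd (volume.restrict (Icc (0 : ℝ) T))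
  have hdom : ∀ (f : ℝ × E d → ℝ) (b : ℝ), (∀ᵐ z ∂(spaceTime d T), |f z| ≤ b) →
      (∀ z : ℝ × E d, R < ‖z.2‖ → f z = 0) → ∀ᵐ z ∂(spaceTime d T),
      ‖f z‖ ≤ (Metric.closedBall (0 : E d) R).indicator (fun _ => b) z.2 := by
    intro f b h1 h2
    filter_upwards [h1] with z hz
    by_cases hzR : z.2 ∈ Metric.closedBall (0 : E d) R
    · rwa [indicator_of_mem hzR]
    · rw [indicator_of_notMem hzR, h2 z (by simpa using hzR), norm_zero]
  have l1 : Tendsto (fun n => ∫ z, Real.exp (-l * z.1) * (χ z.2 * mollify v (k n) z ^ 2)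
      ∂(spaceTime d T)) atTop
      (𝓝 (∫ z, Real.exp (-l * z.1) * (χ z.2 * v z ^ 2) ∂(spaceTime d T))) := by
    refine tendsto_integral_of_dominated_convergence _
      (fun n => me.mul (mχ.mul ((mg n).pow 2))) (hball (1 * (A₀ * G ^ 2))) (fun n => ?_) ?_
    · refine hdom _ _ ?_ fun z hz => by rw [hR _ hz, zero_mul, mul_zero]
      filter_upwards [hexp, bg n] with z h1 h2
      rw [abs_mul, abs_mul, abs_pow]
      gcongr
      exact h0 _
    · filter_upwards [tg] with z hz
      exact ((hz.pow 2).const_mul _).const_mul _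
  have l2 : Tendsto (fun n => ∫ z, Real.exp (-l * z.1) *
      (mollify v (k n) z ^ 2 * adv (c z.1) χ z.2
        + 2 * (χ z.2 * mollify v (k n) z * commutator v c (k n) z)) ∂(spaceTime d T)) atTop
      (𝓝 (∫ z, Real.exp (-l * z.1) * (v z ^ 2 * adv (c z.1) χ z.2) ∂(spaceTime d T))) := by
    refine tendsto_integral_of_dominated_convergence _
      (fun n => me.mul ((((mg n).pow 2).mul ma).add
        (((mχ.mul (mg n)).mul (mr n)).const_mul 2)))
      (hball (1 * (G ^ 2 * B + 2 * (G * (A₀ * Q))))) (fun n => ?_) ?_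
    · refine hdom _ _ ?_ fun z hz => by
        rw [hR _ hz, adv_eq_zero_of_radius hR hz]; simp
      filter_upwards [hexp, bg n, br n, hB] with z h1 h2 h3 h4
      have h5 : |mollify v (k n) z ^ 2 * adv (c z.1) χ z.2| ≤ G ^ 2 * B := by
        rw [abs_mul, abs_pow]
        gcongr
      have h6 : |2 * (χ z.2 * mollify v (k n) z * commutator v c (k n) z)|
          ≤ 2 * (G * (A₀ * Q)) := by
        have e : χ z.2 * mollify v (k n) z * commutator v c (k n) z
            = mollify v (k n) z * (χ z.2 * commutator v c (k n) z) := by ring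
        rw [e, abs_mul, abs_mul, abs_two]
        gcongr
      rw [abs_mul]
      exact mul_le_mul h1 ((abs_add_le _ _).trans (add_le_add h5 h6)) (abs_nonneg _) zero_le_one
    · filter_upwards [tg, tr] with z h1 h2
      have h3 := ((h1.pow 2).mul_const (adv (c z.1) χ z.2)).add ((h1.mul h2).const_mul 2)
      rw [mul_zero, mul_zero, add_zero] at h3
      refine Tendsto.const_mul _ (h3.congr fun n => ?_)
      ring
  exact le_of_tendsto_of_tendsto' (l1.const_mul l) l2 fun n =>
    hw.energy_mollify_le hT hv hc hA (hδ0 n) (hδ1 n) (hk n) hl hχ hχ0 hχ'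

/-- Since 2|x| ≤ 1 + |x|², the polynomial weight controls its own gradient. Transport at bounded
speed then changes the weighted energy at a bounded rate, although the weight is integrable. -/
theorem norm_fderiv_weight_le (x : E d) :
    ‖fderiv ℝ (weight (d := d)) x‖ ≤ (d + 1) * weight x := by
  have hp : 0 < 1 + ‖x‖ ^ 2 := by positivity
  have h1 : HasDerivAt (fun r : ℝ => ((1 + r) ^ (d + 1))⁻¹)
      (-(((d + 1 : ℕ) : ℝ) * (1 + ‖x‖ ^ 2) ^ (d + 1 - 1) * 1) / ((1 + ‖x‖ ^ 2) ^ (d + 1)) ^ 2)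
      (‖x‖ ^ 2) :=
    HasDerivAt.fun_inv (((hasDerivAt_id (‖x‖ ^ 2)).const_add 1).pow (d + 1)) (by positivity)
  have h2 := h1.comp_hasFDerivAt x (hasStrictFDerivAt_norm_sq x).hasFDerivAt
  have e : fderiv ℝ (weight (d := d)) x = _ := h2.fderiv
  rw [e, norm_smul, Real.norm_eq_abs, abs_div, abs_neg, mul_one, Nat.add_sub_cancel,
    abs_of_pos (by positivity), abs_of_pos (by positivity), weight]
  have h3 : ‖2 • innerSL ℝ x‖ ≤ 1 + ‖x‖ ^ 2 := by
    rw [two_nsmul]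
    refine (norm_add_le _ _).trans ?_
    rw [innerSL_apply_norm]
    nlinarith [sq_nonneg (‖x‖ - 1)]
  calc _ ≤ ((d + 1 : ℕ) : ℝ) * (1 + ‖x‖ ^ 2) ^ d / ((1 + ‖x‖ ^ 2) ^ (d + 1)) ^ 2
        * (1 + ‖x‖ ^ 2) := mul_le_mul_of_nonneg_left h3 (by positivity)
    _ = _ := by push_cast; field_simp; ring

/-- Smooth cutoff functions on large balls. -/
theorem exists_cutoff (d : ℕ) : ∃ (C : ℝ) (η : ℕ → E d → ℝ), 0 ≤ C ∧ ∀ n, IsTest (η n) ∧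
    (∀ x, 0 ≤ η n x) ∧ (∀ x, η n x ≤ 1) ∧ (∀ x, ‖fderiv ℝ (η n) x‖ ≤ C * (1 / ((n : ℝ) + 1))) ∧
    ∀ x, ‖x‖ ≤ n → η n x = 1 := by
  let f : ContDiffBump (0 : E d) := ⟨1, 2, by norm_num, by norm_num⟩
  have hc : ContDiff ℝ ∞ f := f.contDiff
  have hs : HasCompactSupport f := f.hasCompactSupport
  obtain ⟨C, hC⟩ := (hs.fderiv (𝕜 := ℝ)).exists_bound_of_continuous
    (hc.continuous_fderiv (by simp))
  refine ⟨C, fun n x => f ((1 / ((n : ℝ) + 1)) • x), (norm_nonneg _).trans (hC 0), fun n => ?_⟩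
  have hn : (0 : ℝ) < 1 / ((n : ℝ) + 1) := Nat.one_div_pos_of_nat
  refine ⟨⟨hc.comp (contDiff_const_smul _), hs.comp_smul hn.ne'⟩, fun x => f.nonneg,
    fun x => f.le_one, fun x => ?_, fun x hx => ?_⟩
  · rw [fderiv_comp_smul, norm_smul, Real.norm_of_nonneg hn.le, mul_comm]
    exact mul_le_mul_of_nonneg_right (hC _) hn.le
  · refine f.one_of_mem_closedBall ?_
    rw [mem_closedBall_zero_iff, norm_smul, Real.norm_of_nonneg hn.le, one_div_mul_eq_div]
    exact (div_le_one (by positivity)).2 (by linarith)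

theorem adv_weight_mul_le {c : E d → E d} {η : E d → ℝ} {C : ℝ} {x : E d} (hM : ‖c x‖ ≤ M)
    (hD : |divergence c x| ≤ D) (hη : DifferentiableAt ℝ η x) (h0 : 0 ≤ η x)
    (hη' : ‖fderiv ℝ η x‖ ≤ C) :
    adv c (fun y => weight y * η y) x ≤ ((d + 1) * M + D) * (weight x * η x) + C * M * weight x := by
  have h1 : HasFDerivAt (fun y => weight y * η y) _ x :=
    (((contDiff_weight (n := 1)).differentiable one_ne_zero) x).hasFDerivAt.mul hη.hasFDerivAt
  rw [adv, h1.fderiv]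
  simp only [add_apply, smul_apply, smul_eq_mul]
  have hw := (weight_pos x).le
  have b1 : fderiv ℝ η x (c x) ≤ C * M := (le_abs_self _).trans
    (((fderiv ℝ η x).le_opNorm _).trans (mul_le_mul hη' hM (norm_nonneg _)
      ((norm_nonneg _).trans hη')))
  have b2 : fderiv ℝ weight x (c x) ≤ (d + 1) * weight x * M := (le_abs_self _).trans
    (((fderiv ℝ weight x).le_opNorm _).trans (mul_le_mul (norm_fderiv_weight_le x) hM
      (norm_nonneg _) (by positivity)))
  have b3 := mul_le_mul_of_nonneg_left b1 hw
  have b4 := mul_le_mul_of_nonneg_left b2 h0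
  have b5 := mul_le_mul_of_nonneg_right ((le_abs_self _).trans hD) (mul_nonneg hw h0)
  linarith

/-- A weak solution of the transport equation with zero initial condition vanishes. -/
theorem IsWeakTransport.ae_eq_zero (hT : 0 < T) {v : ℝ × E d → ℝ}
    {c : ℝ → E d → E d} (hv : IsBdd T K v) (hc : IsRegular T M D c)
    (hw : IsWeakTransport T c (fun _ => 0) v) : ∀ᵐ z ∂(spaceTime d T), v z = 0 := by
  obtain ⟨C, η, hC, hη⟩ := exists_cutoff d
  have hM := hc.M_nonneg
  have hD := hc.D_nonneg
  -- The rate exceeds the growth constant (d+1)M + D by one, so after absorption one full copy of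
  -- the weighted energy remains on the left.
  set l : ℝ := (d + 1) * M + D + 1 with hldef
  have hl : 0 ≤ l := by positivity
  have hexp : ∀ᵐ z ∂(spaceTime d T), |Real.exp (-l * z.1)| ≤ 1 := by
    filter_upwards [ae_mem_spaceTime] with z hz
    rw [abs_of_pos (Real.exp_pos _)]
    exact exp_neg_mul_le hl hz.1
  have me : AEStronglyMeasurable (fun z : ℝ × E d => Real.exp (-l * z.1)) (spaceTime d T) :=
    Continuous.aestronglyMeasurable (by fun_prop)
  have hwc : Continuous (weight (d := d)) := (contDiff_weight (n := 0)).continuous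
  have mw : AEStronglyMeasurable (fun z : ℝ × E d => weight z.2) (spaceTime d T) :=
    (hwc.comp continuous_snd).aestronglyMeasurable
  have mη : ∀ n, AEStronglyMeasurable (fun z : ℝ × E d => η n z.2) (spaceTime d T) := fun n =>
    ((hη n).1.continuous.comp continuous_snd).aestronglyMeasurable
  have iw : Integrable (fun z : ℝ × E d => K ^ 2 * weight z.2) (spaceTime d T) :=
    (integrable_weight.comp_snd (volume.restrict (Icc (0 : ℝ) T))).const_mul _
  have bv : ∀ᵐ z ∂(spaceTime d T), |v z| ^ 2 ≤ K ^ 2 := by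
    filter_upwards [hv.bound] with z hz
    gcongr
  have hb : ∀ n, ∀ᵐ z ∂(spaceTime d T),
      ‖Real.exp (-l * z.1) * (weight z.2 * η n z.2 * v z ^ 2)‖ ≤ K ^ 2 * weight z.2 := fun n => by
    filter_upwards [hexp, hv.bound] with z h1 h2
    rw [norm_mul, norm_mul, norm_mul, norm_pow, Real.norm_of_nonneg (weight_pos _).le,
      Real.norm_of_nonneg ((hη n).2.1 _)]
    calc _ ≤ 1 * (weight z.2 * 1 * K ^ 2) := by
          have := (weight_pos z.2).le
          have := (hη n).2.1 z.2
          gcongr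
          exacts [h1, (hη n).2.2.1 _, h2]
      _ = _ := by ring
  have i0 : Integrable (fun z : ℝ × E d => Real.exp (-l * z.1) * (weight z.2 * v z ^ 2))
      (spaceTime d T) := by
    refine iw.mono' (me.mul (mw.mul (hv.meas.pow 2))) ?_
    filter_upwards [hexp, hv.bound] with z h1 h2
    rw [norm_mul, norm_mul, norm_pow, Real.norm_of_nonneg (weight_pos _).le]
    calc _ ≤ 1 * (weight z.2 * K ^ 2) := by
          have := (weight_pos z.2).le
          gcongr
          exacts [h1, h2]
      _ = _ := by ring
  have i1 : ∀ n, Integrable (fun z : ℝ × E d =>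
      Real.exp (-l * z.1) * (weight z.2 * η n z.2 * v z ^ 2)) (spaceTime d T) := fun n =>
    iw.mono' (me.mul ((mw.mul (mη n)).mul (hv.meas.pow 2))) (hb n)
  set J := ∫ z, Real.exp (-l * z.1) * (weight z.2 * v z ^ 2) ∂(spaceTime d T) with hJ
  -- The only remaining error comes from the gradient of the cutoff, of size 1/(n+1) times the
  -- finite energy J; in the limit J ≤ 0.
  have key : ∀ n : ℕ, ∫ z, Real.exp (-l * z.1) * (weight z.2 * η n z.2 * v z ^ 2) ∂(spaceTime d T)
      ≤ 1 / ((n : ℝ) + 1) * (C * M * J) := fun n => by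
    have hχ : ContDiff ℝ 1 fun x => weight x * η n x :=
      contDiff_weight.mul ((hη n).1.1.of_le (by simp))
    have h1 := hw.energy_le hT hv hc hl hχ
      (fun x => mul_nonneg (weight_pos x).le ((hη n).2.1 x)) (hη n).1.2.mul_left
    obtain ⟨B, hB0, hB⟩ := exists_adv_bound hc hχ (hη n).1.2.mul_left
    obtain ⟨R, -, hR⟩ := (hη n).1.exists_radius
    have i2 : Integrable (fun z : ℝ × E d => Real.exp (-l * z.1) *
        (v z ^ 2 * adv (c z.1) (fun x => weight x * η n x) z.2)) (spaceTime d T) := by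
      refine integrable_cyl (B := 1 * (K ^ 2 * B)) (R := R)
        (me.mul ((hv.meas.pow 2).mul (aestronglyMeasurable_adv hc hχ))) ?_ fun z hz => by
          rw [adv_eq_zero_of_radius (fun x hx => by rw [hR x hx, mul_zero]) hz]; simp
      filter_upwards [hexp, bv, hB] with z h2 h3 h4
      rw [abs_mul, abs_mul, abs_pow]
      gcongr
    have h2 : ∫ z, Real.exp (-l * z.1) *
        (v z ^ 2 * adv (c z.1) (fun x => weight x * η n x) z.2) ∂(spaceTime d T)
        ≤ ∫ z, ((l - 1) * (Real.exp (-l * z.1) * (weight z.2 * η n z.2 * v z ^ 2))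
          + 1 / ((n : ℝ) + 1) * (C * M) * (Real.exp (-l * z.1) * (weight z.2 * v z ^ 2)))
          ∂(spaceTime d T) := by
      refine integral_mono_ae i2 (((i1 n).const_mul _).add (i0.const_mul _)) ?_
      filter_upwards [ae_spaceTime_of_ae_time hc.bound, ae_spaceTime_of_ae_time hc.div_bound]
        with z h3 h4
      have h5 := adv_weight_mul_le (h3 z.2) (h4 z.2) ((hη n).1.differentiable z.2)
        ((hη n).2.1 z.2) ((hη n).2.2.2.1 z.2)
      have h6 := mul_le_mul_of_nonneg_left h5
        (mul_nonneg (Real.exp_pos (-l * z.1)).le (sq_nonneg (v z)))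
      rw [hldef] at h6 ⊢
      linarith
    rw [integral_add ((i1 n).const_mul _) (i0.const_mul _), integral_const_mul,
      integral_const_mul] at h2
    linarith
  have lim : Tendsto (fun n => ∫ z, Real.exp (-l * z.1) * (weight z.2 * η n z.2 * v z ^ 2)
      ∂(spaceTime d T)) atTop (𝓝 J) := by
    refine tendsto_integral_of_dominated_convergence _ (fun n => (i1 n).aestronglyMeasurable)
      iw hb (Eventually.of_forall fun z => ?_)
    refine tendsto_const_nhds.congr' ?_
    filter_upwards [eventually_ge_atTop ⌈‖z.2‖⌉₊] with n hn
    rw [(hη n).2.2.2.2 z.2 (Nat.ceil_le.1 hn), mul_one]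
  have lim' : Tendsto (fun n : ℕ => 1 / ((n : ℝ) + 1) * (C * M * J)) atTop (𝓝 0) := by
    simpa using tendsto_one_div_add_atTop_nhds_zero_nat.mul_const (C * M * J)
  have hJ0 : J ≤ 0 := le_of_tendsto_of_tendsto' lim lim' key
  have hnn : ∀ z : ℝ × E d, 0 ≤ Real.exp (-l * z.1) * (weight z.2 * v z ^ 2) := fun z =>
    mul_nonneg (Real.exp_pos _).le (mul_nonneg (weight_pos _).le (sq_nonneg _))
  have h0 := (integral_eq_zero_iff_of_nonneg hnn i0).1 (le_antisymm hJ0 (integral_nonneg hnn))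
  filter_upwards [h0] with z hz
  have h1 : weight z.2 * v z ^ 2 = 0 := (mul_eq_zero.1 hz).resolve_left (Real.exp_pos _).ne'
  exact pow_eq_zero_iff two_ne_zero |>.1 ((mul_eq_zero.1 h1).resolve_left (weight_pos _).ne')

end RoughTransport
end

noncomputable section
namespace RoughTransport

/-! ### From the transport equation to the rough transport equation -/

variable {d : ℕ} {T γ K M D : ℝ}

/-- The path matters on [0,T] only; freezing it outside gives a globally continuous bounded shift,
which acts measurably on all of space-time. -/
theorem IsHolder.exists_extension {X : ℝ → E d} (hT : 0 < T) (hγ : 0 < γ) (hX : IsHolder T γ X) :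
    ∃ Z : ℝ → E d, Continuous Z ∧ (∀ t ∈ Icc 0 T, Z t = X t) ∧ ∃ H, ∀ t, ‖Z t‖ ≤ H := by
  have hc := hX.continuousOn hγ
  obtain ⟨H, hH⟩ := isCompact_Icc.exists_bound_of_continuousOn hc
  refine ⟨fun t => X (projIcc 0 T hT.le t), ?_, fun t ht => ?_, H, fun t => hH _ (Subtype.prop _)⟩
  · exact (continuousOn_iff_continuous_domRestrict.1 hc).comp continuous_projIcc
  · beta_reduce; rw [projIcc_of_mem hT.le ht]

theorem measurePreserving_shift {Z : ℝ → E d} (hZ : Continuous Z) :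
    MeasurePreserving (fun z : ℝ × E d => (z.1, z.2 + Z z.1)) (spaceTime d T) (spaceTime d T) :=
  (MeasurePreserving.id _).skew_product (g := fun t x => x + Z t)
    (by simp only [Function.uncurry_def]; fun_prop)
    (Eventually.of_forall fun t => map_add_right_eq_self _ (Z t))

theorem IsBdd.shift {u : ℝ × E d → ℝ} (hu : IsBdd T K u) {Z : ℝ → E d} (hZ : Continuous Z) :
    IsBdd T K (shift Z u) :=
  ⟨hu.nonneg, hu.meas.comp_measurePreserving (measurePreserving_shift hZ),
    (measurePreserving_shift hZ).quasiMeasurePreserving.ae hu.bound⟩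

theorem IsBdd.sub {u u' : ℝ × E d → ℝ} {K' : ℝ} (hu : IsBdd T K u) (hu' : IsBdd T K' u') :
    IsBdd T (K + K') (u - u') := by
  refine ⟨add_nonneg hu.nonneg hu'.nonneg, hu.meas.sub hu'.meas, ?_⟩
  filter_upwards [hu.bound, hu'.bound] with z h1 h2
  exact (abs_sub _ _).trans (add_le_add h1 h2)

theorem IsRegular.shiftField {b : ℝ → E d → E d} (hb : IsRegular T M D b) {Z : ℝ → E d}
    (hZ : Continuous Z) {H : ℝ} (hH : ∀ t, ‖Z t‖ ≤ H) : IsRegular T M D (shiftField Z b) where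
  M_nonneg := hb.M_nonneg
  D_nonneg := hb.D_nonneg
  meas := hb.meas.comp_measurePreserving (measurePreserving_shift hZ)
  div_meas := by
    have := hb.div_meas.comp_measurePreserving (measurePreserving_shift hZ)
    refine this.congr (Eventually.of_forall fun z => ?_)
    exact (divergence_comp_add _ _ _).symm
  contDiff := by
    filter_upwards [hb.contDiff] with t ht
    exact ht.comp (contDiff_id.add contDiff_const)
  bound := by
    filter_upwards [hb.bound] with t ht x using ht _
  div_bound := by
    filter_upwards [hb.div_bound] with t ht x
    have := divergence_comp_add (b t) (Z t) x
    exact (congrArg abs this).le.trans (ht _)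
  deriv_bound := fun R => by
    obtain ⟨C, hC⟩ := hb.deriv_bound (R + H)
    refine ⟨C, ?_⟩
    filter_upwards [hC] with t ht x hx
    have e : fderiv ℝ (RoughTransport.shiftField Z b t) x = fderiv ℝ (b t) (x + Z t) :=
      fderiv_comp_add_right (Z t)
    rw [e]
    exact ht _ ((norm_add_le _ _).trans (add_le_add hx (hH t)))

theorem ae_abs_le_of_memLp_top {α : Type*} [MeasurableSpace α] {μ : Measure α} {f : α → ℝ}
    (hf : MemLp f ∞ μ) : ∃ C, 0 ≤ C ∧ ∀ᵐ x ∂μ, |f x| ≤ C := by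
  refine ⟨(eLpNorm f ∞ μ).toReal, ENNReal.toReal_nonneg, ?_⟩
  filter_upwards [ae_le_eLpNormEssSup (f := f) (μ := μ)] with x hx
  rw [← eLpNorm_exponent_top] at hx
  have := ENNReal.toReal_mono hf.eLpNorm_ne_top hx
  rwa [toReal_enorm] at this

theorem IsLinftyC1.exists_isRegular {b : ℝ → E d → E d} (hb : IsLinftyC1 T b)
    (hdiv : MemLp (fun z : ℝ × E d => divergence (b z.1) z.2) ∞ (spaceTime d T)) :
    ∃ M D, IsRegular T M D b := by
  obtain ⟨M, hM⟩ := hb.bounded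
  obtain ⟨D, hD0, hD⟩ := ae_abs_le_of_memLp_top hdiv
  refine ⟨|M|, D, abs_nonneg M, hD0, hb.aestronglyMeasurable, hdiv.1, hb.contDiff, ?_, ?_,
    hb.deriv_bounded⟩
  · filter_upwards [hM] with t ht x using (ht x).trans (le_abs_self M)
  · filter_upwards [hb.contDiff, Measure.ae_ae_of_ae_prod hD] with t h1 h2 x
    -- At almost every time the divergence is continuous in space, so its essential bound holds at
    -- every point: a closed set of full measure is everything.
    have hcl : IsClosed {x | |divergence (b t) x| ≤ D} :=
      isClosed_le (continuous_divergence h1).abs continuous_const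
    have := (Measure.dense_of_ae h2).closure_eq
    rw [hcl.closure_eq] at this
    exact this.symm.subset (mem_univ x)

theorem drift_congr {u u' : ℝ × E d → ℝ} {b : ℝ → E d → E d} {r : ℝ} {φ : E d → ℝ}
    (h : ∀ᵐ x, u (r, x) = u' (r, x)) : drift u b r φ = drift u' b r φ :=
  integral_congr_ae (h.mono fun x hx => by beta_reduce; rw [hx])

theorem intervalIntegral_congr_Icc {f g : ℝ → ℝ}
    (h : ∀ᵐ t ∂(volume.restrict (Icc 0 T)), f t = g t) {t : ℝ} (ht : t ∈ Icc 0 T) :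
    ∫ s in (0 : ℝ)..t, f s = ∫ s in (0 : ℝ)..t, g s := by
  refine intervalIntegral.integral_congr_ae ?_
  filter_upwards [(ae_restrict_iff' measurableSet_Icc).1 h] with s hs hst
  rw [uIoc_of_le ht.1] at hst
  exact hs ⟨hst.1.le, hst.2.trans ht.2⟩

theorem IsSolutionVersion.congr {b : ℝ → E d → E d} {X : ℝ → E d}
    {XX : ℝ → ℝ → Matrix (Fin d) (Fin d) ℝ} {u₀ : E d → ℝ} {u u' : ℝ × E d → ℝ}
    {U : (E d → ℝ) → ℝ → ℝ} (hU : IsSolutionVersion T γ b X XX u₀ u U)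
    (h : ∀ᵐ z ∂(spaceTime d T), u z = u' z) : IsSolutionVersion T γ b X XX u₀ u' U := by
  have hs := Measure.ae_ae_of_ae_prod h
  intro φ hφ
  obtain ⟨h1, h2, h3⟩ := hU φ hφ
  refine ⟨?_, h2, fun t ht => ?_⟩
  · filter_upwards [h1, hs] with t ht1 ht2
    rw [ht1]
    exact integral_congr_ae (ht2.mono fun x hx => by beta_reduce; rw [hx])
  · obtain ⟨I, hI, e⟩ := h3 t ht
    refine ⟨I, hI, ?_⟩
    rw [e, intervalIntegral_congr_Icc (hs.mono fun s hs' => drift_congr hs') ht]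

theorem IsWeakTransport.sub {c : ℝ → E d → E d} {v₀ : E d → ℝ} {v v' : ℝ × E d → ℝ} {K' : ℝ}
    (hv : IsBdd T K v) (hv' : IsBdd T K' v') (hc : IsRegular T M D c)
    (hw : IsWeakTransport T c v₀ v) (hw' : IsWeakTransport T c v₀ v') :
    IsWeakTransport T c (fun _ => 0) (v - v') := by
  intro φ hφ
  filter_upwards [hw φ hφ, hw' φ hφ, integrable_slice_mul hv, integrable_slice_mul hv',
    ae_restrict_mem measurableSet_Icc] with t h1 h2 h3 h4 ht
  have h0 : (0 : ℝ) ∈ Icc 0 T := ⟨le_rfl, ht.1.trans ht.2⟩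
  have e1 : ∫ x, (v - v') (t, x) * φ x
      = (∫ x, v (t, x) * φ x) - ∫ x, v' (t, x) * φ x := by
    rw [← integral_sub (h3 φ hφ) (h4 φ hφ)]
    simp only [Pi.sub_apply, sub_mul]
  have e2 : ∫ s in (0 : ℝ)..t, drift (v - v') c s φ
      = (∫ s in (0 : ℝ)..t, drift v c s φ) - ∫ s in (0 : ℝ)..t, drift v' c s φ := by
    rw [← intervalIntegral.integral_sub (intervalIntegrable_drift hv hc hφ h0 ht)
      (intervalIntegrable_drift hv' hc hφ h0 ht)]
    refine intervalIntegral_congr_Icc ?_ ht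
    filter_upwards [ae_goodTime hv hc, ae_goodTime hv' hc] with s g1 g2
    rw [drift, drift, drift, ← integral_sub (g1.integrable_drift hφ) (g2.integrable_drift hφ)]
    simp only [Pi.sub_apply, sub_mul]
  rw [e1, e2, h1, h2]
  simp

theorem Lp_top_isBdd (u : Lp ℝ ∞ (spaceTime d T)) : ∃ K, IsBdd T K u := by
  obtain ⟨K, hK, h⟩ := ae_abs_le_of_memLp_top (Lp.memLp u)
  exact ⟨K, hK, Lp.aestronglyMeasurable u, h⟩

theorem existsUnique_isWeakControlledSolution (hT : 0 < T) (hγ : 1 / 3 < γ) (hγ' : γ ≤ 1 / 2)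
    {b : ℝ → E d → E d} (hb : IsRegular T M D b) {X : ℝ → E d}
    {XX : ℝ → ℝ → Matrix (Fin d) (Fin d) ℝ} (hX : IsGeometricRoughPath T γ X XX)
    (u₀ : Lp ℝ ∞ (volume : Measure (E d))) :
    ∃! u : Lp ℝ ∞ (spaceTime d T), IsWeakControlledSolution T γ b X XX u₀ u := by
  obtain ⟨Z, hZ, hZX, H, hH⟩ := hX.1.path_holder.exists_extension hT (by linarith)
  have hc := hb.shiftField hZ hH
  obtain ⟨K, hK, hu₀⟩ := ae_abs_le_of_memLp_top (Lp.memLp u₀)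
  have hmp : MeasurePreserving (fun x : E d => x + Z 0) volume volume :=
    measurePreserving_add_right volume (Z 0)
  obtain ⟨v, hv, hw⟩ := exists_isWeakTransport (v₀ := fun x => u₀ (x + Z 0)) hT hc
    ((Lp.aestronglyMeasurable u₀).comp_measurePreserving hmp) hK
    (hmp.quasiMeasurePreserving.ae hu₀)
  have hv' := hv.shift (Z := fun t => -Z t) hZ.neg
  have hmem : MemLp (shift (fun t => -Z t) v) ∞ (spaceTime d T) :=
    memLp_top_of_bound hv'.meas K hv'.bound
  have hsol := isSolutionVersion_shiftVersion (u₀ := u₀) (b := b) hT hγ hγ' hv hc hw hX hZ hZX hH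
    rfl rfl
  -- Existence: the weak solution of the shifted equation is shifted back, and its L^∞ class
  -- inherits the same continuous versions.
  refine ⟨hmem.toLp _, ⟨_, hsol.congr (hmem.coeFn_toLp.mono fun z hz => hz.symm)⟩, ?_⟩
  suffices h : ∀ u u' : Lp ℝ ∞ (spaceTime d T), IsWeakControlledSolution T γ b X XX u₀ u →
      IsWeakControlledSolution T γ b X XX u₀ u' → u = u' from
    fun u hu => h _ _ hu ⟨_, hsol.congr (hmem.coeFn_toLp.mono fun z hz => hz.symm)⟩
  rintro u u' ⟨U, hU⟩ ⟨U', hU'⟩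
  obtain ⟨K₁, h1⟩ := Lp_top_isBdd u
  obtain ⟨K₂, h2⟩ := Lp_top_isBdd u'
  -- Uniqueness: both solutions, seen along the noise, solve the same transport equation with the
  -- same initial datum; their difference vanishes, and the inverse shift preserves null sets.
  have w1 := IsSolutionVersion.isWeakTransport hT hγ hγ' hb hX hZ hZX hH h1 hU
  have w2 := IsSolutionVersion.isWeakTransport hT hγ hγ' hb hX hZ hZX hH h2 hU'
  have b1 := h1.shift hZ
  have b2 := h2.shift hZ
  have h0 := (w1.sub b1 b2 hc w2).ae_eq_zero hT (b1.sub b2) hc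
  have h3 := (measurePreserving_shift (T := T) hZ.neg).quasiMeasurePreserving.ae h0
  refine Lp.ext ?_
  filter_upwards [h3] with z hz
  simp only [Pi.sub_apply, shift, neg_add_cancel_right, Pi.neg_apply] at hz
  exact sub_eq_zero.1 hz

end RoughTransport
end

theorem mainTheorem6 (d : ℕ) (T : ℝ) (hT : 0 < T) (γ : ℝ) (hγ : 1 / 3 < γ) (hγ' : γ ≤ 1 / 2)
    (b : ℝ → RoughTransport.E d → RoughTransport.E d)
    (hb : RoughTransport.IsLinftyC1 T b)
    (hdiv : MemLp (fun z : ℝ × RoughTransport.E d => RoughTransport.divergence (b z.1) z.2) ∞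
      (RoughTransport.spaceTime d T))
    (X : ℝ → RoughTransport.E d) (XX : ℝ → ℝ → Matrix (Fin d) (Fin d) ℝ)
    (hX : RoughTransport.IsGeometricRoughPath T γ X XX)
    (u₀ : Lp ℝ ∞ (volume : Measure (RoughTransport.E d))) :
    ∃! u : Lp ℝ ∞ (RoughTransport.spaceTime d T),
      RoughTransport.IsWeakControlledSolution T γ b X XX u₀ u := by
  obtain ⟨M, D, h⟩ := hb.exists_isRegular hdiv
  exact RoughTransport.existsUnique_isWeakControlledSolution hT hγ hγ' h hX u₀
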